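/- Let $T=\{x\in\mathbb{R}^2: 0<x_1,\ 0<x_2,\ x_1+x_2<1\}$ be the reference triangle, let $\gamma_i=\{x\in\overline{T}: x_i=0\}$ and $\omega_i(x)=\min\{x_i,1\}$ (which equals $x_i$ on $T$) for $i\in\{1,2\}$, and let $1<p<\infty$. All functions are real-valued. For real $s=m+\sigma\ge 0$ with $m\in\mathbb{N}_0$ and $\sigma\in[0,1)$, $W^{s,p}(T)$ is the Sobolev–Slobodeckij space with norm $$\|f\|_{s,p,T}^p=\sum_{|\alpha|\le m}\int_T|D^\alpha f|^p\,dx+\begin{cases}\displaystyle\sum_{|\alpha|=m}\iint_{T\times T}\frac{|D^\alpha f(x)-D^\alpha f(y)|^p}{|x-y|^{\sigma p+2}}\,dx\,dy&\text{if }\sigma>0,\\ 0&\text{if }\sigma=0,\end{cases}$$ where $D^\alpha$ are weak derivatives, and $\|\cdot\|_{p,T}$ is the norm of $L^p(T)=W^{0,p}(T)$. For $\mathfrak{E}\subseteq\{\gamma_1,\gamma_2\}$ put $$\|f\|_{\mathfrak{E},s,p,T}^p=\|f\|_{s,p,T}^p+\begin{cases}\displaystyle\sum_{|\alpha|=m}\Big\|\operatorname{dist}\Big(\cdot,\bigcup_{\gamma\in\mathfrak{E}}\gamma\Big)^{-\sigma}D^\alpha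 f\Big\|_{p,T}^p&\text{if }\sigma p=1\text{ and }\mathfrak{E}\ne\emptyset,\\ 0&\text{otherwise,}\end{cases}$$ and let $W^{s,p}_{\mathfrak{E}}(T)$ be the space of all $f\in W^{s,p}(T)$ such that $\|f\|_{\mathfrak{E},s,p,T}<\infty$ and, in the sense of traces, $D^\beta f|_\gamma=0$ for all $\gamma\in\mathfrak{E}$ and all multi-indices $\beta$ with $0\le|\beta|<s-\frac1p$. For $\mathfrak{E}=\{\gamma\}$ write $W^{s,p}_\gamma(T)$ and $\|\cdot\|_{\gamma,s,p,T}$. **Theorem.** (a) Let $0\le s<\infty$. There is a constant $C$ depending only on $s$ and $p$ such that, for every nonempty $\mathfrak{E}\subseteq\{\gamma_1,\gamma_2\}$ and every $i\in\{1,2\}$ with $\gamma_i\in\mathfrak{E}$: (i) if $f\in W^{s+1,p}(T)\cap W^{1,p}_{\mathfrak{E}}(T)$, then $\omega_i^{-1}f\in W^{s,p}(T)$, with $$\|\omega_i^{-1}f\|_{s,p,T}\le C\|f\|_{s+1,p,T}\qquad\text{and}\qquad\|\omega_i^{-1}f\|_{s,p,T}\le C\|\partial_i f\|_{s,p,T};$$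 (ii) if $f\in W^{s+1,p}_{\mathfrak{E}}(T)$, then $\omega_i^{-1}f\in W^{s,p}_{\mathfrak{E}}(T)$, with $$\|\omega_i^{-1}f\|_{\mathfrak{E},s,p,T}\le C\|f\|_{\mathfrak{E},s+1,p,T}\qquad\text{and}\qquad\|\omega_i^{-1}f\|_{\mathfrak{E},s,p,T}\le C\|\partial_i f\|_{\mathfrak{E},s,p,T}.$$ (b) Let $0\le s<1$. There is a constant $C$ depending only on $s$ and $p$ such that, for $i\in\{1,2\}$ and every $f\in W^{s,p}_{\gamma_i}(T)$, one has $\omega_i^{-s}f\in L^p(T)$ and $$\|\omega_i^{-s}f\|_{p,T}\le C\|f\|_{\gamma_i,s,p,T}.$$ -/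

import Mathlib

open MeasureTheory Set Filter Topology
open scoped NNReal ENNReal ContDiff

noncomputable section

namespace TriHardy

/-- The Euclidean plane. -/
abbrev Plane : Type := EuclideanSpace ℝ (Fin 2)

/-- The open reference triangle `T = {x : 0 < x₁, 0 < x₂, x₁ + x₂ < 1}`; the coordinates
`x₁, x₂` of the mathematics are `x 0, x 1` here. -/
def tri : Set Plane := {x | 0 < x 0 ∧ 0 < x 1 ∧ x 0 + x 1 < 1}

/-- Lebesgue measure on the triangle. -/
def triMeasure : Measure Plane := volume.restrict tri

/-- Unit speed parametrization (for `t ∈ [0, 1]`) of the edge of `T` on which the `i`-th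
coordinate vanishes: `(0, t)` for `i = 0` and `(t, 0)` for `i = 1`. -/
def edgePoint (i : Fin 2) (t : ℝ) : Plane := if i = 0 then !₂[0, t] else !₂[t, 0]

/-- The closed edge `γ_i` of `T` on which the `i`-th coordinate vanishes. -/
def edge (i : Fin 2) : Set Plane := edgePoint i '' Icc 0 1

/-- The barycentric coordinate `ω_i(x) = min(x_i, 1)`, extended to the whole plane. -/
def baryCoord (i : Fin 2) (x : Plane) : ℝ := min (x i) 1

/-- The classical partial derivative `∂_i φ`. -/
def partialDeriv (i : Fin 2) (φ : Plane → ℝ) (x : Plane) : ℝ :=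
  fderiv ℝ φ x (EuclideanSpace.single i 1)

/-- The classical derivative `D^α φ = ∂₁^{α₁} ∂₂^{α₂} φ` (for smooth `φ`). -/
def multiDeriv (α : ℕ × ℕ) (φ : Plane → ℝ) : Plane → ℝ :=
  (partialDeriv 0)^[α.1] ((partialDeriv 1)^[α.2] φ)

/-- `φ ∈ C_c^∞(T)`. -/
def IsTestFun (φ : Plane → ℝ) : Prop :=
  ContDiff ℝ ∞ φ ∧ HasCompactSupport φ ∧ tsupport φ ⊆ tri

/-- `g` is the weak derivative `D^α f` on `T`. -/
def IsWeakDeriv (α : ℕ × ℕ) (f g : Plane → ℝ) : Prop :=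
  LocallyIntegrableOn f tri volume ∧ LocallyIntegrableOn g tri volume ∧
    ∀ φ : Plane → ℝ, IsTestFun φ →
      ∫ x in tri, f x * multiDeriv α φ x = (-1) ^ (α.1 + α.2) * ∫ x in tri, g x * φ x

open Classical in
/-- The weak derivative `D^α f` on `T` (unique almost everywhere on `T` when it exists;
zero by convention when it does not). -/
def weakDeriv (α : ℕ × ℕ) (f : Plane → ℝ) : Plane → ℝ :=
  if h : ∃ g, IsWeakDeriv α f g then h.choose else 0

/-- The multi-index of the first order derivative `∂_i`. -/
def unitIndex (i : Fin 2) : ℕ × ℕ := if i = 0 then (1, 0) else (0, 1)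

/-- `∫_T |v|^p`. -/
def lpPow (p : ℝ) (v : Plane → ℝ) : ℝ≥0∞ := ∫⁻ x in tri, ‖v x‖ₑ ^ p

/-- The Gagliardo double integral `∬_{T × T} |v(x) - v(y)|^p / |x - y|^{σ p + 2} dx dy`. -/
def gagliardoPow (σ p : ℝ) (v : Plane → ℝ) : ℝ≥0∞ :=
  ∫⁻ x in tri, ∫⁻ y in tri, ‖v x - v y‖ₑ ^ p / edist x y ^ (σ * p + 2)

/-- The `p`-th power of the Sobolev-Slobodeckij norm of order `s = m + σ`, where
`m = ⌊s⌋₊` and `σ = Int.fract s`. -/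
def sobolevPow (s p : ℝ) (f : Plane → ℝ) : ℝ≥0∞ :=
  (∑ n ∈ Finset.range (⌊s⌋₊ + 1), ∑ α ∈ Finset.HasAntidiagonal.antidiagonal n, lpPow p (weakDeriv α f)) +
    if 0 < Int.fract s then
      ∑ α ∈ Finset.HasAntidiagonal.antidiagonal ⌊s⌋₊, gagliardoPow (Int.fract s) p (weakDeriv α f)
    else 0

/-- The norm `‖f‖_{s,p,T}` (meaningful for functions that have weak derivatives up to order
`⌊s⌋₊`, see `MemSobolev`). -/
def sobolevNorm (s p : ℝ) (f : Plane → ℝ) : ℝ≥0∞ := sobolevPow s p f ^ (1 / p)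

/-- `f ∈ W^{s,p}(T)`. -/
def MemSobolev (s p : ℝ) (f : Plane → ℝ) : Prop :=
  MemLp f (ENNReal.ofReal p) triMeasure ∧
    (∀ α : ℕ × ℕ, α.1 + α.2 ≤ ⌊s⌋₊ → ∃ g, IsWeakDeriv α f g) ∧
    sobolevNorm s p f < ⊤

/-- `f ∈ W^{r,p}(T)` has the trace `g` on the edge `γ_i` (for `r > 1/p`): the trace operator
`W^{r,p}(T) → L^p(γ_i)` is the continuous extension of `φ ↦ φ|_{γ_i}` from the dense subspace
of the functions that are smooth up to the boundary. -/
def HasTrace (r p : ℝ) (i : Fin 2) (f g : Plane → ℝ) : Prop :=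
  MemSobolev r p f ∧ ∃ φ : ℕ → Plane → ℝ, (∀ n, ContDiff ℝ ∞ (φ n)) ∧
    Tendsto (fun n => sobolevNorm r p (fun x => φ n x - f x)) atTop (𝓝 0) ∧
    Tendsto (fun n => ∫⁻ t in Ioo (0 : ℝ) 1,
      ‖φ n (edgePoint i t) - g (edgePoint i t)‖ₑ ^ p) atTop (𝓝 0)

open Classical in
/-- The `p`-th power of the norm of `W^{s,p}_𝔈(T)`, where the set `E` of indices stands for the
set of edges `𝔈 = {γ_i : i ∈ E}`. -/
def edgePow (E : Finset (Fin 2)) (s p : ℝ) (f : Plane → ℝ) : ℝ≥0∞ :=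
  sobolevPow s p f +
    if Int.fract s * p = 1 ∧ E.Nonempty then
      ∑ α ∈ Finset.HasAntidiagonal.antidiagonal ⌊s⌋₊,
        lpPow p (fun x =>
          Metric.infDist x (⋃ i ∈ E, edge i) ^ (-Int.fract s) * weakDeriv α f x)
    else 0

/-- The norm of `W^{s,p}_𝔈(T)`. -/
def edgeNorm (E : Finset (Fin 2)) (s p : ℝ) (f : Plane → ℝ) : ℝ≥0∞ :=
  edgePow E s p f ^ (1 / p)

/-- `f ∈ W^{s,p}_𝔈(T)`: `D^β f` vanishes on every edge of `𝔈`, in the sense of traces, for all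
`|β| < s - 1/p`, and the norm is finite. -/
def MemEdge (E : Finset (Fin 2)) (s p : ℝ) (f : Plane → ℝ) : Prop :=
  MemSobolev s p f ∧
    (∀ β : ℕ × ℕ, ((β.1 + β.2 : ℕ) : ℝ) < s - 1 / p → ∀ i ∈ E,
      HasTrace (s - ((β.1 + β.2 : ℕ) : ℝ)) p i (weakDeriv β f) 0) ∧
    edgeNorm E s p f < ⊤

end TriHardy

end

noncomputable section

namespace TriHardy

/-! ### Geometry of the triangle -/

/-! Part (a) rests on one formula. Let S_t = `squeeze i t` multiply x_i by t. For smooth φ, the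
fundamental theorem of calculus along t ↦ S_t x gives φ(x) = φ(S_0 x) + x_i ∫₀¹ ∂_iφ(S_t x) dt, and
S_0 x lies on γ_i. A vanishing trace removes the first term in the limit, so ω_i⁻¹ f is the Hardy
mean of ∂_i f almost everywhere (`HasTrace.ae_eq_mul_hardyMean`). It remains to show that Hardy
means are bounded on every space involved.

Differentiating a Hardy mean D^α only inserts a factor t^(α_i) (`IsWeakDeriv.hardyMean`), so bounds
in L^p and in the Gagliardo seminorm suffice. In L^p the Jacobian of S_t costs t⁻¹, which a weighted
Hölder inequality in t absorbs because p > 1. In the Gagliardo integral, substituting in both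
variables would cost t⁻², too much for small p. Instead h(S_t x) - h(S_t y) is compared with
averages of h over a ball of radius |x - y|; after y is integrated out, only one variable is
substituted and the cost is again t⁻¹ (`exists_gagliardo_squeeze_le`). Since S_t is nonexpansive and
maps every edge into itself, the weight dist^(-σ) increases along S_t and is harmless. Vanishing
traces survive because S_t fixes γ_i pointwise and rescales the other edge, where the
one-dimensional Hardy inequality applies (`HasTrace.hardyMean`).

For (b), the case s = 0 is immediate, and if sp = 1 the required weighted term is already part of
the norm. Otherwise compare f with f ∘ Φ, where Φ x = x + x_i v moves x by an amount comparable to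
x_i and multiplies x_i by τ. The weighted difference is controlled by the Gagliardo seminorm
(`exists_lintegral_weight_sub_le`), and composing with Φ multiplies the weighted integral by at most
τ^(sp-1) (`setLIntegral_weight_coordShift_le`). With τ large when sp < 1 and small when sp > 1, this
term is absorbed. The first case pushes points away from the edge and needs no boundary condition;
the second pulls them towards it and needs the boundary values to be subtracted. -/

lemma isOpen_tri : IsOpen tri := by
  have h0 : Continuous fun x : Plane => x 0 := by fun_prop
  have h1 : Continuous fun x : Plane => x 1 := by fun_prop
  exact (isOpen_lt continuous_const h0).inter
    ((isOpen_lt continuous_const h1).inter (isOpen_lt (h0.add h1) continuous_const))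

lemma measurableSet_tri : MeasurableSet tri := isOpen_tri.measurableSet

lemma convex_tri : Convex ℝ tri := by
  intro x hx y hy a b ha hb hab
  obtain ⟨hx0, hx1, hx2⟩ := hx
  obtain ⟨hy0, hy1, hy2⟩ := hy
  simp only [tri, mem_ofPred_eq, PiLp.add_apply, PiLp.smul_apply, smul_eq_mul]
  rcases ha.eq_or_lt with rfl | ha
  · have hb1 : b = 1 := by linarith
    subst hb1
    refine ⟨?_, ?_, ?_⟩ <;> linarith
  · refine ⟨by positivity, by positivity, ?_⟩
    nlinarith [mul_lt_mul_of_pos_left hx2 ha, mul_le_mul_of_nonneg_left hy2.le hb]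

lemma coord_pos {x : Plane} (hx : x ∈ tri) (i : Fin 2) : 0 < x i := by
  fin_cases i
  exacts [hx.1, hx.2.1]

lemma coord_lt_one {x : Plane} (hx : x ∈ tri) (i : Fin 2) : x i < 1 := by
  obtain ⟨h0, h1, h2⟩ := hx
  fin_cases i <;> simp <;> linarith

lemma dist_le_two {x y : Plane} (hx : x ∈ tri) (hy : y ∈ tri) : dist x y ≤ 2 := by
  rw [EuclideanSpace.dist_eq, Real.sqrt_le_left (by norm_num)]
  have h : ∀ i, dist (x i) (y i) ^ 2 ≤ 1 := fun i => by
    have := coord_pos hx i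
    have := coord_pos hy i
    have := coord_lt_one hx i
    have := coord_lt_one hy i
    rw [Real.dist_eq, sq_abs]
    nlinarith
  rw [Fin.sum_univ_two]
  linarith [h 0, h 1]

lemma tri_nonempty : (!₂[(1 / 4 : ℝ), 1 / 4] : Plane) ∈ tri := by
  simp [tri]; norm_num

lemma isBounded_tri : Bornology.IsBounded tri :=
  Metric.isBounded_iff.2 ⟨2, fun _ hx _ hy => dist_le_two hx hy⟩

lemma volume_tri_lt_top : volume tri < ⊤ := isBounded_tri.measure_lt_top

lemma volume_tri_ne_zero : volume tri ≠ 0 :=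
  (isOpen_tri.measure_pos volume ⟨_, tri_nonempty⟩).ne'

/-! ### Linear changes of variables -/

/-- The linear map `x ↦ x + x_i v`. -/
def coordShift (i : Fin 2) (v x : Plane) : Plane := x + x i • v

lemma coordShift_apply (i : Fin 2) (v x : Plane) (j : Fin 2) :
    coordShift i v x j = x j + x i * v j := by simp [coordShift]

lemma continuous_coordShift (i : Fin 2) (v : Plane) : Continuous (coordShift i v) := by
  unfold coordShift; fun_prop

lemma lintegral_coordShift {i : Fin 2} {v : Plane} (hv : 0 < 1 + v i) {F : Plane → ℝ≥0∞}
    (hF : Measurable F) :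
    ∫⁻ x, F (coordShift i v x) = ENNReal.ofReal (1 + v i)⁻¹ * ∫⁻ x, F x := by
  let f : Module.Dual ℝ Plane := (EuclideanSpace.proj (𝕜 := ℝ) i).toLinearMap
  have hdet : LinearMap.det (LinearMap.transvection f v) = 1 + v i :=
    LinearMap.transvection.det f v
  have hc : coordShift i v = LinearMap.transvection f v := by
    ext1 x; simp [coordShift, LinearMap.transvection.apply, f]
  have := Measure.map_linearMap_addHaar_eq_smul_addHaar (volume : Measure Plane)
    (f := LinearMap.transvection f v) (by rw [hdet]; exact hv.ne')
  rw [hdet, ← hc, abs_of_pos (inv_pos.2 hv)] at this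
  rw [← lintegral_map hF (continuous_coordShift i v).measurable, this, lintegral_smul_measure,
    smul_eq_mul]

lemma setLIntegral_coordShift_le {i : Fin 2} {v : Plane} (hv : 0 < 1 + v i) {F : Plane → ℝ≥0∞}
    (hF : Measurable F) {S S' : Set Plane} (hS : MeasurableSet S) (hS' : MeasurableSet S')
    (h : ∀ x ∈ S, coordShift i v x ∈ S') :
    ∫⁻ x in S, F (coordShift i v x) ≤ ENNReal.ofReal (1 + v i)⁻¹ * ∫⁻ x in S', F x := by
  rw [← lintegral_indicator hS', ← lintegral_coordShift hv (hF.indicator hS'),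
    ← lintegral_indicator hS]
  refine lintegral_mono fun x => ?_
  by_cases hx : x ∈ S
  · simp [hx, h x hx]
  · simp [hx]

/-- Multiplication of the `i`-th coordinate by `t`. -/
def squeeze (i : Fin 2) (t : ℝ) (x : Plane) : Plane :=
  coordShift i (EuclideanSpace.single i (t - 1)) x

lemma squeeze_self (i : Fin 2) (t : ℝ) (x : Plane) : squeeze i t x i = t * x i := by
  simp [squeeze, coordShift_apply]; ring

lemma squeeze_of_ne {i j : Fin 2} (h : j ≠ i) (t : ℝ) (x : Plane) : squeeze i t x j = x j := by
  simp [squeeze, coordShift_apply, h]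

lemma squeeze_eq (i : Fin 2) (t : ℝ) (x : Plane) :
    squeeze i t x = x + (x i * (t - 1)) • EuclideanSpace.single i 1 := by
  ext j
  by_cases h : j = i
  · subst h; simp [squeeze, coordShift_apply]
  · simp [squeeze_of_ne h, h]

lemma continuous_squeeze (i : Fin 2) : Continuous fun q : ℝ × Plane => squeeze i q.1 q.2 := by
  simp only [squeeze_eq]; fun_prop

lemma measurable_squeeze (i : Fin 2) : Measurable fun q : ℝ × Plane => squeeze i q.1 q.2 :=
  (continuous_squeeze i).measurable

lemma measurable_squeeze_right (i : Fin 2) (t : ℝ) : Measurable (squeeze i t) :=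
  (continuous_coordShift i _).measurable

lemma squeeze_mem_tri {i : Fin 2} {t : ℝ} (ht0 : 0 < t) (ht1 : t ≤ 1) {x : Plane} (hx : x ∈ tri) :
    squeeze i t x ∈ tri := by
  obtain ⟨h0, h1, h2⟩ := hx
  have ha : t * x 0 ≤ x 0 := mul_le_of_le_one_left h0.le ht1
  have hb : t * x 1 ≤ x 1 := mul_le_of_le_one_left h1.le ht1
  fin_cases i
  · refine ⟨?_, ?_, ?_⟩ <;> simp only [Fin.zero_eta, squeeze_self, ne_eq, one_ne_zero,
      not_false_eq_true, squeeze_of_ne]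
    exacts [by positivity, h1, by linarith]
  · refine ⟨?_, ?_, ?_⟩ <;> simp only [Fin.mk_one, squeeze_self, ne_eq, zero_ne_one,
      not_false_eq_true, squeeze_of_ne]
    exacts [h0, by positivity, by linarith]

lemma lintegral_squeeze_le {i : Fin 2} {t : ℝ} (ht0 : 0 < t) (ht1 : t ≤ 1) {F : Plane → ℝ≥0∞}
    (hF : Measurable F) :
    ∫⁻ x in tri, F (squeeze i t x) ≤ ENNReal.ofReal t⁻¹ * ∫⁻ x in tri, F x := by
  have := setLIntegral_coordShift_le (i := i) (v := EuclideanSpace.single i (t - 1))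
    (by simpa using ht0) hF measurableSet_tri measurableSet_tri
    (fun x hx => squeeze_mem_tri ht0 ht1 hx)
  rwa [show 1 + (EuclideanSpace.single i (t - 1) : Plane) i = t by simp] at this

lemma dist_squeeze_le (i : Fin 2) {t : ℝ} (ht0 : 0 ≤ t) (ht1 : t ≤ 1) (x y : Plane) :
    dist (squeeze i t x) (squeeze i t y) ≤ dist x y := by
  rw [EuclideanSpace.dist_eq, EuclideanSpace.dist_eq]
  refine Real.sqrt_le_sqrt (Finset.sum_le_sum fun j _ => ?_)
  by_cases h : j = i
  · subst h
    rw [squeeze_self, squeeze_self, Real.dist_eq, Real.dist_eq, ← mul_sub, abs_mul, mul_pow]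
    refine mul_le_of_le_one_left (sq_nonneg _) ?_
    rw [abs_of_nonneg ht0]
    exact pow_le_one₀ ht0 ht1
  · rw [squeeze_of_ne h, squeeze_of_ne h]

/-! ### Local averages -/

/-- The homothety of ratio r/2 centred at u keeps the triangle inside itself by convexity, and
inside the ball because the diameter is at most 2. -/
lemma volume_tri_inter_closedBall_ge {u : Plane} (hu : u ∈ tri) {r : ℝ} (hr0 : 0 ≤ r)
    (hr2 : r ≤ 2) :
    ENNReal.ofReal ((r / 2) ^ 2) * volume tri ≤ volume (tri ∩ Metric.closedBall u r) := by
  have h := Measure.addHaar_image_homothety (volume : Measure Plane) u (r / 2) tri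
  rw [finrank_euclideanSpace_fin, abs_of_nonneg (by positivity)] at h
  rw [← h]
  refine measure_mono ?_
  rintro _ ⟨w, hw, rfl⟩
  rw [AffineMap.homothety_apply]
  simp only [vsub_eq_sub, vadd_eq_add]
  refine ⟨?_, ?_⟩
  · have := convex_tri hu hw (a := 1 - r / 2) (b := r / 2) (by linarith) (by positivity) (by ring)
    convert this using 1
    module
  · rw [Metric.mem_closedBall, dist_eq_norm, add_sub_cancel_right, norm_smul, ← dist_eq_norm,
      Real.norm_of_nonneg (by positivity)]
    nlinarith [dist_le_two hw hu]

/-- The local oscillation of `h` at the scale `2 e` around `u`. -/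
def localOsc (p : ℝ) (h : Plane → ℝ) (u : Plane) (e : ℝ≥0∞) : ℝ≥0∞ :=
  ∫⁻ z in tri, if edist u z ≤ 2 * e then ‖h u - h z‖ₑ ^ p else 0

/-- Insert h(z) and average over the z of the triangle in the ball of radius r about u. That set has
measure at least a multiple of r², whence r^(-2); its points lie within 2r of both u and v, whence
the scale in `localOsc`. -/
lemma exists_enorm_sub_rpow_le (p : ℝ) (hp : 1 ≤ p) :
    ∃ C : ℝ≥0∞, C ≠ ⊤ ∧ ∀ h : Plane → ℝ, Measurable h → ∀ u ∈ tri, ∀ v ∈ tri, ∀ r : ℝ, 0 < r →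
      r ≤ 2 → dist u v ≤ r →
      ‖h u - h v‖ₑ ^ p ≤ C * ENNReal.ofReal r ^ (-2 : ℝ) *
        (localOsc p h u (ENNReal.ofReal r) + localOsc p h v (ENNReal.ofReal r)) := by
  refine ⟨2 ^ (p - 1) * (ENNReal.ofReal (1 / 4) * volume tri)⁻¹, ?_, ?_⟩
  · refine ENNReal.mul_ne_top (by finiteness) (ENNReal.inv_ne_top.2 ?_)
    exact mul_ne_zero (by simp) volume_tri_ne_zero
  intro h hh u hu v hv r hr0 hr2 huv
  set m := volume (tri ∩ Metric.closedBall u r) with hm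
  have hB : MeasurableSet (tri ∩ Metric.closedBall u r) :=
    measurableSet_tri.inter Metric.isClosed_closedBall.measurableSet
  have hmea : ∀ w, Measurable fun z => ‖h w - h z‖ₑ ^ p := fun w => by fun_prop
  have hosc : ∀ w, dist u w ≤ r → ∫⁻ z in tri ∩ Metric.closedBall u r, ‖h w - h z‖ₑ ^ p ≤
      localOsc p h w (ENNReal.ofReal r) := by
    intro w hw
    rw [inter_comm, ← setLIntegral_indicator Metric.isClosed_closedBall.measurableSet]
    refine lintegral_mono fun z => ?_
    by_cases hz : z ∈ Metric.closedBall u r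
    · have : edist w z ≤ 2 * ENNReal.ofReal r := by
        have h2 : 2 * ENNReal.ofReal r = ENNReal.ofReal (2 * r) := by
          rw [ENNReal.ofReal_mul (by norm_num), ENNReal.ofReal_ofNat]
        rw [edist_dist, h2]
        refine ENNReal.ofReal_le_ofReal ?_
        have := dist_triangle w u z
        rw [Metric.mem_closedBall, dist_comm] at hz
        rw [dist_comm w u] at this
        linarith
      simp [hz, this]
    · simp [hz]
  have key : ‖h u - h v‖ₑ ^ p * m ≤ 2 ^ (p - 1) *
      (localOsc p h u (ENNReal.ofReal r) + localOsc p h v (ENNReal.ofReal r)) := by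
    rw [hm, ← setLIntegral_const]
    calc ∫⁻ _ in tri ∩ Metric.closedBall u r, ‖h u - h v‖ₑ ^ p
        ≤ ∫⁻ z in tri ∩ Metric.closedBall u r,
            2 ^ (p - 1) * (‖h u - h z‖ₑ ^ p + ‖h v - h z‖ₑ ^ p) := by
          refine lintegral_mono fun z => ?_
          refine le_trans ?_ (ENNReal.rpow_add_le_mul_rpow_add_rpow _ _ hp)
          refine ENNReal.rpow_le_rpow ?_ (by linarith)
          have : h u - h v = (h u - h z) - (h v - h z) := by ring
          rw [this]
          exact enorm_sub_le
      _ ≤ _ := by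
          rw [lintegral_const_mul' _ _ (by finiteness), lintegral_add_left (hmea u)]
          gcongr
          · exact hosc u (by simpa using hr0.le)
          · exact hosc v huv
  have hlow := volume_tri_inter_closedBall_ge hu hr0.le hr2
  set A := ENNReal.ofReal (1 / 4) * volume tri with hA
  set R := ENNReal.ofReal r with hR
  have hR0 : R ≠ 0 := by simpa [hR] using hr0
  have hRt : R ≠ ⊤ := ENNReal.ofReal_ne_top
  have hA0 : A ≠ 0 := mul_ne_zero (by simp) volume_tri_ne_zero
  have hAt : A ≠ ⊤ := ENNReal.mul_ne_top (by simp) volume_tri_lt_top.ne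
  have hRA : ENNReal.ofReal ((r / 2) ^ 2) * volume tri = R ^ (2 : ℝ) * A := by
    rw [hA, hR, ENNReal.ofReal_rpow_of_pos hr0, ← mul_assoc, ← ENNReal.ofReal_mul (by positivity)]
    congr 2
    rw [Real.rpow_two]; ring
  rw [hRA] at hlow
  have h2 : ‖h u - h v‖ₑ ^ p * (R ^ (2 : ℝ) * A) ≤ 2 ^ (p - 1) *
      (localOsc p h u R + localOsc p h v R) := le_trans (by gcongr) key
  have hR2 : R ^ (2 : ℝ) * A ≠ 0 := mul_ne_zero (by simp [hR0]) hA0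
  have hR2t : R ^ (2 : ℝ) * A ≠ ⊤ := ENNReal.mul_ne_top (by finiteness) hAt
  rw [← ENNReal.le_div_iff_mul_le (Or.inl hR2) (Or.inl hR2t)] at h2
  refine h2.trans (le_of_eq ?_)
  rw [div_eq_mul_inv, ENNReal.mul_inv (Or.inr hAt) (Or.inr hA0), ENNReal.rpow_neg]
  ring

/-- The exponent exceeds the dimension by q, so the tail beyond radius d/2 scales like d^(-q). Where
d ≤ 2|w| one has (d/3)(1 + |w|/d) ≤ |w|, which dominates the kernel by a rescaled copy of an
integrable function. -/
lemma exists_lintegral_tail_le (q : ℝ) (hq : 0 < q) :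
    ∃ C : ℝ≥0∞, C ≠ ⊤ ∧ ∀ (x : Plane) (d : ℝ≥0∞), d ≠ ⊤ →
      ∫⁻ y, (if d ≤ 2 * edist x y then edist x y ^ (-(q + 2)) else 0) ≤ C * d ^ (-q) := by
  have hfin := finite_integral_one_add_norm (E := Plane) (μ := volume) (r := q + 2)
    (by rw [finrank_euclideanSpace_fin]; push_cast; linarith)
  set I := ∫⁻ w : Plane, ENNReal.ofReal ((1 + ‖w‖) ^ (-(q + 2))) with hI
  -- The summand 1 keeps the constant nonzero, so that the bound is ⊤ when d = 0.
  refine ⟨3 ^ (q + 2) * I + 1, ?_, ?_⟩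
  · have := hfin.ne; finiteness
  intro x d hd
  rcases eq_or_ne d 0 with rfl | hd0
  · rw [ENNReal.zero_rpow_of_neg (by linarith), ENNReal.mul_top (by simp)]
    exact le_top
  lift d to ℝ≥0 using hd
  have hdp : 0 < (d : ℝ) := by
    have : d ≠ 0 := by simpa using hd0
    positivity
  have hmeas : Measurable fun w : Plane => ENNReal.ofReal ((1 + ‖w‖) ^ (-(q + 2))) := by fun_prop
  have hscale : ∫⁻ w : Plane, ENNReal.ofReal ((1 + ‖(d : ℝ)⁻¹ • w‖) ^ (-(q + 2))) =
      ENNReal.ofReal ((d : ℝ) ^ 2) * I := by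
    rw [hI, ← lintegral_map (g := fun w : Plane => (d : ℝ)⁻¹ • w) hmeas (by fun_prop),
      Measure.map_addHaar_smul _ (inv_ne_zero hdp.ne'), lintegral_smul_measure,
      finrank_euclideanSpace_fin, inv_pow, inv_inv, abs_of_nonneg (by positivity), smul_eq_mul]
  have hpt : ∀ w : Plane, (if (d : ℝ≥0∞) ≤ 2 * ‖w‖ₑ then ‖w‖ₑ ^ (-(q + 2)) else 0) ≤
      ENNReal.ofReal ((d / 3) ^ (-(q + 2))) *
        ENNReal.ofReal ((1 + ‖(d : ℝ)⁻¹ • w‖) ^ (-(q + 2))) := by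
    intro w
    split_ifs with hw
    · have hw' : (d : ℝ) ≤ 2 * ‖w‖ := by
        rw [enorm_eq_nnnorm] at hw
        exact_mod_cast hw
      have hwp : 0 < ‖w‖ := by linarith
      rw [← ofReal_norm, ENNReal.ofReal_rpow_of_pos hwp, ← ENNReal.ofReal_mul (by positivity),
        ← Real.mul_rpow (by positivity) (by positivity)]
      refine ENNReal.ofReal_le_ofReal
        (Real.rpow_le_rpow_of_nonpos (by positivity) ?_ (by linarith))
      rw [norm_smul, norm_inv, Real.norm_of_nonneg hdp.le]
      field_simp
      linarith
    · exact zero_le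
  calc ∫⁻ y, (if (d : ℝ≥0∞) ≤ 2 * edist x y then edist x y ^ (-(q + 2)) else 0)
      = ∫⁻ w : Plane, (if (d : ℝ≥0∞) ≤ 2 * ‖w‖ₑ then ‖w‖ₑ ^ (-(q + 2)) else 0) := by
        rw [← lintegral_sub_left_eq_self _ x]
        simp only [edist_eq_enorm_sub, sub_sub_cancel]
    _ ≤ ENNReal.ofReal ((d / 3) ^ (-(q + 2))) * (ENNReal.ofReal ((d : ℝ) ^ 2) * I) := by
        rw [← hscale, ← lintegral_const_mul' _ _ ENNReal.ofReal_ne_top]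
        exact lintegral_mono hpt
    _ = 3 ^ (q + 2) * I * (d : ℝ≥0∞) ^ (-q) := by
        rw [← mul_assoc, ← ENNReal.ofReal_mul (by positivity), ← ENNReal.ofReal_coe_nnreal,
          ENNReal.ofReal_rpow_of_pos hdp, mul_right_comm]
        congr 1
        rw [← ENNReal.ofReal_ofNat 3, ENNReal.ofReal_rpow_of_pos (by norm_num),
          ← ENNReal.ofReal_mul (by positivity)]
        congr 1
        rw [Real.div_rpow hdp.le (by norm_num), Real.rpow_neg (by norm_num : (0 : ℝ) ≤ 3),
          div_inv_eq_mul, mul_comm _ ((3 : ℝ) ^ (q + 2)), mul_assoc, ← Real.rpow_two,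
          ← Real.rpow_add hdp]
        congr 2; ring
    _ ≤ _ := by gcongr; exact le_self_add

/-! ### Hardy averages -/

lemma ae_Ioo_iff {P : ℝ → Prop} (h : ∀ t ∈ Ioo (0 : ℝ) 1, P t) :
    ∀ᵐ t ∂(volume.restrict (Ioo (0 : ℝ) 1)), P t :=
  (ae_restrict_iff' measurableSet_Ioo).2 (ae_of_all _ h)

lemma lintegral_Ioo_rpow_ne_top {a : ℝ} (ha : -1 < a) :
    ∫⁻ t in Ioo (0 : ℝ) 1, ENNReal.ofReal t ^ a ≠ ⊤ := by
  have h := ((intervalIntegral.integrableOn_Ioo_rpow_iff (t := 1) one_pos).2 ha).lintegral_lt_top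
  refine ne_of_lt (lt_of_le_of_lt (le_of_eq ?_) h)
  refine lintegral_congr_ae (ae_Ioo_iff fun t ht => ?_)
  exact ENNReal.ofReal_rpow_of_pos ht.1

/-- Hölder applied to F = (t^a F) · t^(-a) with a = (p-1)/(2p): the second factor contributes the
integrable t^(-1/2), and the remaining weight t^((p-1)/2) is still integrable after a later Jacobian
t⁻¹. -/
lemma exists_lintegral_Ioo_rpow_le (p : ℝ) (hp : 1 < p) :
    ∃ C : ℝ≥0∞, C ≠ ⊤ ∧ ∀ F : ℝ → ℝ≥0∞, Measurable F →
      (∫⁻ t in Ioo (0 : ℝ) 1, F t) ^ p ≤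
        C * ∫⁻ t in Ioo (0 : ℝ) 1, ENNReal.ofReal t ^ ((p - 1) / 2) * F t ^ p := by
  have hp0 : 0 < p := by linarith
  set p' := Real.conjExponent p with hp'
  have hc : p.HolderConjugate p' := .conjExponent hp
  refine ⟨((∫⁻ t in Ioo (0 : ℝ) 1, ENNReal.ofReal t ^ (-(1 / 2) : ℝ)) ^ (1 / p')) ^ p, ?_, ?_⟩
  · have := lintegral_Ioo_rpow_ne_top (a := -(1 / 2)) (by norm_num)
    have := hc.symm.pos
    finiteness
  intro F hF
  set a := (p - 1) / (2 * p) with ha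
  have h := ENNReal.lintegral_mul_le_Lp_mul_Lq (volume.restrict (Ioo (0 : ℝ) 1)) hc
    (f := fun t => ENNReal.ofReal t ^ a * F t) (g := fun t => ENNReal.ofReal t ^ (-a))
    (by fun_prop) (by fun_prop)
  have e1 : ∫⁻ t in Ioo (0 : ℝ) 1, F t = ∫⁻ t in Ioo (0 : ℝ) 1,
      ((fun t => ENNReal.ofReal t ^ a * F t) * fun t => ENNReal.ofReal t ^ (-a)) t := by
    refine lintegral_congr_ae (ae_Ioo_iff fun t ht => ?_)
    have h0 : ENNReal.ofReal t ≠ 0 := by simpa using ht.1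
    simp only [Pi.mul_apply]
    rw [mul_right_comm, ← ENNReal.rpow_add _ _ h0 ENNReal.ofReal_ne_top]
    simp
  have e2 : ∀ t, (ENNReal.ofReal t ^ a * F t) ^ p =
      ENNReal.ofReal t ^ ((p - 1) / 2) * F t ^ p := fun t => by
    rw [ENNReal.mul_rpow_of_nonneg _ _ hp0.le, ← ENNReal.rpow_mul]
    congr 2; rw [ha]; field_simp
  have e3 : ∀ t, (ENNReal.ofReal t ^ (-a)) ^ p' = ENNReal.ofReal t ^ (-(1 / 2) : ℝ) := fun t => by
    rw [← ENNReal.rpow_mul]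
    congr 1
    have : p - 1 ≠ 0 := by linarith
    rw [ha, hp', Real.conjExponent]; field_simp
  rw [e1]
  simp only [e2, e3] at h
  refine (ENNReal.rpow_le_rpow h hp0.le).trans (le_of_eq ?_)
  rw [ENNReal.mul_rpow_of_nonneg _ _ hp0.le, mul_comm, ← ENNReal.rpow_mul _ (1 / p) p,
    one_div_mul_cancel hp0.ne', ENNReal.rpow_one]

lemma rpow_mul_ofReal_inv {t : ℝ} (ht : 0 < t) (a : ℝ) :
    ENNReal.ofReal t ^ a * ENNReal.ofReal t⁻¹ = ENNReal.ofReal t ^ (a - 1) := by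
  rw [ENNReal.ofReal_inv_of_pos ht, ← ENNReal.rpow_neg_one, ← ENNReal.rpow_add _ _ (by simpa)
    ENNReal.ofReal_ne_top, sub_eq_add_neg]

lemma exists_lintegral_squeeze_le (p : ℝ) (hp : 1 < p) :
    ∃ C : ℝ≥0∞, C ≠ ⊤ ∧ ∀ (i : Fin 2) (F : Plane → ℝ≥0∞), Measurable F →
      ∫⁻ x in tri, (∫⁻ t in Ioo (0 : ℝ) 1, F (squeeze i t x)) ^ p ≤ C * ∫⁻ x in tri, F x ^ p := by
  obtain ⟨C, hC, h⟩ := exists_lintegral_Ioo_rpow_le p hp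
  refine ⟨C * ∫⁻ t in Ioo (0 : ℝ) 1, ENNReal.ofReal t ^ ((p - 1) / 2 - 1),
    ENNReal.mul_ne_top hC (lintegral_Ioo_rpow_ne_top (by linarith)), fun i F hF => ?_⟩
  have hm : Measurable fun q : ℝ × Plane => F (squeeze i q.1 q.2) :=
    hF.comp (measurable_squeeze i)
  calc ∫⁻ x in tri, (∫⁻ t in Ioo (0 : ℝ) 1, F (squeeze i t x)) ^ p
      ≤ ∫⁻ x in tri, C * ∫⁻ t in Ioo (0 : ℝ) 1,
          ENNReal.ofReal t ^ ((p - 1) / 2) * F (squeeze i t x) ^ p :=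
        lintegral_mono fun x => h _ (hm.comp measurable_prodMk_right)
    _ = C * ∫⁻ t in Ioo (0 : ℝ) 1, ∫⁻ x in tri,
          ENNReal.ofReal t ^ ((p - 1) / 2) * F (squeeze i t x) ^ p := by
        rw [lintegral_const_mul' _ _ hC, lintegral_lintegral_swap]
        exact (((ENNReal.measurable_ofReal.comp measurable_snd).pow_const _).mul
          ((hm.comp measurable_swap).pow_const _)).aemeasurable
    _ ≤ C * ∫⁻ t in Ioo (0 : ℝ) 1,
          ENNReal.ofReal t ^ ((p - 1) / 2 - 1) * ∫⁻ x in tri, F x ^ p := by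
        refine mul_le_mul_right (lintegral_mono_ae (ae_Ioo_iff fun t ht => ?_)) C
        have := ht.1
        rw [lintegral_const_mul' _ _ (by finiteness), ← rpow_mul_ofReal_inv ht.1, mul_assoc]
        gcongr
        exact lintegral_squeeze_le ht.1 ht.2.le (hF.pow_const p)
    _ = _ := by
        rw [lintegral_mul_const _ (by fun_prop), mul_assoc]

lemma div_rpow_eq (a b : ℝ≥0∞) (q : ℝ) : a / b ^ q = a * b ^ (-q) := by
  rw [div_eq_mul_inv, ENNReal.rpow_neg]

/-- The integrand that bounds the difference quotients of `h ∘ squeeze i t` after averaging. -/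
def oscKernel (p q : ℝ) (i : Fin 2) (t : ℝ) (h : Plane → ℝ) (x y z : Plane) : ℝ≥0∞ :=
  ‖h (squeeze i t x) - h z‖ₑ ^ p *
    if edist (squeeze i t x) z ≤ 2 * edist x y then edist x y ^ (-(q + 2)) else 0

lemma measurable_oscKernel (p q : ℝ) (i : Fin 2) (t : ℝ) {h : Plane → ℝ} (hh : Measurable h) :
    Measurable fun w : (Plane × Plane) × Plane => oscKernel p q i t h w.1.1 w.1.2 w.2 := by
  have hS := measurable_squeeze_right i t
  unfold oscKernel
  refine Measurable.mul (by fun_prop) (Measurable.ite ?_ (by fun_prop) measurable_const)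
  exact measurableSet_le (by fun_prop) (by fun_prop)

lemma lintegral_oscKernel {p q : ℝ} {i : Fin 2} {t : ℝ} {h : Plane → ℝ} {x y : Plane}
    (hxy : x ≠ y) : ∫⁻ z in tri, oscKernel p q i t h x y z =
      edist x y ^ (-(q + 2)) * localOsc p h (squeeze i t x) (edist x y) := by
  have h0 : edist x y ≠ 0 := by simpa using hxy
  have h1 := edist_ne_top x y
  rw [localOsc, ← lintegral_const_mul' _ _ (by finiteness)]
  refine lintegral_congr fun z => ?_
  rw [oscKernel]
  split_ifs <;> simp [mul_comm]

/-- For fixed x and z the variable y occurs only in the kernel, so it is integrated first, by the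
tail estimate. What is left depends on x only through S_t x, and a single substitution costs t⁻¹. -/
lemma exists_lintegral_oscKernel_le (p q : ℝ) (hp : 0 < p) (hq : 0 < q) :
    ∃ D : ℝ≥0∞, D ≠ ⊤ ∧ ∀ (i : Fin 2) (h : Plane → ℝ), Measurable h → ∀ t ∈ Ioo (0 : ℝ) 1,
      ∫⁻ x in tri, ∫⁻ y in tri, ∫⁻ z in tri, oscKernel p q i t h x y z ≤
      D * (ENNReal.ofReal t⁻¹ * ∫⁻ u in tri, ∫⁻ z in tri, ‖h u - h z‖ₑ ^ p / edist u z ^ q) := by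
  obtain ⟨D, hD, htail⟩ := exists_lintegral_tail_le q hq
  refine ⟨D, hD, fun i h hh t ht => ?_⟩
  have h1 : ∀ x, ∫⁻ y in tri, ∫⁻ z in tri, oscKernel p q i t h x y z ≤
      D * ∫⁻ z in tri, ‖h (squeeze i t x) - h z‖ₑ ^ p / edist (squeeze i t x) z ^ q := by
    intro x
    rw [lintegral_lintegral_swap, ← lintegral_const_mul' _ _ hD]
    · refine lintegral_mono fun z => ?_
      simp only [oscKernel]
      rw [lintegral_const_mul' _ _ (by finiteness), div_rpow_eq, mul_left_comm]
      refine mul_le_mul_right ?_ _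
      exact (setLIntegral_le_lintegral _ _).trans (htail x _ (edist_ne_top _ _))
    · exact ((measurable_oscKernel p q i t hh).comp
        (f := fun w : Plane × Plane => ((x, w.1), w.2)) (by fun_prop)).aemeasurable
  refine (lintegral_mono h1).trans ?_
  rw [lintegral_const_mul' _ _ hD]
  refine mul_le_mul_right ?_ _
  refine lintegral_squeeze_le (F := fun u => ∫⁻ z in tri, ‖h u - h z‖ₑ ^ p / edist u z ^ q)
    ht.1 ht.2.le ?_
  exact Measurable.lintegral_prod_right'
    (f := fun w : Plane × Plane => ‖h w.1 - h w.2‖ₑ ^ p / edist w.1 w.2 ^ q) (by fun_prop)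

/-- The averaging radius is |x - y|, not the possibly much smaller |S_t x - S_t y|; this is allowed
because S_t is nonexpansive. The resulting r^(-2) becomes part of the exponent -(q + 2) of
`oscKernel`. -/
lemma exists_enorm_squeeze_sub_le (p q : ℝ) (hp : 1 ≤ p) :
    ∃ C : ℝ≥0∞, C ≠ ⊤ ∧ ∀ (i : Fin 2) (h : Plane → ℝ), Measurable h → ∀ t ∈ Ioo (0 : ℝ) 1,
      ∀ x ∈ tri, ∀ y ∈ tri,
        ‖h (squeeze i t x) - h (squeeze i t y)‖ₑ ^ p / edist x y ^ q ≤
        C * (∫⁻ z in tri, oscKernel p q i t h x y z) +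
          C * ∫⁻ z in tri, oscKernel p q i t h y x z := by
  obtain ⟨C, hC, hav⟩ := exists_enorm_sub_rpow_le p hp
  refine ⟨C, hC, fun i h hh t ht x hx y hy => ?_⟩
  rcases eq_or_ne x y with rfl | hxy
  · simp [show 0 < p by linarith]
  have := hav h hh _ (squeeze_mem_tri (i := i) ht.1 ht.2.le hx) _
    (squeeze_mem_tri (i := i) ht.1 ht.2.le hy) (dist x y) (dist_pos.2 hxy) (dist_le_two hx hy)
    (dist_squeeze_le i ht.1.le ht.2.le x y)
  rw [← edist_dist] at this
  rw [lintegral_oscKernel hxy, lintegral_oscKernel hxy.symm, div_rpow_eq, edist_comm y x]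
  have he0 : edist x y ≠ 0 := by simpa using hxy
  refine (mul_le_mul_left this _).trans (le_of_eq ?_)
  rw [show -(q + 2) = -2 + -q by ring, ENNReal.rpow_add _ _ he0 (edist_ne_top x y)]
  ring

/-- The power t⁻¹ is the point: t⁻², from substituting in both variables, is integrable against
t^((p-1)/2) only for p > 3. The two oscillation terms are exchanged by swapping x and y. -/
lemma exists_gagliardo_squeeze_le (σ p : ℝ) (hσ : 0 < σ) (hp : 1 < p) :
    ∃ C : ℝ≥0∞, C ≠ ⊤ ∧ ∀ (i : Fin 2) (h : Plane → ℝ), Measurable h → ∀ t ∈ Ioo (0 : ℝ) 1,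
      ∫⁻ x in tri, ∫⁻ y in tri,
          ‖h (squeeze i t x) - h (squeeze i t y)‖ₑ ^ p / edist x y ^ (σ * p + 2) ≤
        C * ENNReal.ofReal t⁻¹ * gagliardoPow σ p h := by
  have hp0 : 0 < p := by linarith
  obtain ⟨C, hC, hpt⟩ := exists_enorm_squeeze_sub_le p (σ * p + 2) hp.le
  obtain ⟨D, hD, hmain⟩ := exists_lintegral_oscKernel_le p (σ * p + 2) hp0 (by positivity)
  refine ⟨C * D + C * D, by finiteness, fun i h hh t ht => ?_⟩
  have hm := measurable_oscKernel p (σ * p + 2) i t hh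
  have hJm : Measurable fun w : Plane × Plane => ∫⁻ z in tri,
      oscKernel p (σ * p + 2) i t h w.1 w.2 z := Measurable.lintegral_prod_right' hm
  have hJr : ∀ x, Measurable fun y => ∫⁻ z in tri, oscKernel p (σ * p + 2) i t h x y z := fun x =>
    hJm.comp (f := fun y => (x, y)) (by fun_prop)
  refine (setLIntegral_mono' measurableSet_tri fun x hx =>
    setLIntegral_mono' measurableSet_tri fun y hy => hpt i h hh t ht x hx y hy).trans ?_
  have e : ∀ x, ∫⁻ y in tri, (C * (∫⁻ z in tri, oscKernel p (σ * p + 2) i t h x y z) +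
      C * ∫⁻ z in tri, oscKernel p (σ * p + 2) i t h y x z) =
      C * (∫⁻ y in tri, ∫⁻ z in tri, oscKernel p (σ * p + 2) i t h x y z) +
      C * ∫⁻ y in tri, ∫⁻ z in tri, oscKernel p (σ * p + 2) i t h y x z := fun x => by
    rw [lintegral_add_left ((hJr x).const_mul C), lintegral_const_mul' _ _ hC,
      lintegral_const_mul' _ _ hC]
  rw [lintegral_congr e, lintegral_add_left (Measurable.lintegral_prod_right' hJm |>.const_mul C),
    lintegral_const_mul' _ _ hC, lintegral_const_mul' _ _ hC,
    lintegral_lintegral_swap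
      (f := fun x y => ∫⁻ z in tri, oscKernel p (σ * p + 2) i t h y x z)
      (hJm.comp measurable_swap).aemeasurable]
  refine (add_le_add (mul_le_mul_right (hmain i h hh t ht) C)
    (mul_le_mul_right (hmain i h hh t ht) C)).trans (le_of_eq ?_)
  rw [gagliardoPow]
  ring

lemma exists_gagliardo_lintegral_squeeze_le (σ p : ℝ) (hσ : 0 < σ) (hp : 1 < p) :
    ∃ C : ℝ≥0∞, C ≠ ⊤ ∧ ∀ (i : Fin 2) (h : Plane → ℝ), Measurable h →
      ∫⁻ x in tri, ∫⁻ y in tri, (∫⁻ t in Ioo (0 : ℝ) 1,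
          ‖h (squeeze i t x) - h (squeeze i t y)‖ₑ) ^ p / edist x y ^ (σ * p + 2) ≤
        C * gagliardoPow σ p h := by
  obtain ⟨C, hC, hI⟩ := exists_lintegral_Ioo_rpow_le p hp
  obtain ⟨D, hD, hG⟩ := exists_gagliardo_squeeze_le σ p hσ hp
  refine ⟨C * (∫⁻ t in Ioo (0 : ℝ) 1, ENNReal.ofReal t ^ ((p - 1) / 2 - 1)) * D,
    ENNReal.mul_ne_top (ENNReal.mul_ne_top hC (lintegral_Ioo_rpow_ne_top (by linarith))) hD,
    fun i h hh => ?_⟩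
  have hs := measurable_squeeze i
  let J : Plane → Plane → ℝ → ℝ≥0∞ := fun x y t => ENNReal.ofReal t ^ ((p - 1) / 2) *
    (‖h (squeeze i t x) - h (squeeze i t y)‖ₑ ^ p / edist x y ^ (σ * p + 2))
  have hJ : Measurable fun w : (Plane × Plane) × ℝ => J w.1.1 w.1.2 w.2 := by
    have h1 : Measurable fun w : (Plane × Plane) × ℝ => squeeze i w.2 w.1.1 :=
      hs.comp (f := fun w : (Plane × Plane) × ℝ => (w.2, w.1.1)) (by fun_prop)
    have h2 : Measurable fun w : (Plane × Plane) × ℝ => squeeze i w.2 w.1.2 :=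
      hs.comp (f := fun w : (Plane × Plane) × ℝ => (w.2, w.1.2)) (by fun_prop)
    simp only [J]
    fun_prop
  have hmt : ∀ x y, Measurable fun t => ‖h (squeeze i t x) - h (squeeze i t y)‖ₑ := fun x y => by
    have h1 : Measurable fun t => squeeze i t x := hs.comp measurable_prodMk_right
    have h2 : Measurable fun t => squeeze i t y := hs.comp measurable_prodMk_right
    fun_prop
  have hpt : ∀ x y, (∫⁻ t in Ioo (0 : ℝ) 1, ‖h (squeeze i t x) - h (squeeze i t y)‖ₑ) ^ p /
      edist x y ^ (σ * p + 2) ≤ C * ∫⁻ t in Ioo (0 : ℝ) 1, J x y t := by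
    intro x y
    calc _ ≤ (C * ∫⁻ t in Ioo (0 : ℝ) 1, ENNReal.ofReal t ^ ((p - 1) / 2) *
            ‖h (squeeze i t x) - h (squeeze i t y)‖ₑ ^ p) / edist x y ^ (σ * p + 2) := by
          gcongr
          exact hI _ (hmt x y)
      _ = _ := by
          rw [div_eq_mul_inv, mul_assoc, ← lintegral_mul_const _ ?_]
          · simp only [J, div_eq_mul_inv, mul_assoc]
          · have := hmt x y
            fun_prop
  have hJx : ∀ x, Measurable fun w : Plane × ℝ => J x w.1 w.2 := fun x =>
    hJ.comp (f := fun w : Plane × ℝ => ((x, w.1), w.2)) (by fun_prop)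
  calc _ ≤ ∫⁻ x in tri, ∫⁻ y in tri, C * ∫⁻ t in Ioo (0 : ℝ) 1, J x y t :=
        lintegral_mono fun x => lintegral_mono fun y => hpt x y
    _ = C * ∫⁻ t in Ioo (0 : ℝ) 1, ∫⁻ x in tri, ∫⁻ y in tri, J x y t := by
        simp only [lintegral_const_mul' C _ hC]
        congr 1
        trans ∫⁻ x in tri, ∫⁻ t in Ioo (0 : ℝ) 1, ∫⁻ y in tri, J x y t
        · exact lintegral_congr fun x => lintegral_lintegral_swap (hJx x).aemeasurable
        · refine lintegral_lintegral_swap (Measurable.lintegral_prod_right'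
            (f := fun w : (Plane × ℝ) × Plane => J w.1.1 w.2 w.1.2) ?_).aemeasurable
          exact hJ.comp (f := fun w : (Plane × ℝ) × Plane => ((w.1.1, w.2), w.1.2)) (by fun_prop)
    _ ≤ C * ∫⁻ t in Ioo (0 : ℝ) 1,
          ENNReal.ofReal t ^ ((p - 1) / 2 - 1) * (D * gagliardoPow σ p h) := by
        refine mul_le_mul_right (lintegral_mono_ae (ae_Ioo_iff fun t ht => ?_)) C
        have := ht.1
        simp only [J]
        simp_rw [lintegral_const_mul' (ENNReal.ofReal t ^ ((p - 1) / 2)) _ (by finiteness)]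
        rw [← rpow_mul_ofReal_inv ht.1, mul_assoc]
        gcongr
        refine (hG i h hh t ht).trans (le_of_eq ?_)
        ring
    _ = _ := by
        rw [lintegral_mul_const _ (by fun_prop)]
        ring

/-! ### Classical derivatives -/

lemma contDiff_partialDeriv {φ : Plane → ℝ} (h : ContDiff ℝ ∞ φ) (i : Fin 2) :
    ContDiff ℝ ∞ (partialDeriv i φ) :=
  (h.fderiv_right (m := ∞) (by simp)).clm_apply contDiff_const

lemma contDiff_partialDeriv_iterate {φ : Plane → ℝ} (h : ContDiff ℝ ∞ φ) (i : Fin 2) (n : ℕ) :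
    ContDiff ℝ ∞ ((partialDeriv i)^[n] φ) := by
  induction n with
  | zero => exact h
  | succ n ih => rw [Function.iterate_succ_apply']; exact contDiff_partialDeriv ih i

lemma contDiff_multiDeriv {φ : Plane → ℝ} (h : ContDiff ℝ ∞ φ) (α : ℕ × ℕ) :
    ContDiff ℝ ∞ (multiDeriv α φ) :=
  contDiff_partialDeriv_iterate (contDiff_partialDeriv_iterate h 1 _) 0 _

lemma partialDeriv_comm {φ : Plane → ℝ} (h : ContDiff ℝ ∞ φ) (i j : Fin 2) :
    partialDeriv i (partialDeriv j φ) = partialDeriv j (partialDeriv i φ) := by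
  have hd : Differentiable ℝ (fderiv ℝ φ) :=
    (h.fderiv_right (m := ∞) (by simp)).differentiable (by simp)
  have key : ∀ i j x, partialDeriv i (partialDeriv j φ) x =
      fderiv ℝ (fderiv ℝ φ) x (EuclideanSpace.single i 1) (EuclideanSpace.single j 1) := by
    intro i j x
    have : HasFDerivAt (partialDeriv j φ)
        ((fderiv ℝ (fderiv ℝ φ) x).flip (EuclideanSpace.single j 1)) x := by
      have := (hd x).hasFDerivAt.clm_apply
        (hasFDerivAt_const (EuclideanSpace.single j 1 : Plane) x)
      rw [ContinuousLinearMap.comp_zero, zero_add] at this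
      exact this
    rw [partialDeriv, this.fderiv]
    rfl
  ext x
  rw [key, key]
  exact (h.contDiffAt.isSymmSndFDerivAt (by simp [minSmoothness_of_isRCLikeNormedField]; exact WithTop.coe_le_coe.2 le_top)).eq _ _

lemma partialDeriv_iterate_comm {φ : Plane → ℝ} (h : ContDiff ℝ ∞ φ) (i j : Fin 2) (m n : ℕ) :
    (partialDeriv i)^[m] ((partialDeriv j)^[n] φ) =
      (partialDeriv j)^[n] ((partialDeriv i)^[m] φ) := by
  have one : ∀ (m : ℕ) {φ : Plane → ℝ}, ContDiff ℝ ∞ φ →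
      (partialDeriv i)^[m] (partialDeriv j φ) = partialDeriv j ((partialDeriv i)^[m] φ) := by
    intro m
    induction m with
    | zero => intro φ _; rfl
    | succ m ih =>
      intro φ h
      rw [Function.iterate_succ_apply, partialDeriv_comm h, ih (contDiff_partialDeriv h i),
        Function.iterate_succ_apply]
  induction n generalizing φ with
  | zero => rfl
  | succ n ih =>
    rw [Function.iterate_succ_apply, ih (contDiff_partialDeriv h j), one m h,
      Function.iterate_succ_apply]

lemma multiDeriv_multiDeriv {φ : Plane → ℝ} (h : ContDiff ℝ ∞ φ) (α β : ℕ × ℕ) :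
    multiDeriv α (multiDeriv β φ) = multiDeriv (α + β) φ := by
  unfold multiDeriv
  rw [← partialDeriv_iterate_comm (contDiff_partialDeriv_iterate h 1 _) 0 1, Prod.fst_add,
    Prod.snd_add, Function.iterate_add_apply, Function.iterate_add_apply]

lemma multiDeriv_unitIndex (i : Fin 2) (φ : Plane → ℝ) :
    multiDeriv (unitIndex i) φ = partialDeriv i φ := by
  fin_cases i <;> simp [multiDeriv, unitIndex]

lemma support_partialDeriv_subset (i : Fin 2) (φ : Plane → ℝ) :
    tsupport (partialDeriv i φ) ⊆ tsupport φ := by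
  refine closure_minimal (fun x hx => ?_) isClosed_closure
  have : x ∈ Function.support (fderiv ℝ φ) := by
    intro h0
    exact hx (by simp [partialDeriv, h0])
  exact support_fderiv_subset ℝ this

lemma IsTestFun.partialDeriv {φ : Plane → ℝ} (h : IsTestFun φ) (i : Fin 2) :
    IsTestFun (partialDeriv i φ) :=
  ⟨contDiff_partialDeriv h.1 i,
    h.2.1.of_isClosed_subset isClosed_closure (support_partialDeriv_subset i φ),
    (support_partialDeriv_subset i φ).trans h.2.2⟩

lemma IsTestFun.multiDeriv {φ : Plane → ℝ} (h : IsTestFun φ) (α : ℕ × ℕ) :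
    IsTestFun (multiDeriv α φ) := by
  have it : ∀ (i : Fin 2) (n : ℕ) {φ : Plane → ℝ}, IsTestFun φ →
      IsTestFun ((TriHardy.partialDeriv i)^[n] φ) := by
    intro i n
    induction n with
    | zero => exact fun h => h
    | succ n ih => intro φ h; rw [Function.iterate_succ_apply]; exact ih (h.partialDeriv i)
  exact it 0 _ (it 1 _ h)

lemma isTestFun_of_tsupport_subset {φ : Plane → ℝ} (h : ContDiff ℝ ∞ φ) (hs : tsupport φ ⊆ tri) :
    IsTestFun φ :=
  ⟨h, Metric.isCompact_of_isClosed_isBounded isClosed_closure (isBounded_tri.subset hs), hs⟩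

lemma IsTestFun.eq_zero {φ : Plane → ℝ} (h : IsTestFun φ) {x : Plane} (hx : x ∉ tri) : φ x = 0 :=
  image_eq_zero_of_notMem_tsupport fun h' => hx (h.2.2 h')

lemma IsTestFun.exists_bound {φ : Plane → ℝ} (h : IsTestFun φ) : ∃ C, ∀ x, ‖φ x‖ ≤ C :=
  h.1.continuous.bounded_above_of_compact_support h.2.1

lemma setIntegral_tri_mul {φ : Plane → ℝ} (h : IsTestFun φ) (f : Plane → ℝ) :
    ∫ x in tri, f x * φ x = ∫ x, f x * φ x :=
  setIntegral_eq_integral_of_forall_compl_eq_zero fun x hx => by simp [h.eq_zero hx]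

/-! ### Weak derivatives -/

lemma IsWeakDeriv.congr {α : ℕ × ℕ} {f f' g g' : Plane → ℝ} (h : IsWeakDeriv α f g)
    (hf : f =ᵐ[volume.restrict tri] f') (hg : g =ᵐ[volume.restrict tri] g') :
    IsWeakDeriv α f' g' := by
  refine ⟨h.1.congr hf, h.2.1.congr hg, fun φ hφ => ?_⟩
  exact (integral_congr_ae (hf.mul (ae_eq_refl (multiDeriv α φ)))).symm.trans
    ((h.2.2 φ hφ).trans (congrArg _ (integral_congr_ae (hg.mul (ae_eq_refl φ)))))

/-- True equality, not just equality almost everywhere: the choice is made from a predicate that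
depends only on the class of f. -/
lemma weakDeriv_congr {f f' : Plane → ℝ} (hf : f =ᵐ[volume.restrict tri] f') (α : ℕ × ℕ) :
    weakDeriv α f = weakDeriv α f' := by
  have : IsWeakDeriv α f = IsWeakDeriv α f' := by
    ext g
    exact ⟨fun h => h.congr hf (ae_eq_refl g), fun h => h.congr hf.symm (ae_eq_refl g)⟩
  unfold weakDeriv
  rw [this]

lemma isWeakDeriv_weakDeriv {α : ℕ × ℕ} {f : Plane → ℝ} (h : ∃ g, IsWeakDeriv α f g) :
    IsWeakDeriv α f (weakDeriv α f) := by
  rw [weakDeriv, dif_pos h]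
  exact h.choose_spec

lemma integrable_tri_mul {f φ : Plane → ℝ} (hf : LocallyIntegrableOn f tri) (hφ : IsTestFun φ) :
    Integrable (fun x => f x * φ x) := by
  have h1 : IntegrableOn f (tsupport φ) :=
    hf.integrableOn_compact_subset hφ.2.2 hφ.2.1
  have h2 : IntegrableOn (fun x => f x * φ x) (tsupport φ) :=
    h1.mul_continuousOn_of_subset hφ.1.continuous.continuousOn
      (isClosed_tsupport φ).measurableSet hφ.2.1 le_rfl
  refine (integrableOn_iff_integrable_of_support_subset fun x hx => ?_).1 h2
  exact subset_tsupport φ (right_ne_zero_of_mul hx)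

lemma IsWeakDeriv.ae_unique {α : ℕ × ℕ} {f g g' : Plane → ℝ} (h : IsWeakDeriv α f g)
    (h' : IsWeakDeriv α f g') : g =ᵐ[volume.restrict tri] g' := by
  have := isOpen_tri.ae_eq_zero_of_integral_contDiff_smul_eq_zero (f := g - g') (μ := volume)
    (h.2.1.sub h'.2.1) fun φ hφ hc hs => by
      have ht : IsTestFun φ := ⟨hφ, hc, hs⟩
      have e := (h.2.2 φ ht).symm.trans (h'.2.2 φ ht)
      rw [setIntegral_tri_mul ht, setIntegral_tri_mul ht] at e
      have e' := mul_left_cancel₀ (pow_ne_zero _ (by norm_num)) e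
      calc ∫ x, φ x • (g - g') x = ∫ x, (g x * φ x - g' x * φ x) := by
            congr 1; ext x; simp; ring
        _ = 0 := by
          rw [integral_sub (integrable_tri_mul h.2.1 ht) (integrable_tri_mul h'.2.1 ht), e',
            sub_self]
  rw [Filter.EventuallyEq, ae_restrict_iff' measurableSet_tri]
  filter_upwards [this] with x hx hxt
  exact sub_eq_zero.1 (hx hxt)

lemma IsWeakDeriv.weakDeriv_ae_eq {α : ℕ × ℕ} {f g : Plane → ℝ} (h : IsWeakDeriv α f g) :
    weakDeriv α f =ᵐ[volume.restrict tri] g :=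
  (isWeakDeriv_weakDeriv ⟨g, h⟩).ae_unique h

lemma isWeakDeriv_zero {f : Plane → ℝ} (h : LocallyIntegrableOn f tri) : IsWeakDeriv 0 f f :=
  ⟨h, h, fun φ _ => by simp [multiDeriv]⟩

lemma IsWeakDeriv.of_add {α β : ℕ × ℕ} {f g h : Plane → ℝ} (hg : IsWeakDeriv β f g)
    (hh : IsWeakDeriv (β + α) f h) : IsWeakDeriv α g h := by
  refine ⟨hg.2.1, hh.2.1, fun φ hφ => ?_⟩
  have h1 := hg.2.2 _ (hφ.multiDeriv α)
  have h2 := hh.2.2 φ hφ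
  rw [multiDeriv_multiDeriv hφ.1, h2] at h1
  have h3 : ((-1 : ℝ) ^ (β.1 + β.2)) ≠ 0 := pow_ne_zero _ (by norm_num)
  refine mul_left_cancel₀ h3 (h1.symm.trans ?_)
  rw [← mul_assoc, ← pow_add]
  congr 2
  simp only [Prod.fst_add, Prod.snd_add]
  ring

lemma IsWeakDeriv.trans {α β : ℕ × ℕ} {f g h : Plane → ℝ} (hg : IsWeakDeriv β f g)
    (hh : IsWeakDeriv α g h) : IsWeakDeriv (β + α) f h := by
  refine ⟨hg.1, hh.2.1, fun φ hφ => ?_⟩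
  rw [← multiDeriv_multiDeriv hφ.1, hg.2.2 _ (hφ.multiDeriv α), hh.2.2 φ hφ, ← mul_assoc,
    ← pow_add]
  congr 2
  simp only [Prod.fst_add, Prod.snd_add]
  ring

lemma IsWeakDeriv.sub {α : ℕ × ℕ} {f g f' g' : Plane → ℝ} (h : IsWeakDeriv α f g)
    (h' : IsWeakDeriv α f' g') :
    IsWeakDeriv α (fun x => f x - f' x) (fun x => g x - g' x) := by
  refine ⟨h.1.sub h'.1, h.2.1.sub h'.2.1, fun φ hφ => ?_⟩
  have hm := hφ.multiDeriv α
  have e1 := h.2.2 φ hφ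
  have e2 := h'.2.2 φ hφ
  rw [setIntegral_tri_mul hm, setIntegral_tri_mul hφ] at *
  simp only [sub_mul]
  rw [integral_sub (integrable_tri_mul h.1 hm) (integrable_tri_mul h'.1 hm),
    integral_sub (integrable_tri_mul h.2.1 hφ) (integrable_tri_mul h'.2.1 hφ), e1, e2, mul_sub]

lemma isWeakDeriv_partialDeriv {f : Plane → ℝ} (hf : ContDiff ℝ ∞ f) (i : Fin 2) :
    IsWeakDeriv (unitIndex i) f (partialDeriv i f) := by
  have hl : ∀ {u : Plane → ℝ}, ContDiff ℝ ∞ u → LocallyIntegrableOn u tri := fun hu =>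
    hu.continuous.locallyIntegrable.locallyIntegrableOn _
  have hd := contDiff_partialDeriv hf i
  refine ⟨hl hf, hl hd, fun φ hφ => ?_⟩
  rw [multiDeriv_unitIndex, setIntegral_tri_mul (hφ.partialDeriv i), setIntegral_tri_mul hφ]
  have := integral_mul_fderiv_eq_neg_fderiv_mul_of_integrable (μ := (volume : Measure Plane))
    (f := f) (g := φ) (v := EuclideanSpace.single i 1)
    (integrable_tri_mul (hl hd) hφ) (integrable_tri_mul (hl hf) (hφ.partialDeriv i))
    (integrable_tri_mul (hl hf) hφ) (fun x _ => hf.differentiable (by simp) x)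
    (fun x _ => hφ.1.differentiable (by simp) x)
  have e : (unitIndex i).1 + (unitIndex i).2 = 1 := by fin_cases i <;> simp [unitIndex]
  rw [e, pow_one, neg_one_mul]
  exact this

lemma isWeakDeriv_multiDeriv {f : Plane → ℝ} (hf : ContDiff ℝ ∞ f) (α : ℕ × ℕ) :
    IsWeakDeriv α f (multiDeriv α f) := by
  have hl : LocallyIntegrableOn f tri :=
    hf.continuous.locallyIntegrable.locallyIntegrableOn _
  have step : ∀ (i : Fin 2) (β : ℕ × ℕ), IsWeakDeriv β f (multiDeriv β f) →
      IsWeakDeriv (β + unitIndex i) f (multiDeriv (β + unitIndex i) f) := fun i β h => by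
    rw [add_comm β, ← multiDeriv_multiDeriv hf, multiDeriv_unitIndex, add_comm]
    exact h.trans (isWeakDeriv_partialDeriv (contDiff_multiDeriv hf β) i)
  obtain ⟨a, b⟩ := α
  induction a with
  | zero =>
    induction b with
    | zero => exact isWeakDeriv_zero hl
    | succ b ih => simpa [unitIndex] using step 1 _ ih
  | succ a ih => simpa [unitIndex] using step 0 _ ih

/-! ### The space `L^p(T)` -/

lemma eLpNorm_eq_lpPow {p : ℝ} (hp : 0 < p) (g : Plane → ℝ) :
    eLpNorm g (ENNReal.ofReal p) triMeasure = lpPow p g ^ (1 / p) := by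
  rw [eLpNorm_eq_lintegral_rpow_enorm_toReal (by simpa using hp) ENNReal.ofReal_ne_top,
    ENNReal.toReal_ofReal hp.le]
  rfl

lemma lpPow_congr {p : ℝ} {f g : Plane → ℝ} (h : f =ᵐ[volume.restrict tri] g) :
    lpPow p f = lpPow p g :=
  lintegral_congr_ae (h.fun_comp fun r => ‖r‖ₑ ^ p)

lemma gagliardoPow_congr {σ p : ℝ} {f g : Plane → ℝ} (h : f =ᵐ[volume.restrict tri] g) :
    gagliardoPow σ p f = gagliardoPow σ p g := by
  refine lintegral_congr_ae ?_
  filter_upwards [h] with x hx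
  refine lintegral_congr_ae ?_
  filter_upwards [h] with y hy
  rw [hx, hy]

lemma enorm_le_one_add_rpow {p : ℝ} (hp : 1 ≤ p) (a : ℝ≥0∞) : a ≤ 1 + a ^ p := by
  rcases le_total a 1 with h | h
  · exact h.trans le_self_add
  · calc a = a ^ (1 : ℝ) := (ENNReal.rpow_one a).symm
      _ ≤ a ^ p := ENNReal.rpow_le_rpow_of_exponent_le h hp
      _ ≤ _ := le_add_self

lemma lintegral_ne_top_of_rpow {p : ℝ} (hp : 1 ≤ p) {F : Plane → ℝ≥0∞}
    (h : ∫⁻ x in tri, F x ^ p ≠ ⊤) : ∫⁻ x in tri, F x ≠ ⊤ := by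
  refine ne_top_of_le_ne_top ?_ (lintegral_mono fun x => enorm_le_one_add_rpow hp (F x))
  rw [lintegral_add_left measurable_const]
  have := volume_tri_lt_top.ne
  simp only [lintegral_const, MeasurableSet.univ, Measure.restrict_apply, univ_inter, one_mul]
  finiteness

lemma integrableOn_of_lpPow {p : ℝ} (hp : 1 ≤ p) {g : Plane → ℝ} (hg : Measurable g)
    (h : lpPow p g ≠ ⊤) : IntegrableOn g tri :=
  ⟨hg.aestronglyMeasurable, (lintegral_ne_top_of_rpow hp h).lt_top⟩

/-! ### Derivatives along squeezing maps -/

/-- The `i`-th entry of a multi-index. -/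
def entry (i : Fin 2) (α : ℕ × ℕ) : ℕ := if i = 0 then α.1 else α.2

/-- `squeeze i s` as a continuous linear map. -/
def squeezeCLM (i : Fin 2) (s : ℝ) : Plane →L[ℝ] Plane :=
  ContinuousLinearMap.id ℝ Plane +
    (EuclideanSpace.proj (𝕜 := ℝ) i).smulRight (EuclideanSpace.single i (s - 1) : Plane)

lemma squeezeCLM_apply (i : Fin 2) (s : ℝ) (x : Plane) : squeezeCLM i s x = squeeze i s x := by
  simp [squeezeCLM, squeeze, coordShift]

lemma squeeze_squeeze (i : Fin 2) (s t : ℝ) (x : Plane) :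
    squeeze i s (squeeze i t x) = squeeze i (s * t) x := by
  ext j
  by_cases h : j = i
  · subst h; simp only [squeeze_self]; ring
  · simp only [squeeze_of_ne h]

lemma squeeze_one (i : Fin 2) (x : Plane) : squeeze i 1 x = x := by
  ext j
  by_cases h : j = i
  · subst h; simp [squeeze_self]
  · simp [squeeze_of_ne h]

lemma contDiff_comp_squeeze {φ : Plane → ℝ} (h : ContDiff ℝ ∞ φ) (i : Fin 2) (s : ℝ) :
    ContDiff ℝ ∞ fun x => φ (squeeze i s x) := by
  simp only [← squeezeCLM_apply]
  exact h.comp (squeezeCLM i s).contDiff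

lemma partialDeriv_comp_squeeze {φ : Plane → ℝ} (h : ContDiff ℝ ∞ φ) (i j : Fin 2) (s c : ℝ) :
    partialDeriv j (fun x => c * φ (squeeze i s x)) =
      fun x => (if j = i then s else 1) * c * partialDeriv j φ (squeeze i s x) := by
  ext x
  have hd : HasFDerivAt (fun x => c * φ (squeeze i s x))
      (c • (fderiv ℝ φ (squeeze i s x)).comp (squeezeCLM i s)) x := by
    have h1 : HasFDerivAt φ (fderiv ℝ φ (squeeze i s x)) (squeezeCLM i s x) := by
      rw [squeezeCLM_apply]
      exact (h.differentiable (by simp) _).hasFDerivAt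
    have := (h1.comp x (squeezeCLM i s).hasFDerivAt).const_mul c
    simpa only [Function.comp_def, squeezeCLM_apply] using this
  have e : squeeze i s (EuclideanSpace.single j 1) =
      (if j = i then s else 1 : ℝ) • EuclideanSpace.single j (1 : ℝ) := by
    ext k
    by_cases hk : k = i
    · subst hk
      by_cases hj : j = k
      · subst hj; simp [squeeze_self]
      · simp [squeeze_self, hj]
    · by_cases hj : j = i
      · subst hj; simp [squeeze_of_ne hk, hk]
      · simp [squeeze_of_ne hk, hj]
  rw [partialDeriv, hd.fderiv, partialDeriv]
  simp only [_root_.smul_apply, ContinuousLinearMap.comp_apply, squeezeCLM_apply, e,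
    map_smul, smul_eq_mul]
  ring

lemma partialDeriv_iterate_comp_squeeze {φ : Plane → ℝ} (h : ContDiff ℝ ∞ φ) (i j : Fin 2)
    (s c : ℝ) (n : ℕ) :
    (partialDeriv j)^[n] (fun x => c * φ (squeeze i s x)) =
      fun x => (if j = i then s else 1) ^ n * c * (partialDeriv j)^[n] φ (squeeze i s x) := by
  induction n with
  | zero => simp
  | succ n ih =>
    rw [Function.iterate_succ_apply', ih,
      partialDeriv_comp_squeeze (contDiff_partialDeriv_iterate h j n), Function.iterate_succ_apply']
    ext x
    ring

lemma multiDeriv_comp_squeeze {φ : Plane → ℝ} (h : ContDiff ℝ ∞ φ) (i : Fin 2) (s : ℝ)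
    (α : ℕ × ℕ) :
    multiDeriv α (fun x => φ (squeeze i s x)) =
      fun x => s ^ entry i α * multiDeriv α φ (squeeze i s x) := by
  have h1 := partialDeriv_iterate_comp_squeeze h i 1 s 1 α.2
  simp only [one_mul, mul_one] at h1
  unfold multiDeriv
  rw [h1, partialDeriv_iterate_comp_squeeze (contDiff_partialDeriv_iterate h 1 α.2)]
  fin_cases i <;> simp [entry]

lemma squeeze_inv_mem {i : Fin 2} {t : ℝ} (ht : t ∈ Ioo (0 : ℝ) 1) {x : Plane}
    (h : squeeze i t⁻¹ x ∈ tri) : x ∈ tri := by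
  have := squeeze_mem_tri (i := i) ht.1 ht.2.le h
  rwa [squeeze_squeeze, mul_inv_cancel₀ ht.1.ne', squeeze_one] at this

lemma IsTestFun.comp_squeeze {φ : Plane → ℝ} (h : IsTestFun φ) (i : Fin 2) {t : ℝ}
    (ht : t ∈ Ioo (0 : ℝ) 1) : IsTestFun fun x => φ (squeeze i t⁻¹ x) := by
  refine isTestFun_of_tsupport_subset (contDiff_comp_squeeze h.1 i _) fun x hx => ?_
  exact squeeze_inv_mem ht (h.2.2 (tsupport_comp_subset_preimage φ
    (continuous_coordShift i _) hx))

lemma integral_squeeze {i : Fin 2} {t : ℝ} (ht : 0 < t) {G : Plane → ℝ} (hG : Measurable G) :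
    ∫ x, G (squeeze i t x) = t⁻¹ * ∫ x, G x := by
  have e : Measure.map (squeeze i t) volume = ENNReal.ofReal t⁻¹ • (volume : Measure Plane) := by
    ext s hs
    rw [Measure.map_apply (measurable_squeeze_right i t) hs, Measure.smul_apply, smul_eq_mul,
      ← lintegral_indicator_one hs,
      ← lintegral_indicator_one (measurable_squeeze_right i t hs)]
    have := lintegral_coordShift (i := i) (v := EuclideanSpace.single i (t - 1))
      (by simpa using ht) (F := s.indicator 1) (measurable_one.indicator hs)
    rw [show 1 + (EuclideanSpace.single i (t - 1) : Plane) i = t by simp] at this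
    exact this
  rw [← integral_map (measurable_squeeze_right i t).aemeasurable hG.aestronglyMeasurable, e,
    integral_smul_measure, ENNReal.toReal_ofReal (inv_nonneg.2 ht.le), smul_eq_mul]

lemma setIntegral_squeeze_mul {i : Fin 2} {t : ℝ} (ht : t ∈ Ioo (0 : ℝ) 1) {F φ : Plane → ℝ}
    (hF : Measurable F) (hφ : IsTestFun φ) :
    ∫ x in tri, F (squeeze i t x) * φ x = t⁻¹ * ∫ x in tri, F x * φ (squeeze i t⁻¹ x) := by
  have hm := measurable_squeeze_right i t⁻¹
  have hφm := hφ.1.continuous.measurable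
  rw [setIntegral_tri_mul hφ, setIntegral_tri_mul (hφ.comp_squeeze i ht),
    ← integral_squeeze (i := i) ht.1 (by fun_prop)]
  congr 1
  ext x
  rw [squeeze_squeeze, inv_mul_cancel₀ ht.1.ne', squeeze_one]

/-- The chain rule for weak derivatives, by duality: the substitution moves S_t onto the test
function as S_(1/t), where the classical chain rule applies. The new test function is still
supported in the triangle because S_t maps the triangle into itself. -/
lemma IsWeakDeriv.setIntegral_squeeze {i : Fin 2} {t : ℝ} (ht : t ∈ Ioo (0 : ℝ) 1)
    {α : ℕ × ℕ} {g h φ : Plane → ℝ} (hgh : IsWeakDeriv α g h) (hg : Measurable g)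
    (hh : Measurable h) (hφ : IsTestFun φ) :
    ∫ x in tri, g (squeeze i t x) * multiDeriv α φ x =
      (-1) ^ (α.1 + α.2) * (t ^ entry i α * ∫ x in tri, h (squeeze i t x) * φ x) := by
  rw [setIntegral_squeeze_mul ht hg (hφ.multiDeriv α), setIntegral_squeeze_mul ht hh hφ]
  have h1 := hgh.2.2 _ (hφ.comp_squeeze i ht)
  rw [multiDeriv_comp_squeeze hφ.1] at h1
  have h2 : ∀ x, g x * (t⁻¹ ^ entry i α * multiDeriv α φ (squeeze i t⁻¹ x)) =
      t⁻¹ ^ entry i α * (g x * multiDeriv α φ (squeeze i t⁻¹ x)) := fun x => by ring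
  simp_rw [h2] at h1
  rw [integral_const_mul] at h1
  have h3 : t ^ entry i α * t⁻¹ ^ entry i α = 1 := by
    rw [← mul_pow, mul_inv_cancel₀ ht.1.ne', one_pow]
  linear_combination (t ^ entry i α * t⁻¹) * h1 -
    (t⁻¹ * ∫ x in tri, g x * multiDeriv α φ (squeeze i t⁻¹ x)) * h3

/-! ### Hardy means of functions -/

/-- The Hardy mean `∫₀¹ t^k g(S_t x) dt`, where `S_t` multiplies the `i`-th coordinate by `t`. -/
def hardyMean (i : Fin 2) (k : ℕ) (g : Plane → ℝ) (x : Plane) : ℝ :=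
  ∫ t in Ioo (0 : ℝ) 1, t ^ k * g (squeeze i t x)

lemma measurable_hardyMean (i : Fin 2) (k : ℕ) {g : Plane → ℝ} (hg : Measurable g) :
    Measurable (hardyMean i k g) := by
  have h1 : Measurable fun w : Plane × ℝ => squeeze i w.2 w.1 :=
    (measurable_squeeze i).comp measurable_swap
  have : Measurable fun w : Plane × ℝ => w.2 ^ k * g (squeeze i w.2 w.1) := by fun_prop
  exact this.stronglyMeasurable.integral_prod_right'.measurable

lemma enorm_pow_mul_le {t : ℝ} (ht : t ∈ Ioo (0 : ℝ) 1) (k : ℕ) (a : ℝ) :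
    ‖t ^ k * a‖ₑ ≤ ‖a‖ₑ := by
  rw [enorm_mul]
  refine mul_le_of_le_one_left zero_le ?_
  rw [← ofReal_norm, norm_pow, Real.norm_of_nonneg ht.1.le, ENNReal.ofReal_le_one]
  exact pow_le_one₀ ht.1.le ht.2.le

lemma enorm_hardyMean_le (i : Fin 2) (k : ℕ) (g : Plane → ℝ) (x : Plane) :
    ‖hardyMean i k g x‖ₑ ≤ ∫⁻ t in Ioo (0 : ℝ) 1, ‖g (squeeze i t x)‖ₑ :=
  (enorm_integral_le_lintegral_enorm _).trans
    (lintegral_mono_ae (ae_Ioo_iff fun _ ht => enorm_pow_mul_le ht k _))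

/-- Hardy's inequality with a weight that increases along the squeezing maps. -/
lemma exists_lpPow_mul_hardyMean_le (p : ℝ) (hp : 1 < p) :
    ∃ C : ℝ≥0∞, C ≠ ⊤ ∧ ∀ (i : Fin 2) (k : ℕ) (g w : Plane → ℝ), Measurable g → Measurable w →
      (∀ x ∈ tri, ∀ t ∈ Ioo (0 : ℝ) 1, ‖w x‖ₑ ≤ ‖w (squeeze i t x)‖ₑ) →
      lpPow p (fun x => w x * hardyMean i k g x) ≤ C * lpPow p (fun x => w x * g x) := by
  obtain ⟨C, hC, h⟩ := exists_lintegral_squeeze_le p hp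
  refine ⟨C, hC, fun i k g w hg hw hmono => ?_⟩
  refine le_trans ?_ (h i (fun x => ‖w x * g x‖ₑ) (by fun_prop))
  refine setLIntegral_mono' measurableSet_tri fun x hx => ?_
  gcongr
  rw [enorm_mul]
  refine (mul_le_mul_right (enorm_hardyMean_le i k g x) _).trans ?_
  rw [← lintegral_const_mul' _ _ (by finiteness)]
  refine lintegral_mono_ae (ae_Ioo_iff fun t ht => ?_)
  rw [enorm_mul]
  gcongr
  exact hmono x hx t ht

lemma exists_lpPow_hardyMean_le (p : ℝ) (hp : 1 < p) :
    ∃ C : ℝ≥0∞, C ≠ ⊤ ∧ ∀ (i : Fin 2) (k : ℕ) (g : Plane → ℝ), Measurable g →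
      lpPow p (hardyMean i k g) ≤ C * lpPow p g := by
  obtain ⟨C, hC, h⟩ := exists_lpPow_mul_hardyMean_le p hp
  refine ⟨C, hC, fun i k g hg => ?_⟩
  simpa using h i k g (fun _ => 1) hg measurable_const (by simp)

/-- Licence for Fubini in the variables x and t: on a set of finite measure, the L^p Hardy bound
gives integrability. -/
lemma integrable_prod_squeeze {p : ℝ} (hp : 1 < p) (i : Fin 2) {g : Plane → ℝ} (hg : Measurable g)
    (h : lpPow p g ≠ ⊤) :
    Integrable (fun w : Plane × ℝ => g (squeeze i w.2 w.1))
      ((volume.restrict tri).prod (volume.restrict (Ioo (0 : ℝ) 1))) := by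
  obtain ⟨C, hC, hle⟩ := exists_lintegral_squeeze_le p hp
  have hm : Measurable fun w : Plane × ℝ => squeeze i w.2 w.1 :=
    (measurable_squeeze i).comp measurable_swap
  refine ⟨(hg.comp hm).aestronglyMeasurable, ?_⟩
  have hgm : Measurable fun w : Plane × ℝ => ‖g (squeeze i w.2 w.1)‖ₑ := (hg.comp hm).enorm
  rw [HasFiniteIntegral, lintegral_prod _ hgm.aemeasurable]
  refine (lintegral_ne_top_of_rpow hp.le ?_).lt_top
  exact ne_top_of_le_ne_top (ENNReal.mul_ne_top hC h) (hle i (fun x => ‖g x‖ₑ) (by fun_prop))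

lemma integrable_prod_pow_mul_squeeze {p : ℝ} (hp : 1 < p) (i : Fin 2) (k : ℕ) {g φ : Plane → ℝ}
    (hg : Measurable g) (h : lpPow p g ≠ ⊤) (hφ : Measurable φ) {B : ℝ} (hB : ∀ x, ‖φ x‖ ≤ B) :
    Integrable (fun w : Plane × ℝ => w.2 ^ k * g (squeeze i w.2 w.1) * φ w.1)
      ((volume.restrict tri).prod (volume.restrict (Ioo (0 : ℝ) 1))) := by
  have hi := integrable_prod_squeeze hp i hg h
  have hm : Measurable fun w : Plane × ℝ => squeeze i w.2 w.1 :=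
    (measurable_squeeze i).comp measurable_swap
  refine Integrable.mono' (hi.norm.const_mul B) (by fun_prop) ?_
  have hae : ∀ᵐ w ∂((volume.restrict tri).prod (volume.restrict (Ioo (0 : ℝ) 1))),
      w.2 ∈ Ioo (0 : ℝ) 1 := by
    rw [Measure.prod_restrict]
    filter_upwards [ae_restrict_mem (measurableSet_tri.prod measurableSet_Ioo)] with w hw
    exact hw.2
  filter_upwards [hae] with w hw
  rw [norm_mul, norm_mul, norm_pow, Real.norm_of_nonneg hw.1.le, mul_comm B]
  refine mul_le_mul ?_ (hB _) (norm_nonneg _) (norm_nonneg _)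
  exact mul_le_of_le_one_left (norm_nonneg _) (pow_le_one₀ hw.1.le hw.2.le)

lemma ae_integrable_squeeze {p : ℝ} (hp : 1 < p) (i : Fin 2) (k : ℕ) {g : Plane → ℝ}
    (hg : Measurable g) (h : lpPow p g ≠ ⊤) :
    ∀ᵐ x ∂(volume.restrict tri), IntegrableOn (fun t => t ^ k * g (squeeze i t x)) (Ioo 0 1) := by
  have := (integrable_prod_pow_mul_squeeze hp i k hg h (φ := fun _ => 1) measurable_const
    (B := 1) (by simp)).prod_right_ae
  filter_upwards [this] with x hx
  simpa [IntegrableOn] using hx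

lemma hardyMean_sub_ae {p : ℝ} (hp : 1 < p) (i : Fin 2) (k : ℕ) {g g' : Plane → ℝ}
    (hg : Measurable g) (h : lpPow p g ≠ ⊤) (hg' : Measurable g') (h' : lpPow p g' ≠ ⊤) :
    hardyMean i k (fun x => g x - g' x) =ᵐ[volume.restrict tri]
      fun x => hardyMean i k g x - hardyMean i k g' x := by
  filter_upwards [ae_integrable_squeeze hp i k hg h, ae_integrable_squeeze hp i k hg' h'] with x h1 h2
  rw [hardyMean, hardyMean, hardyMean, ← integral_sub h1 h2]
  simp only [mul_sub]

/-- Finiteness of `lpPow p g` makes the defining integrals converge for almost every x; only there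
is the difference of two means the mean of the differences. -/
lemma exists_gagliardoPow_hardyMean_le (σ p : ℝ) (hσ : 0 < σ) (hp : 1 < p) :
    ∃ C : ℝ≥0∞, C ≠ ⊤ ∧ ∀ (i : Fin 2) (k : ℕ) (g : Plane → ℝ), Measurable g → lpPow p g ≠ ⊤ →
      gagliardoPow σ p (hardyMean i k g) ≤ C * gagliardoPow σ p g := by
  obtain ⟨C, hC, h⟩ := exists_gagliardo_lintegral_squeeze_le σ p hσ hp
  refine ⟨C, hC, fun i k g hg hgp => le_trans ?_ (h i g hg)⟩
  have hae := ae_integrable_squeeze hp i k hg hgp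
  refine lintegral_mono_ae ?_
  filter_upwards [hae] with x hx
  refine lintegral_mono_ae ?_
  filter_upwards [hae] with y hy
  gcongr
  rw [hardyMean, hardyMean, ← integral_sub hx hy]
  refine (enorm_integral_le_lintegral_enorm _).trans
    (lintegral_mono_ae (ae_Ioo_iff fun t ht => ?_))
  rw [← mul_sub]
  exact enorm_pow_mul_le ht k _

/-- Fubini reduces this to a fixed t. Each derivative in direction i releases a factor t, which is
why Hardy means carry a weight t^k. -/
lemma IsWeakDeriv.hardyMean {p : ℝ} (hp : 1 < p) (i : Fin 2) (k : ℕ) {α : ℕ × ℕ}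
    {g h : Plane → ℝ} (hgh : IsWeakDeriv α g h) (hg : Measurable g) (hh : Measurable h)
    (hgp : lpPow p g ≠ ⊤) (hhp : lpPow p h ≠ ⊤) :
    IsWeakDeriv α (hardyMean i k g) (hardyMean i (k + entry i α) h) := by
  obtain ⟨C, hC, hle⟩ := exists_lpPow_hardyMean_le p hp
  have hl : ∀ (k : ℕ) {u : Plane → ℝ}, Measurable u → lpPow p u ≠ ⊤ →
      LocallyIntegrableOn (TriHardy.hardyMean i k u) tri := fun k u hu hup =>
    (integrableOn_of_lpPow hp.le (measurable_hardyMean i k hu)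
      (ne_top_of_le_ne_top (ENNReal.mul_ne_top hC hup) (hle i k u hu))).locallyIntegrableOn
  have hswap : ∀ (k : ℕ) {u φ : Plane → ℝ}, Measurable u → lpPow p u ≠ ⊤ → IsTestFun φ →
      ∫ x in tri, TriHardy.hardyMean i k u x * φ x =
        ∫ t in Ioo (0 : ℝ) 1, t ^ k * ∫ x in tri, u (squeeze i t x) * φ x := by
    intro k u φ hu hup hφ
    obtain ⟨B, hB⟩ := hφ.exists_bound
    have hi := integrable_prod_pow_mul_squeeze hp i k hu hup hφ.1.continuous.measurable hB
    calc _ = ∫ x in tri, ∫ t in Ioo (0 : ℝ) 1, t ^ k * u (squeeze i t x) * φ x := by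
          simp only [TriHardy.hardyMean, integral_mul_const]
      _ = ∫ t in Ioo (0 : ℝ) 1, ∫ x in tri, t ^ k * u (squeeze i t x) * φ x :=
          integral_integral_swap hi
      _ = _ := by simp only [mul_assoc, integral_const_mul]
  refine ⟨hl k hg hgp, hl _ hh hhp, fun φ hφ => ?_⟩
  rw [hswap k hg hgp (hφ.multiDeriv α), hswap _ hh hhp hφ, ← integral_const_mul]
  refine integral_congr_ae (ae_Ioo_iff fun t ht => ?_)
  simp only
  rw [hgh.setIntegral_squeeze ht hg hh hφ, pow_add]
  ring

/-! ### Sobolev spaces -/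

open Finset.HasAntidiagonal (antidiagonal)

lemma IsWeakDeriv.exists_measurable {α : ℕ × ℕ} {f g : Plane → ℝ} (h : IsWeakDeriv α f g) :
    ∃ g', Measurable g' ∧ IsWeakDeriv α f g' ∧ g =ᵐ[volume.restrict tri] g' := by
  have hm := h.2.1.aestronglyMeasurable
  exact ⟨hm.mk g, hm.stronglyMeasurable_mk.measurable, h.congr (ae_eq_refl f) hm.ae_eq_mk,
    hm.ae_eq_mk⟩

lemma lpPow_weakDeriv_le_sobolevPow {s p : ℝ} {f : Plane → ℝ} {α : ℕ × ℕ}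
    (hα : α.1 + α.2 ≤ ⌊s⌋₊) : lpPow p (weakDeriv α f) ≤ sobolevPow s p f := by
  refine le_trans ?_ le_self_add
  refine le_trans ?_ (Finset.single_le_sum (f := fun n => ∑ α ∈ antidiagonal n,
    lpPow p (weakDeriv α f)) (fun _ _ => zero_le)
    (Finset.mem_range.2 (Nat.lt_succ_of_le hα)))
  exact Finset.single_le_sum (f := fun α => lpPow p (weakDeriv α f)) (fun _ _ => zero_le)
    (Finset.HasAntidiagonal.mem_antidiagonal.2 rfl)

lemma rpow_lt_top_iff {p : ℝ} (hp : 0 < p) (a : ℝ≥0∞) : a ^ (1 / p) < ⊤ ↔ a < ⊤ :=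
  ENNReal.rpow_lt_top_iff_of_pos (by positivity)

lemma MemSobolev.sobolevPow_lt_top {s p : ℝ} (hp : 0 < p) {f : Plane → ℝ}
    (h : MemSobolev s p f) : sobolevPow s p f < ⊤ :=
  (rpow_lt_top_iff hp _).1 h.2.2

/-- `weakDeriv` is an arbitrary choice without measurability; the Hardy estimates are applied to
this representative. -/
lemma MemSobolev.exists_rep {s p : ℝ} (hp : 0 < p) {f : Plane → ℝ} (h : MemSobolev s p f)
    {α : ℕ × ℕ} (hα : α.1 + α.2 ≤ ⌊s⌋₊) :
    ∃ g, Measurable g ∧ IsWeakDeriv α f g ∧ weakDeriv α f =ᵐ[volume.restrict tri] g ∧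
      lpPow p g ≠ ⊤ := by
  obtain ⟨g, hg, hw, he⟩ := (isWeakDeriv_weakDeriv (h.2.1 α hα)).exists_measurable
  refine ⟨g, hg, hw, he, ?_⟩
  rw [← lpPow_congr he]
  exact ((lpPow_weakDeriv_le_sobolevPow hα).trans_lt (h.sobolevPow_lt_top hp)).ne

lemma sobolevPow_congr {f f' : Plane → ℝ} (h : f =ᵐ[volume.restrict tri] f') (s p : ℝ) :
    sobolevPow s p f = sobolevPow s p f' := by
  simp only [sobolevPow, weakDeriv_congr h]

lemma sobolevNorm_congr {f f' : Plane → ℝ} (h : f =ᵐ[volume.restrict tri] f') (s p : ℝ) :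
    sobolevNorm s p f = sobolevNorm s p f' := by
  rw [sobolevNorm, sobolevNorm, sobolevPow_congr h]

lemma MemSobolev.congr {s p : ℝ} {f f' : Plane → ℝ} (hf : MemSobolev s p f)
    (h : f =ᵐ[volume.restrict tri] f') : MemSobolev s p f' := by
  refine ⟨(memLp_congr_ae h).1 hf.1, fun α hα => ?_, ?_⟩
  · obtain ⟨g, hg⟩ := hf.2.1 α hα
    exact ⟨g, hg.congr h (ae_eq_refl g)⟩
  · rw [← sobolevNorm_congr h]
    exact hf.2.2

lemma weakDeriv_zero_ae {f : Plane → ℝ} (h : LocallyIntegrableOn f tri) :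
    weakDeriv 0 f =ᵐ[volume.restrict tri] f :=
  (isWeakDeriv_zero h).weakDeriv_ae_eq

lemma MemSobolev.weakDeriv_zero_ae {s p : ℝ} {f : Plane → ℝ} (h : MemSobolev s p f) :
    weakDeriv 0 f =ᵐ[volume.restrict tri] f := by
  obtain ⟨g, hg⟩ := h.2.1 0 (by simp)
  exact TriHardy.weakDeriv_zero_ae hg.1

lemma memLp_of_lpPow {p : ℝ} (hp : 0 < p) {f : Plane → ℝ} (hf : Measurable f)
    (h : lpPow p f ≠ ⊤) : MemLp f (ENNReal.ofReal p) triMeasure := by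
  refine ⟨hf.aestronglyMeasurable, ?_⟩
  rw [eLpNorm_eq_lpPow hp, rpow_lt_top_iff hp]
  exact h.lt_top

lemma sobolevNorm_le_of_pow_le {s s' p : ℝ} (hp : 0 < p) {f f' : Plane → ℝ} {C : ℝ≥0∞}
    (h : sobolevPow s p f ≤ C * sobolevPow s' p f') :
    sobolevNorm s p f ≤ C ^ (1 / p) * sobolevNorm s' p f' := by
  rw [sobolevNorm, sobolevNorm, ← ENNReal.mul_rpow_of_nonneg _ _ (by positivity)]
  exact ENNReal.rpow_le_rpow h (by positivity)

lemma weakDeriv_hardyMean_ae {s p : ℝ} (hp : 1 < p) (i : Fin 2) (k : ℕ) {h : Plane → ℝ}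
    (hm : Measurable h) (hs : MemSobolev s p h) {α : ℕ × ℕ} (hα : α.1 + α.2 ≤ ⌊s⌋₊) :
    ∃ g, Measurable g ∧ lpPow p g ≠ ⊤ ∧ weakDeriv α h =ᵐ[volume.restrict tri] g ∧
      IsWeakDeriv α (hardyMean i k h) (hardyMean i (k + entry i α) g) := by
  have hp0 : 0 < p := by linarith
  obtain ⟨g, hg, hw, he, hgp⟩ := hs.exists_rep hp0 hα
  have hhp : lpPow p h ≠ ⊤ := by
    rw [← lpPow_congr hs.weakDeriv_zero_ae]
    exact ((lpPow_weakDeriv_le_sobolevPow (by simp)).trans_lt (hs.sobolevPow_lt_top hp0)).ne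
  exact ⟨g, hg, hgp, he, hw.hardyMean hp i k hm hg hhp hgp⟩

/-- The norms are compared term by term: D^α of the mean is a mean of D^α h with a larger exponent
of t, and the L^p and Gagliardo bounds are uniform in that exponent. -/
lemma exists_sobolevPow_hardyMean_le (s p : ℝ) (hp : 1 < p) :
    ∃ C : ℝ≥0∞, C ≠ ⊤ ∧ ∀ (i : Fin 2) (k : ℕ) (h : Plane → ℝ), Measurable h → MemSobolev s p h →
      MemSobolev s p (hardyMean i k h) ∧
      sobolevPow s p (hardyMean i k h) ≤ C * sobolevPow s p h := by
  have hp0 : 0 < p := by linarith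
  obtain ⟨C, hC, hL⟩ := exists_lpPow_hardyMean_le p hp
  -- The Gagliardo bound requires σ > 0; for integral s the seminorm is absent and D = 0 will do.
  obtain ⟨D, hD, hG⟩ : ∃ D : ℝ≥0∞, D ≠ ⊤ ∧ (0 < Int.fract s → ∀ (i : Fin 2) (k : ℕ)
      (g : Plane → ℝ), Measurable g → lpPow p g ≠ ⊤ →
      gagliardoPow (Int.fract s) p (hardyMean i k g) ≤ D * gagliardoPow (Int.fract s) p g) := by
    by_cases hs : 0 < Int.fract s
    · obtain ⟨D, hD, h⟩ := exists_gagliardoPow_hardyMean_le (Int.fract s) p hs hp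
      exact ⟨D, hD, fun _ => h⟩
    · exact ⟨0, ENNReal.zero_ne_top, fun h => absurd h hs⟩
  refine ⟨C + D, by finiteness, fun i k h hm hs => ?_⟩
  have hl : ∀ α : ℕ × ℕ, α.1 + α.2 ≤ ⌊s⌋₊ →
      lpPow p (weakDeriv α (hardyMean i k h)) ≤ (C + D) * lpPow p (weakDeriv α h) := by
    intro α hα
    obtain ⟨g, hg, -, he, hw⟩ := weakDeriv_hardyMean_ae hp i k hm hs hα
    rw [lpPow_congr he, lpPow_congr hw.weakDeriv_ae_eq]
    exact (hL i _ g hg).trans (mul_le_mul_left le_self_add _)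
  have hpow : sobolevPow s p (hardyMean i k h) ≤ (C + D) * sobolevPow s p h := by
    rw [sobolevPow, sobolevPow, mul_add, Finset.mul_sum]
    simp only [Finset.mul_sum]
    refine add_le_add (Finset.sum_le_sum fun n hn => Finset.sum_le_sum fun α hα => hl α ?_) ?_
    · rw [Finset.HasAntidiagonal.mem_antidiagonal.1 hα]
      exact Nat.lt_succ_iff.1 (Finset.mem_range.1 hn)
    · split_ifs with hf
      · rw [Finset.mul_sum]
        refine Finset.sum_le_sum fun α hα => ?_
        obtain ⟨g, hg, hgp, he, hw⟩ :=
          weakDeriv_hardyMean_ae hp i k hm hs (Finset.HasAntidiagonal.mem_antidiagonal.1 hα).le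
        rw [gagliardoPow_congr he, gagliardoPow_congr hw.weakDeriv_ae_eq]
        exact (hG hf i _ g hg hgp).trans (mul_le_mul_left le_add_self _)
      · exact zero_le
  have hfin : sobolevPow s p (hardyMean i k h) < ⊤ :=
    hpow.trans_lt (ENNReal.mul_lt_top (by finiteness) (hs.sobolevPow_lt_top hp0))
  refine ⟨⟨?_, fun α hα => ?_, (rpow_lt_top_iff hp0 _).2 hfin⟩, hpow⟩
  · refine memLp_of_lpPow hp0 (measurable_hardyMean i k hm) ?_
    obtain ⟨g, hg, -, he, hw⟩ := weakDeriv_hardyMean_ae (α := 0) hp i k hm hs (by simp)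
    rw [← lpPow_congr (TriHardy.weakDeriv_zero_ae hw.1)]
    exact ((lpPow_weakDeriv_le_sobolevPow (by simp)).trans_lt hfin).ne
  · obtain ⟨g, -, -, -, hw⟩ := weakDeriv_hardyMean_ae hp i k hm hs hα
    exact ⟨_, hw⟩

/-! ### Derivatives of Sobolev functions -/

lemma unitIndex_order (i : Fin 2) : (unitIndex i).1 + (unitIndex i).2 = 1 := by
  fin_cases i <;> simp [unitIndex]

lemma sum_antidiagonal_unitIndex_le (i : Fin 2) (n : ℕ) (a : ℕ × ℕ → ℝ≥0∞) :
    ∑ α ∈ antidiagonal n, a (unitIndex i + α) ≤ ∑ α ∈ antidiagonal (n + 1), a α := by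
  rw [← Finset.sum_image (s := antidiagonal n) (g := fun α => unitIndex i + α) (f := a)
    fun _ _ _ _ h => add_left_cancel h]
  refine Finset.sum_le_sum_of_subset fun β hβ => ?_
  obtain ⟨α, hα, rfl⟩ := Finset.mem_image.1 hβ
  rw [Finset.HasAntidiagonal.mem_antidiagonal] at hα ⊢
  have := unitIndex_order i
  simp only [Prod.fst_add, Prod.snd_add]
  omega

lemma floor_add_one {s : ℝ} (hs : 0 ≤ s) : ⌊s + 1⌋₊ = ⌊s⌋₊ + 1 := Nat.floor_add_one hs

lemma MemSobolev.isWeakDeriv_weakDeriv_unitIndex {s p : ℝ} (hs : 0 ≤ s) {f : Plane → ℝ}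
    (h : MemSobolev (s + 1) p f) (i : Fin 2) {α : ℕ × ℕ} (hα : α.1 + α.2 ≤ ⌊s⌋₊) :
    IsWeakDeriv α (weakDeriv (unitIndex i) f) (weakDeriv (unitIndex i + α) f) := by
  have h1 := unitIndex_order i
  refine (isWeakDeriv_weakDeriv (h.2.1 _ ?_)).of_add (isWeakDeriv_weakDeriv (h.2.1 _ ?_))
  · rw [floor_add_one hs]; omega
  · rw [floor_add_one hs]; simp only [Prod.fst_add, Prod.snd_add]; omega

/-- N is left general so that it can be the L^p, the Gagliardo or the distance-weighted functional.
-/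
lemma sum_antidiagonal_weakDeriv_unitIndex_le {s p : ℝ} (hs : 0 ≤ s) {f : Plane → ℝ}
    (h : MemSobolev (s + 1) p f) (i : Fin 2) {N : (Plane → ℝ) → ℝ≥0∞}
    (hN : ∀ u v : Plane → ℝ, u =ᵐ[volume.restrict tri] v → N u = N v) {n : ℕ} (hn : n ≤ ⌊s⌋₊) :
    ∑ α ∈ antidiagonal n, N (weakDeriv α (weakDeriv (unitIndex i) f)) ≤
      ∑ α ∈ antidiagonal (n + 1), N (weakDeriv α f) := by
  refine le_trans (le_of_eq ?_) (sum_antidiagonal_unitIndex_le i n fun α => N (weakDeriv α f))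
  refine Finset.sum_congr rfl fun α hα => hN _ _ ?_
  exact (h.isWeakDeriv_weakDeriv_unitIndex hs i
    ((Finset.HasAntidiagonal.mem_antidiagonal.1 hα).trans_le hn)).weakDeriv_ae_eq

lemma MemSobolev.sobolevPow_weakDeriv_le {s p : ℝ} (hs : 0 ≤ s) {f : Plane → ℝ}
    (h : MemSobolev (s + 1) p f) (i : Fin 2) :
    sobolevPow s p (weakDeriv (unitIndex i) f) ≤ sobolevPow (s + 1) p f := by
  rw [sobolevPow, sobolevPow, floor_add_one hs, Int.fract_add_one]
  refine add_le_add ?_ ?_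
  · rw [Finset.sum_range_succ' _ (⌊s⌋₊ + 1)]
    refine le_trans (Finset.sum_le_sum fun n hn => ?_) le_self_add
    exact sum_antidiagonal_weakDeriv_unitIndex_le hs h i (fun u v => lpPow_congr)
      (Nat.lt_succ_iff.1 (Finset.mem_range.1 hn))
  · split_ifs with hf
    · exact sum_antidiagonal_weakDeriv_unitIndex_le hs h i (fun u v => gagliardoPow_congr) le_rfl
    · exact le_rfl

lemma MemSobolev.weakDeriv_unitIndex {s p : ℝ} (hp : 0 < p) (hs : 0 ≤ s) {f : Plane → ℝ}
    (h : MemSobolev (s + 1) p f) (i : Fin 2) : MemSobolev s p (weakDeriv (unitIndex i) f) := by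
  refine ⟨?_, fun α hα => ⟨_, h.isWeakDeriv_weakDeriv_unitIndex hs i hα⟩,
    (rpow_lt_top_iff hp _).2
      ((h.sobolevPow_weakDeriv_le hs i).trans_lt (h.sobolevPow_lt_top hp))⟩
  have h1 : (unitIndex i).1 + (unitIndex i).2 ≤ ⌊s + 1⌋₊ := by
    rw [unitIndex_order, floor_add_one hs]; omega
  obtain ⟨g, hg, -, he, hgp⟩ := h.exists_rep hp h1
  exact (memLp_congr_ae he).2 (memLp_of_lpPow hp hg hgp)

/-! ### Smoothness of Hardy means -/

lemma hasFDerivAt_integral_Ioo {F : Type} [NormedAddCommGroup F] [NormedSpace ℝ F]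
    {H : ℝ × Plane → F} (hH : ContDiff ℝ ∞ H) (x : Plane) :
    HasFDerivAt (fun x => ∫ t in Ioo (0 : ℝ) 1, H (t, x))
      (∫ t in Ioo (0 : ℝ) 1, (fderiv ℝ H (t, x)).comp (ContinuousLinearMap.inr ℝ ℝ Plane)) x := by
  have hc : Continuous fun q : ℝ × Plane =>
      (fderiv ℝ H q).comp (ContinuousLinearMap.inr ℝ ℝ Plane) :=
    ((hH.fderiv_right (m := ∞) (by simp)).clm_comp contDiff_const).continuous
  obtain ⟨B, hB⟩ := (isCompact_Icc (a := (0 : ℝ)) (b := 1)).prod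
    (isCompact_closedBall x 1) |>.exists_bound_of_continuousOn hc.continuousOn
  have hint : ∀ {G : Type} [NormedAddCommGroup G] {u : ℝ → G}, Continuous u →
      IntegrableOn u (Ioo 0 1) := fun hu =>
    (hu.locallyIntegrable.integrableOn_isCompact isCompact_Icc).mono_set Ioo_subset_Icc_self
  refine hasFDerivAt_integral_of_dominated_of_fderiv_le (bound := fun _ => B)
    (F := fun x t => H (t, x))
    (F' := fun x t => (fderiv ℝ H (t, x)).comp (ContinuousLinearMap.inr ℝ ℝ Plane))
    (Metric.ball_mem_nhds x one_pos) ?_ ?_ ?_ ?_ ?_ ?_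
  · refine Eventually.of_forall fun y => ?_
    exact (hint (hH.continuous.comp (Continuous.prodMk_left y))).aestronglyMeasurable
  · exact hint (hH.continuous.comp (Continuous.prodMk_left x))
  · exact (hint (hc.comp (Continuous.prodMk_left x))).aestronglyMeasurable
  · exact ae_Ioo_iff fun t ht y hy =>
      hB (t, y) ⟨Ioo_subset_Icc_self ht, Metric.ball_subset_closedBall hy⟩
  · exact hint continuous_const
  · refine ae_of_all _ fun t y _ => ?_
    exact (hH.differentiable (by simp) (t, y)).hasFDerivAt.comp y (hasFDerivAt_prodMk_right t y)

/-- The target space is quantified inside the induction because the derivative takes values in a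
space of linear maps. -/
lemma contDiff_integral_Ioo (n : ℕ) : ∀ {F : Type} [NormedAddCommGroup F] [NormedSpace ℝ F]
    {H : ℝ × Plane → F}, ContDiff ℝ ∞ H →
    ContDiff ℝ n fun x => ∫ t in Ioo (0 : ℝ) 1, H (t, x) := by
  induction n with
  | zero =>
    intro F _ _ H hH
    exact contDiff_zero.2 (continuous_iff_continuousAt.2 fun x =>
      (hasFDerivAt_integral_Ioo hH x).continuousAt)
  | succ n ih =>
    intro F _ _ H hH
    refine contDiff_succ_iff_fderiv.2
      ⟨fun x => (hasFDerivAt_integral_Ioo hH x).differentiableAt, fun h => (WithTop.natCast_ne_top n h).elim, ?_⟩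
    have e : fderiv ℝ (fun x => ∫ t in Ioo (0 : ℝ) 1, H (t, x)) = fun x =>
        ∫ t in Ioo (0 : ℝ) 1, (fderiv ℝ H (t, x)).comp (ContinuousLinearMap.inr ℝ ℝ Plane) :=
      funext fun x => (hasFDerivAt_integral_Ioo hH x).fderiv
    rw [e]
    exact ih (H := fun q => (fderiv ℝ H q).comp (ContinuousLinearMap.inr ℝ ℝ Plane))
      ((hH.fderiv_right (m := ∞) (by simp)).clm_comp contDiff_const)

lemma contDiff_hardyMean (i : Fin 2) (k : ℕ) {φ : Plane → ℝ} (h : ContDiff ℝ ∞ φ) :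
    ContDiff ℝ ∞ (hardyMean i k φ) := by
  refine contDiff_infty.2 fun n => contDiff_integral_Ioo n
    (H := fun q : ℝ × Plane => q.1 ^ k * φ (squeeze i q.1 q.2)) ?_
  have hs : ContDiff ℝ ∞ fun q : ℝ × Plane => squeeze i q.1 q.2 := by
    simp only [squeeze_eq]
    have : ContDiff ℝ ∞ fun q : ℝ × Plane => q.2 i := by fun_prop
    fun_prop
  exact (contDiff_fst.pow k).mul (h.comp hs)

/-! ### Coordinate slices -/

lemma lintegral_plane {F : ℝ × ℝ → ℝ≥0∞} (hF : Measurable F) :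
    ∫⁻ x : Plane, F (x 0, x 1) = ∫⁻ q : ℝ × ℝ, F q := by
  have h := (volume_preserving_finTwoArrow ℝ).comp
    (EuclideanSpace.volume_preserving_symm_measurableEquiv_toLp (Fin 2))
  exact h.lintegral_comp hF

/-- Enlarge the triangle to the unit square and use Tonelli. This turns convergence of traces on an
edge into convergence in L^p of the functions extended constantly across the triangle. -/
lemma lintegral_coord_le (j : Fin 2) {ψ : ℝ → ℝ≥0∞} (hψ : Measurable ψ) :
    ∫⁻ x in tri, ψ (x j) ≤ ∫⁻ t in Ioo (0 : ℝ) 1, ψ t := by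
  have h1 : Measurable ((Ioo (0 : ℝ) 1).indicator ψ) := hψ.indicator measurableSet_Ioo
  have h2 : Measurable ((Ioo (0 : ℝ) 1).indicator (1 : ℝ → ℝ≥0∞)) :=
    measurable_one.indicator measurableSet_Ioo
  have hmem : ∀ x ∈ tri, ∀ j, x j ∈ Ioo (0 : ℝ) 1 := fun x hx j => ⟨coord_pos hx j, coord_lt_one hx j⟩
  rw [← lintegral_indicator measurableSet_tri, ← lintegral_indicator measurableSet_Ioo]
  fin_cases j
  · calc _ ≤ ∫⁻ x : Plane, (Ioo (0 : ℝ) 1).indicator ψ (x 0) *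
          (Ioo (0 : ℝ) 1).indicator 1 (x 1) := by
          refine lintegral_mono fun x => ?_
          by_cases hx : x ∈ tri
          · simp [hx, hmem x hx 0, hmem x hx 1]
          · simp [hx]
      _ = _ := by
          rw [lintegral_plane (F := fun q => (Ioo (0 : ℝ) 1).indicator ψ q.1 *
            (Ioo (0 : ℝ) 1).indicator 1 q.2) (by fun_prop), Measure.volume_eq_prod,
            lintegral_prod_mul h1.aemeasurable h2.aemeasurable,
            lintegral_indicator_one measurableSet_Ioo]
          simp
  · calc _ ≤ ∫⁻ x : Plane, (Ioo (0 : ℝ) 1).indicator 1 (x 0) *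
          (Ioo (0 : ℝ) 1).indicator ψ (x 1) := by
          refine lintegral_mono fun x => ?_
          by_cases hx : x ∈ tri
          · simp [hx, hmem x hx 0, hmem x hx 1]
          · simp [hx]
      _ = _ := by
          rw [lintegral_plane (F := fun q => (Ioo (0 : ℝ) 1).indicator 1 q.1 *
            (Ioo (0 : ℝ) 1).indicator ψ q.2) (by fun_prop), Measure.volume_eq_prod,
            lintegral_prod_mul h2.aemeasurable h1.aemeasurable,
            lintegral_indicator_one measurableSet_Ioo]
          simp

lemma edgePoint_eq_squeeze_zero (i : Fin 2) (x : Plane) : edgePoint i (x (i + 1)) = squeeze i 0 x := by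
  ext j
  fin_cases i <;> fin_cases j <;> simp [edgePoint, squeeze, coordShift_apply]

lemma squeeze_edgePoint_self (i : Fin 2) (s t : ℝ) :
    squeeze i s (edgePoint i t) = edgePoint i t := by
  ext j
  fin_cases i <;> fin_cases j <;> simp [edgePoint, squeeze, coordShift_apply]

lemma squeeze_edgePoint_of_ne {i j : Fin 2} (h : j ≠ i) (s t : ℝ) :
    squeeze i s (edgePoint j t) = edgePoint j (s * t) := by
  ext k
  fin_cases i <;> fin_cases j <;> fin_cases k <;>
    simp_all [edgePoint, squeeze, coordShift_apply] <;> ring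

lemma continuous_edgePoint (i : Fin 2) : Continuous (edgePoint i) := by
  unfold edgePoint
  split_ifs <;> fun_prop

/-- The fundamental theorem of calculus for t ↦ φ(S_t x) on [0, 1]. -/
lemma eq_slice_add_mul_hardyMean {φ : Plane → ℝ} (h : ContDiff ℝ ∞ φ) (i : Fin 2) (x : Plane) :
    φ x = φ (squeeze i 0 x) + x i * hardyMean i 0 (partialDeriv i φ) x := by
  have hd : ∀ t : ℝ, HasDerivAt (fun t => φ (squeeze i t x))
      (x i * partialDeriv i φ (squeeze i t x)) t := by
    intro t
    have h1 : HasDerivAt (fun t : ℝ => squeeze i t x) (x i • EuclideanSpace.single i (1 : ℝ)) t := by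
      simp only [squeeze_eq]
      have : HasDerivAt (fun t : ℝ => x i * (t - 1)) (x i) t := by
        simpa using ((hasDerivAt_id t).sub_const 1).const_mul (x i)
      exact (this.smul_const (EuclideanSpace.single i (1 : ℝ) : Plane)).const_add x
    have := (h.differentiable (by simp) (squeeze i t x)).hasFDerivAt.comp_hasDerivAt t h1
    rw [map_smul, smul_eq_mul] at this
    exact this
  have hs : Continuous fun t : ℝ => squeeze i t x :=
    (continuous_squeeze i).comp (Continuous.prodMk_left x)
  have hc : Continuous fun t : ℝ => x i * partialDeriv i φ (squeeze i t x) :=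
    continuous_const.mul ((contDiff_partialDeriv h i).continuous.comp hs)
  have := intervalIntegral.integral_eq_sub_of_hasDerivAt (fun t _ => hd t)
    (hc.intervalIntegrable 0 1)
  rw [intervalIntegral.integral_of_le zero_le_one, integral_Ioc_eq_integral_Ioo,
    integral_const_mul, squeeze_one] at this
  simp only [hardyMean, pow_zero, one_mul]
  linarith

/-! ### Smooth functions on the triangle -/

lemma lpPow_ne_top_of_contDiff {p : ℝ} (hp : 0 < p) {φ : Plane → ℝ} (h : ContDiff ℝ ∞ φ) :
    lpPow p φ ≠ ⊤ := by
  obtain ⟨B, hB⟩ := isBounded_tri.isCompact_closure.exists_bound_of_continuousOn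
    h.continuous.continuousOn
  refine ne_top_of_le_ne_top (b := ENNReal.ofReal B ^ p * volume tri) ?_ ?_
  · have := volume_tri_lt_top.ne
    finiteness
  · rw [← setLIntegral_const]
    refine setLIntegral_mono' measurableSet_tri fun x hx => ?_
    gcongr
    rw [← ofReal_norm]
    exact ENNReal.ofReal_le_ofReal (hB x (subset_closure hx))

lemma lpPow_add_le {p : ℝ} (hp : 1 ≤ p) {u : Plane → ℝ} (hu : Measurable u) (v : Plane → ℝ) :
    lpPow p (fun x => u x + v x) ≤ 2 ^ (p - 1) * (lpPow p u + lpPow p v) := by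
  rw [lpPow, lpPow, lpPow, ← lintegral_add_left (by fun_prop),
    ← lintegral_const_mul' _ _ (by finiteness)]
  refine lintegral_mono fun x => ?_
  exact (ENNReal.rpow_le_rpow (enorm_add_le _ _) (by linarith)).trans
    (ENNReal.rpow_add_le_mul_rpow_add_rpow _ _ hp)

lemma ae_eq_zero_of_lpPow {p : ℝ} (hp : 0 < p) {u : Plane → ℝ} (hu : Measurable u)
    (h : lpPow p u = 0) : u =ᵐ[volume.restrict tri] 0 := by
  rw [lpPow, lintegral_eq_zero_iff (by fun_prop)] at h
  filter_upwards [h] with x hx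
  simpa [hp, hp.not_gt] using hx

lemma tendsto_zero_of_sobolevNorm {r p : ℝ} (hp : 0 < p) {w : ℕ → Plane → ℝ}
    (h : Tendsto (fun n => sobolevNorm r p (w n)) atTop (𝓝 0)) :
    Tendsto (fun n => sobolevPow r p (w n)) atTop (𝓝 0) := by
  have := (ENNReal.continuous_rpow_const (y := p)).tendsto 0 |>.comp h
  rw [ENNReal.zero_rpow_of_pos hp] at this
  refine this.congr fun n => ?_
  rw [Function.comp, sobolevNorm, ← ENNReal.rpow_mul, one_div_mul_cancel hp.ne', ENNReal.rpow_one]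

lemma HasTrace.congr {r p : ℝ} {i : Fin 2} {f f' g : Plane → ℝ} (h : HasTrace r p i f g)
    (hf : f =ᵐ[volume.restrict tri] f') : HasTrace r p i f' g := by
  obtain ⟨hm, φ, hφ, h1, h2⟩ := h
  refine ⟨hm.congr hf, φ, hφ, ?_, h2⟩
  refine h1.congr fun n => sobolevNorm_congr ?_ _ _
  filter_upwards [hf] with x hx
  rw [hx]

/-! ### Functions with vanishing trace as Hardy means -/

lemma lpPow_slice_le {p : ℝ} (i : Fin 2) {φ : Plane → ℝ} (h : ContDiff ℝ ∞ φ) :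
    lpPow p (fun x => φ (squeeze i 0 x)) ≤ ∫⁻ t in Ioo (0 : ℝ) 1, ‖φ (edgePoint i t)‖ₑ ^ p := by
  have hm := h.continuous.measurable
  have he := (continuous_edgePoint i).measurable
  simp only [lpPow, ← edgePoint_eq_squeeze_zero]
  exact lintegral_coord_le (i + 1) (ψ := fun t => ‖φ (edgePoint i t)‖ₑ ^ p) (by fun_prop)

/-- Pass to the limit in `eq_slice_add_mul_hardyMean` along the smooth functions that define the
trace: the slices tend to 0 in L^p because the trace vanishes, and the means converge by Hardy's
inequality. -/
lemma HasTrace.ae_eq_mul_hardyMean {p : ℝ} (hp : 1 < p) {i : Fin 2} {f g : Plane → ℝ}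
    (h : HasTrace 1 p i f 0) (hf : Measurable f) (hg : Measurable g)
    (hfg : IsWeakDeriv (unitIndex i) f g) (hgp : lpPow p g ≠ ⊤) :
    f =ᵐ[volume.restrict tri] fun x => x i * hardyMean i 0 g x := by
  have hp0 : 0 < p := by linarith
  obtain ⟨hm, φ, hφ, h1, h2⟩ := h
  obtain ⟨C, hC, hH⟩ := exists_lpPow_hardyMean_le p hp
  have h1' := tendsto_zero_of_sobolevNorm hp0 h1
  have hloc : ∀ n, LocallyIntegrableOn (fun x => φ n x - f x) tri := fun n =>
    ((hφ n).continuous.locallyIntegrable.locallyIntegrableOn _).sub hfg.1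
  have t1 : Tendsto (fun n => lpPow p (fun x => φ n x - f x)) atTop (𝓝 0) := by
    refine tendsto_of_tendsto_of_tendsto_of_le_of_le tendsto_const_nhds h1' (fun _ => zero_le)
      fun n => ?_
    rw [← lpPow_congr (TriHardy.weakDeriv_zero_ae (hloc n))]
    exact lpPow_weakDeriv_le_sobolevPow (by simp)
  have t2 : Tendsto (fun n => lpPow p (fun x => partialDeriv i (φ n) x - g x)) atTop (𝓝 0) := by
    refine tendsto_of_tendsto_of_tendsto_of_le_of_le tendsto_const_nhds h1' (fun _ => zero_le)
      fun n => ?_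
    rw [← lpPow_congr ((isWeakDeriv_partialDeriv (hφ n) i).sub hfg).weakDeriv_ae_eq]
    exact lpPow_weakDeriv_le_sobolevPow (by rw [unitIndex_order]; simp)
  have t3 : Tendsto (fun n => lpPow p (fun x => φ n (squeeze i 0 x))) atTop (𝓝 0) := by
    refine tendsto_of_tendsto_of_tendsto_of_le_of_le tendsto_const_nhds h2 (fun _ => zero_le)
      fun n => ?_
    simpa using lpPow_slice_le i (hφ n)
  have hsq := measurable_squeeze_right i 0
  have hA := measurable_hardyMean i 0 hg
  have key : ∀ n, lpPow p (fun x => f x - x i * hardyMean i 0 g x) ≤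
      2 ^ (p - 1) * (lpPow p (fun x => φ n x - f x) + 2 ^ (p - 1) *
        (lpPow p (fun x => φ n (squeeze i 0 x)) +
          C * lpPow p (fun x => partialDeriv i (φ n) x - g x))) := by
    intro n
    have hφm := (hφ n).continuous.measurable
    have hdm := (contDiff_partialDeriv (hφ n) i).continuous.measurable
    have hdp := lpPow_ne_top_of_contDiff hp0 (contDiff_partialDeriv (hφ n) i)
    -- The error splits into three parts, each of which tends to 0: the approximation of f, the
    -- slice, and the mean of the approximation error of ∂_i f.
    have e : (fun x => f x - x i * hardyMean i 0 g x) =ᵐ[volume.restrict tri]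
        fun x => (f x - φ n x) + (φ n (squeeze i 0 x) +
          x i * hardyMean i 0 (fun x => partialDeriv i (φ n) x - g x) x) := by
      filter_upwards [hardyMean_sub_ae hp i 0 hdm hdp hg hgp] with x hx
      rw [hx]
      linear_combination eq_slice_add_mul_hardyMean (hφ n) i x
    rw [lpPow_congr e]
    refine (lpPow_add_le hp.le (by fun_prop) _).trans ?_
    refine mul_le_mul_right (add_le_add (le_of_eq ?_)
      ((lpPow_add_le hp.le (by fun_prop) _).trans
        (mul_le_mul_right (add_le_add le_rfl ?_) _))) _
    · simp only [lpPow]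
      exact lintegral_congr fun x => by rw [enorm_sub_rev]
    · refine le_trans ?_ (hH i 0 _ (by fun_prop))
      refine setLIntegral_mono' measurableSet_tri fun x hx => ?_
      gcongr
      rw [enorm_mul]
      refine mul_le_of_le_one_left zero_le ?_
      rw [← ofReal_norm, Real.norm_of_nonneg (coord_pos hx i).le, ENNReal.ofReal_le_one]
      exact (coord_lt_one hx i).le
  have hlim : Tendsto (fun n => 2 ^ (p - 1) * (lpPow p (fun x => φ n x - f x) + 2 ^ (p - 1) *
        (lpPow p (fun x => φ n (squeeze i 0 x)) +
          C * lpPow p (fun x => partialDeriv i (φ n) x - g x)))) atTop (𝓝 0) := by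
    have hK : (2 : ℝ≥0∞) ^ (p - 1) ≠ ⊤ := by finiteness
    have a2 := ENNReal.Tendsto.const_mul t2 (Or.inr hC)
    have a3 := ENNReal.Tendsto.const_mul (t3.add a2) (Or.inr hK)
    have a4 := ENNReal.Tendsto.const_mul (t1.add a3) (Or.inr hK)
    simpa using a4
  have h0 : lpPow p (fun x => f x - x i * hardyMean i 0 g x) = 0 :=
    le_antisymm (ge_of_tendsto' hlim key) zero_le
  filter_upwards [ae_eq_zero_of_lpPow hp0 (by fun_prop) h0] with x hx
  exact sub_eq_zero.1 hx

/-! ### Traces of Hardy means -/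

lemma exists_lintegral_Ioo_hardy_le (p : ℝ) (hp : 1 < p) :
    ∃ C : ℝ≥0∞, C ≠ ⊤ ∧ ∀ F : ℝ → ℝ≥0∞, Measurable F →
      ∫⁻ x in Ioo (0 : ℝ) 1, (∫⁻ t in Ioo (0 : ℝ) 1, F (t * x)) ^ p ≤
        C * ∫⁻ x in Ioo (0 : ℝ) 1, F x ^ p := by
  obtain ⟨C, hC, h⟩ := exists_lintegral_Ioo_rpow_le p hp
  refine ⟨C * ∫⁻ t in Ioo (0 : ℝ) 1, ENNReal.ofReal t ^ ((p - 1) / 2 - 1),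
    ENNReal.mul_ne_top hC (lintegral_Ioo_rpow_ne_top (by linarith)), fun F hF => ?_⟩
  have hscale : ∀ t ∈ Ioo (0 : ℝ) 1, ∫⁻ x in Ioo (0 : ℝ) 1, F (t * x) ^ p ≤
      ENNReal.ofReal t⁻¹ * ∫⁻ x in Ioo (0 : ℝ) 1, F x ^ p := by
    intro t ht
    rw [← lintegral_indicator measurableSet_Ioo, ← lintegral_indicator measurableSet_Ioo]
    have e : Measure.map (fun x => t * x) volume = ENNReal.ofReal t⁻¹ • (volume : Measure ℝ) := by
      rw [Real.map_volume_mul_left ht.1.ne', abs_of_pos (inv_pos.2 ht.1)]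
    rw [← smul_eq_mul, ← lintegral_smul_measure, ← e,
      lintegral_map ((hF.pow_const p).indicator measurableSet_Ioo) (by fun_prop)]
    refine lintegral_mono fun x => ?_
    by_cases hx : x ∈ Ioo (0 : ℝ) 1
    · have : t * x ∈ Ioo (0 : ℝ) 1 :=
        ⟨mul_pos ht.1 hx.1, mul_lt_one_of_nonneg_of_lt_one_left ht.1.le ht.2 hx.2.le⟩
      simp [hx, this]
    · simp [hx]
  calc ∫⁻ x in Ioo (0 : ℝ) 1, (∫⁻ t in Ioo (0 : ℝ) 1, F (t * x)) ^ p
      ≤ ∫⁻ x in Ioo (0 : ℝ) 1, C * ∫⁻ t in Ioo (0 : ℝ) 1,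
          ENNReal.ofReal t ^ ((p - 1) / 2) * F (t * x) ^ p :=
        lintegral_mono fun x => h _ (by fun_prop)
    _ = C * ∫⁻ t in Ioo (0 : ℝ) 1, ∫⁻ x in Ioo (0 : ℝ) 1,
          ENNReal.ofReal t ^ ((p - 1) / 2) * F (t * x) ^ p := by
        rw [lintegral_const_mul' _ _ hC, lintegral_lintegral_swap]
        simp only [Function.uncurry_def]
        fun_prop
    _ ≤ C * ∫⁻ t in Ioo (0 : ℝ) 1,
          ENNReal.ofReal t ^ ((p - 1) / 2 - 1) * ∫⁻ x in Ioo (0 : ℝ) 1, F x ^ p := by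
        refine mul_le_mul_right (lintegral_mono_ae (ae_Ioo_iff fun t ht => ?_)) C
        have := ht.1
        rw [lintegral_const_mul' _ _ (by finiteness), ← rpow_mul_ofReal_inv ht.1, mul_assoc]
        exact mul_le_mul_right (hscale t ht) _
    _ = _ := by
        rw [lintegral_mul_const _ (by fun_prop), mul_assoc]

/-- On its own edge S_t is the identity, so the mean only shrinks values; on the other edge S_t
multiplies the parameter by t, and the one-dimensional Hardy inequality applies. -/
lemma exists_lintegral_hardyMean_edgePoint_le (p : ℝ) (hp : 1 < p) :
    ∃ C : ℝ≥0∞, C ≠ ⊤ ∧ ∀ (i j : Fin 2) (k : ℕ) (φ : Plane → ℝ), ContDiff ℝ ∞ φ →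
      ∫⁻ t in Ioo (0 : ℝ) 1, ‖hardyMean i k φ (edgePoint j t)‖ₑ ^ p ≤
        C * ∫⁻ t in Ioo (0 : ℝ) 1, ‖φ (edgePoint j t)‖ₑ ^ p := by
  obtain ⟨C, hC, h⟩ := exists_lintegral_Ioo_hardy_le p hp
  refine ⟨1 + C, by finiteness, fun i j k φ hφ => ?_⟩
  have hm := hφ.continuous.measurable
  have he := (continuous_edgePoint j).measurable
  by_cases hj : j = i
  · subst hj
    refine le_trans (lintegral_mono fun t => ?_) (le_mul_of_one_le_left zero_le le_self_add)
    gcongr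
    refine (enorm_hardyMean_le j k φ _).trans ?_
    simp [squeeze_edgePoint_self]
  · refine le_trans ?_ (mul_le_mul_left (le_add_self (a := C) (b := 1)) _)
    refine le_trans (lintegral_mono fun t => ?_) (h (fun t => ‖φ (edgePoint j t)‖ₑ) (by fun_prop))
    gcongr
    refine (enorm_hardyMean_le i k φ _).trans (le_of_eq ?_)
    simp only [squeeze_edgePoint_of_ne hj]

/-- The means of the approximants of h are smooth and serve as approximants of the mean; both
convergences follow from boundedness of the mean, in the Sobolev norm and on the edge. -/
lemma HasTrace.hardyMean {r p : ℝ} (hp : 1 < p) {j : Fin 2} {h : Plane → ℝ}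
    (ht : HasTrace r p j h 0) (hh : Measurable h) (i : Fin 2) (k : ℕ) :
    HasTrace r p j (hardyMean i k h) 0 := by
  have hp0 : 0 < p := by linarith
  obtain ⟨hm, φ, hφ, h1, h2⟩ := ht
  obtain ⟨C, hC, hS⟩ := exists_sobolevPow_hardyMean_le r p hp
  obtain ⟨D, hD, hE⟩ := exists_lintegral_hardyMean_edgePoint_le p hp
  refine ⟨(hS i k h hh hm).1, fun n => TriHardy.hardyMean i k (φ n),
    fun n => contDiff_hardyMean i k (hφ n), ?_, ?_⟩
  · obtain ⟨g0, hg0, -, he0, hgp0⟩ := hm.exists_rep (α := 0) hp0 (by simp)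
    have hhp : lpPow p h ≠ ⊤ := by
      rw [← lpPow_congr hm.weakDeriv_zero_ae, lpPow_congr he0]; exact hgp0
    have hlim := ENNReal.Tendsto.const_mul h1 (a := C ^ (1 / p)) (Or.inr (by finiteness))
    rw [mul_zero] at hlim
    refine tendsto_of_tendsto_of_tendsto_of_le_of_le' tendsto_const_nhds hlim
      (Eventually.of_forall fun _ => zero_le) ?_
    -- Only eventually in n: the Sobolev bound needs φ_n - h to have finite norm, which the
    -- convergence supplies for large n.
    filter_upwards [h1.eventually (gt_mem_nhds ENNReal.zero_lt_top)] with n hn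
    have hφm := (hφ n).continuous.measurable
    have hφp := lpPow_ne_top_of_contDiff hp0 (hφ n)
    have hw : MemSobolev r p fun x => φ n x - h x :=
      ⟨(memLp_of_lpPow hp0 hφm hφp).sub hm.1, fun α hα =>
        ⟨_, (isWeakDeriv_multiDeriv (hφ n) α).sub (isWeakDeriv_weakDeriv (hm.2.1 α hα))⟩, hn⟩
    rw [← sobolevNorm_congr (hardyMean_sub_ae hp i k hφm hφp hh hhp)]
    exact sobolevNorm_le_of_pow_le hp0 (hS i k _ (by fun_prop) hw).2
  · have hlim := ENNReal.Tendsto.const_mul h2 (a := D) (Or.inr hD)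
    rw [mul_zero] at hlim
    refine tendsto_of_tendsto_of_tendsto_of_le_of_le tendsto_const_nhds hlim
      (fun _ => zero_le) fun n => ?_
    simpa using hE i j k (φ n) (hφ n)

/-! ### Distances to the edges -/


lemma isClosed_edges (E : Finset (Fin 2)) : IsClosed (⋃ i ∈ E, edge i) :=
  E.finite_toSet.isClosed_biUnion fun i _ =>
    (isCompact_Icc.image (continuous_edgePoint i)).isClosed

lemma edges_nonempty {E : Finset (Fin 2)} {i : Fin 2} (hi : i ∈ E) :
    (⋃ i ∈ E, edge i).Nonempty :=
  ⟨edgePoint i 0, mem_biUnion hi (mem_image_of_mem _ (by simp))⟩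

lemma edgePoint_self (i : Fin 2) (t : ℝ) : edgePoint i t i = 0 := by
  fin_cases i <;> simp [edgePoint]

lemma notMem_edges (E : Finset (Fin 2)) {x : Plane} (hx : x ∈ tri) : x ∉ ⋃ i ∈ E, edge i := by
  simp only [mem_iUnion, not_exists]
  rintro i - ⟨t, -, rfl⟩
  exact (coord_pos hx i).ne' (edgePoint_self i t)

lemma squeeze_mem_edges {E : Finset (Fin 2)} (i : Fin 2) {t : ℝ} (ht : t ∈ Ioo (0 : ℝ) 1)
    {y : Plane} (hy : y ∈ ⋃ i ∈ E, edge i) : squeeze i t y ∈ ⋃ i ∈ E, edge i := by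
  simp only [mem_iUnion] at hy ⊢
  obtain ⟨j, hj, r, hr, rfl⟩ := hy
  by_cases h : j = i
  · subst h
    exact ⟨j, hj, r, hr, (squeeze_edgePoint_self j t r).symm⟩
  · refine ⟨j, hj, t * r, ⟨mul_nonneg ht.1.le hr.1, ?_⟩, (squeeze_edgePoint_of_ne h t r).symm⟩
    exact mul_le_one₀ ht.2.le hr.1 hr.2

lemma infDist_edges_pos {E : Finset (Fin 2)} {i : Fin 2} (hi : i ∈ E) {x : Plane} (hx : x ∈ tri) :
    0 < Metric.infDist x (⋃ i ∈ E, edge i) :=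
  ((isClosed_edges E).notMem_iff_infDist_pos (edges_nonempty hi)).1 (notMem_edges E hx)

/-- S_t is nonexpansive and maps the union of the edges into itself, also when E contains the edge
opposite to direction i's own. -/
lemma infDist_squeeze_le {E : Finset (Fin 2)} {j : Fin 2} (hj : j ∈ E) (i : Fin 2) {t : ℝ}
    (ht : t ∈ Ioo (0 : ℝ) 1) (x : Plane) :
    Metric.infDist (squeeze i t x) (⋃ i ∈ E, edge i) ≤ Metric.infDist x (⋃ i ∈ E, edge i) := by
  rw [Metric.le_infDist (edges_nonempty hj)]
  exact fun y hy => (Metric.infDist_le_dist_of_mem (squeeze_mem_edges i ht hy)).trans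
    (dist_squeeze_le i ht.1.le ht.2.le x y)

lemma enorm_infDist_rpow_le {E : Finset (Fin 2)} {j : Fin 2} (hj : j ∈ E) (i : Fin 2) {t σ : ℝ}
    (hσ : 0 ≤ σ) (ht : t ∈ Ioo (0 : ℝ) 1) {x : Plane} (hx : x ∈ tri) :
    ‖Metric.infDist x (⋃ i ∈ E, edge i) ^ (-σ)‖ₑ ≤
      ‖Metric.infDist (squeeze i t x) (⋃ i ∈ E, edge i) ^ (-σ)‖ₑ := by
  have h1 := infDist_edges_pos hj hx
  have h2 := infDist_edges_pos hj (squeeze_mem_tri (i := i) ht.1 ht.2.le hx)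
  rw [Real.enorm_of_nonneg (by positivity), Real.enorm_of_nonneg (by positivity)]
  exact ENNReal.ofReal_le_ofReal
    (Real.rpow_le_rpow_of_nonpos h2 (infDist_squeeze_le hj i ht x) (by linarith))

lemma measurable_infDist_rpow (E : Finset (Fin 2)) (a : ℝ) :
    Measurable fun x : Plane => Metric.infDist x (⋃ i ∈ E, edge i) ^ a := by
  have h : Measurable fun x : Plane => Metric.infDist x (⋃ i ∈ E, edge i) :=
    (Metric.continuous_infDist_pt _).measurable
  fun_prop

/-! ### Edge norms -/

lemma lpPow_weight_congr {p : ℝ} (w : Plane → ℝ) {u v : Plane → ℝ}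
    (h : u =ᵐ[volume.restrict tri] v) :
    lpPow p (fun x => w x * u x) = lpPow p (fun x => w x * v x) :=
  lpPow_congr (by filter_upwards [h] with x hx; rw [hx])

lemma edgePow_congr (E : Finset (Fin 2)) (s p : ℝ) {u v : Plane → ℝ}
    (h : u =ᵐ[volume.restrict tri] v) : edgePow E s p u = edgePow E s p v := by
  simp only [edgePow, sobolevPow_congr h, weakDeriv_congr h]

lemma sobolevPow_le_edgePow (E : Finset (Fin 2)) (s p : ℝ) (f : Plane → ℝ) :
    sobolevPow s p f ≤ edgePow E s p f := le_self_add

lemma MemEdge.edgePow_lt_top {E : Finset (Fin 2)} {s p : ℝ} (hp : 0 < p) {f : Plane → ℝ}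
    (h : MemEdge E s p f) : edgePow E s p f < ⊤ :=
  (rpow_lt_top_iff hp _).1 h.2.2

lemma edgeNorm_le_of_pow_le {E : Finset (Fin 2)} {s s' p : ℝ} (hp : 0 < p) {f f' : Plane → ℝ}
    {C : ℝ≥0∞} (h : edgePow E s p f ≤ C * edgePow E s' p f') :
    edgeNorm E s p f ≤ C ^ (1 / p) * edgeNorm E s' p f' := by
  rw [edgeNorm, edgeNorm, ← ENNReal.mul_rpow_of_nonneg _ _ (by positivity)]
  exact ENNReal.rpow_le_rpow h (by positivity)

lemma exists_edgePow_hardyMean_le (s p : ℝ) (hp : 1 < p) :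
    ∃ C : ℝ≥0∞, C ≠ ⊤ ∧ ∀ (E : Finset (Fin 2)) (i : Fin 2) (k : ℕ) (h : Plane → ℝ), Measurable h →
      MemSobolev s p h → edgePow E s p (hardyMean i k h) ≤ C * edgePow E s p h := by
  obtain ⟨C, hC, hS⟩ := exists_sobolevPow_hardyMean_le s p hp
  obtain ⟨D, hD, hW⟩ := exists_lpPow_mul_hardyMean_le p hp
  refine ⟨C + D, by finiteness, fun E i k h hm hs => ?_⟩
  rw [edgePow, edgePow, mul_add]
  refine add_le_add ((hS i k h hm hs).2.trans (mul_le_mul_left le_self_add _)) ?_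
  split_ifs with hc
  · obtain ⟨j, hj⟩ := hc.2
    rw [Finset.mul_sum]
    refine Finset.sum_le_sum fun α hα => ?_
    obtain ⟨g, hg, -, he, hw⟩ := weakDeriv_hardyMean_ae hp i k hm hs
      (Finset.HasAntidiagonal.mem_antidiagonal.1 hα).le
    rw [lpPow_weight_congr _ he, lpPow_weight_congr _ hw.weakDeriv_ae_eq]
    exact (hW i _ g (fun x => Metric.infDist x (⋃ i ∈ E, edge i) ^ (-Int.fract s)) hg
      (measurable_infDist_rpow E _) fun x hx t ht =>
        enorm_infDist_rpow_le hj i (Int.fract_nonneg s) ht hx).trans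
      (mul_le_mul_left le_add_self _)
  · exact zero_le

lemma MemSobolev.edgePow_weakDeriv_le {s p : ℝ} (hs : 0 ≤ s) {f : Plane → ℝ}
    (h : MemSobolev (s + 1) p f) (E : Finset (Fin 2)) (i : Fin 2) :
    edgePow E s p (weakDeriv (unitIndex i) f) ≤ edgePow E (s + 1) p f := by
  rw [edgePow, edgePow, floor_add_one hs, Int.fract_add_one]
  refine add_le_add (h.sobolevPow_weakDeriv_le hs i) ?_
  split_ifs with hc
  · exact sum_antidiagonal_weakDeriv_unitIndex_le hs h i
      (N := fun u => lpPow p fun x => Metric.infDist x (⋃ i ∈ E, edge i) ^ (-Int.fract s) * u x)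
      (fun u v => lpPow_weight_congr _) le_rfl
  · exact le_rfl

/-! ### Division by a barycentric coordinate -/

lemma sobolevPow_one_le {r p : ℝ} (hr : 1 ≤ r) (f : Plane → ℝ) :
    sobolevPow 1 p f ≤ sobolevPow r p f := by
  have h1 : 1 ≤ ⌊r⌋₊ := Nat.le_floor (by simpa using hr)
  rw [sobolevPow, sobolevPow, Int.fract_one, if_neg (lt_irrefl _), add_zero, Nat.floor_one]
  refine le_trans ?_ le_self_add
  exact Finset.sum_le_sum_of_subset (Finset.range_mono (by omega))

lemma sobolevNorm_one_le {r p : ℝ} (hp : 0 < p) (hr : 1 ≤ r) (f : Plane → ℝ) :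
    sobolevNorm 1 p f ≤ sobolevNorm r p f :=
  ENNReal.rpow_le_rpow (sobolevPow_one_le hr f) (by positivity)

/-- The same approximants work in order 1, the only order that the representation by Hardy means
uses. -/
lemma HasTrace.one {r p : ℝ} (hp : 0 < p) (hr : 1 ≤ r) {i : Fin 2} {f g : Plane → ℝ}
    (h : HasTrace r p i f g) : HasTrace 1 p i f g := by
  obtain ⟨hm, φ, hφ, h1, h2⟩ := h
  have hfl : 1 ≤ ⌊r⌋₊ := Nat.le_floor (by simpa using hr)
  refine ⟨⟨hm.1, fun α hα => hm.2.1 α (hα.trans (by simpa using hfl)),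
    (sobolevNorm_one_le hp hr f).trans_lt hm.2.2⟩, φ, hφ, ?_, h2⟩
  exact tendsto_of_tendsto_of_tendsto_of_le_of_le tendsto_const_nhds h1 (fun _ => zero_le)
    fun n => sobolevNorm_one_le hp hr _

lemma MemSobolev.exists_ae_eq_hardyMean {s p : ℝ} (hp : 1 < p) (hs : 0 ≤ s) {i : Fin 2}
    {f : Plane → ℝ} (h : MemSobolev (s + 1) p f) (ht : HasTrace 1 p i f 0) :
    ∃ g, Measurable g ∧ weakDeriv (unitIndex i) f =ᵐ[volume.restrict tri] g ∧ MemSobolev s p g ∧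
      (fun x => (baryCoord i x)⁻¹ * f x) =ᵐ[volume.restrict tri] hardyMean i 0 g := by
  have hp0 : 0 < p := by linarith
  have h1 : (unitIndex i).1 + (unitIndex i).2 ≤ ⌊s + 1⌋₊ := by
    rw [unitIndex_order, floor_add_one hs]; omega
  obtain ⟨g, hg, hw, he, hgp⟩ := h.exists_rep hp0 h1
  obtain ⟨f', hf', hw', he'⟩ := (isWeakDeriv_zero hw.1).exists_measurable
  refine ⟨g, hg, he, (h.weakDeriv_unitIndex hp0 hs i).congr he, ?_⟩
  filter_upwards [he', (ht.congr he').ae_eq_mul_hardyMean hp hf' hg (hw.congr he' (ae_eq_refl g))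
    hgp, ae_restrict_mem measurableSet_tri] with x h1 h2 hx
  rw [h1, h2, baryCoord, min_eq_left (coord_lt_one hx i).le, inv_mul_cancel_left₀
    (coord_pos hx i).ne']

lemma MemEdge.hasTrace_one {E : Finset (Fin 2)} {s p : ℝ} (hp : 1 < p) (hs : 1 ≤ s) {f : Plane → ℝ}
    (h : MemEdge E s p f) {i : Fin 2} (hi : i ∈ E) : HasTrace 1 p i f 0 := by
  have hp0 : 0 < p := by linarith
  have hp1 : 1 / p < 1 := (div_lt_one hp0).2 hp
  have h1 := h.2.1 0 (by simp only [Prod.fst_zero, Prod.snd_zero, add_zero, Nat.cast_zero]; linarith) i hi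
  simp only [Prod.fst_zero, Prod.snd_zero, add_zero, Nat.cast_zero, sub_zero] at h1
  exact (h1.one hp0 hs).congr h.1.weakDeriv_zero_ae

lemma HasTrace.weakDeriv_hardyMean {s p : ℝ} (hp : 1 < p) (hs : 0 ≤ s) {i : Fin 2}
    {f g : Plane → ℝ} (h : MemSobolev (s + 1) p f) (hg : Measurable g) (hgs : MemSobolev s p g)
    (he : weakDeriv (unitIndex i) f =ᵐ[volume.restrict tri] g) {r : ℝ} {j : Fin 2} {β : ℕ × ℕ}
    (hβ : β.1 + β.2 ≤ ⌊s⌋₊) (ht : HasTrace r p j (weakDeriv (unitIndex i + β) f) 0) :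
    HasTrace r p j (weakDeriv β (TriHardy.hardyMean i 0 g)) 0 := by
  obtain ⟨u, hu, -, hgu, hw⟩ := weakDeriv_hardyMean_ae hp i 0 hg hgs hβ
  refine HasTrace.congr ?_ hw.weakDeriv_ae_eq.symm
  refine HasTrace.hardyMean hp (ht.congr ?_) hu i _
  rw [← weakDeriv_congr he] at hgu
  exact (h.isWeakDeriv_weakDeriv_unitIndex hs i hβ).weakDeriv_ae_eq.symm.trans hgu

/-- For |β| < s - 1/p, D^β of the quotient is a Hardy mean of D^(β + e_i) f, whose order |β| + 1 is
below (s + 1) - 1/p; its trace vanishes by hypothesis, and Hardy means preserve this. -/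
lemma MemEdge.div_baryCoord {E : Finset (Fin 2)} {s p : ℝ} (hp : 1 < p) (hs : 0 ≤ s) {i : Fin 2}
    (hi : i ∈ E) {f : Plane → ℝ} (h : MemEdge E (s + 1) p f) :
    MemEdge E s p fun x => (baryCoord i x)⁻¹ * f x := by
  have hp0 : 0 < p := by linarith
  obtain ⟨g, hg, he, hgs, hgf⟩ := h.1.exists_ae_eq_hardyMean hp hs
    (h.hasTrace_one hp (by linarith) hi)
  obtain ⟨C, hC, hS⟩ := exists_sobolevPow_hardyMean_le s p hp
  obtain ⟨D, hD, hE⟩ := exists_edgePow_hardyMean_le s p hp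
  refine ⟨(hS i 0 g hg hgs).1.congr hgf.symm, fun β hβ j hj => ?_, ?_⟩
  · have hpp : 0 < 1 / p := by positivity
    have hβ' : β.1 + β.2 ≤ ⌊s⌋₊ := Nat.le_floor (by linarith)
    rw [weakDeriv_congr hgf]
    refine HasTrace.weakDeriv_hardyMean hp hs h.1 hg hgs he hβ' ?_
    have hn : (unitIndex i + β).1 + (unitIndex i + β).2 = β.1 + β.2 + 1 := by
      have := unitIndex_order i
      simp only [Prod.fst_add, Prod.snd_add]; omega
    have := h.2.1 (unitIndex i + β) (by rw [hn]; push_cast at hβ ⊢; linarith) j hj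
    rw [hn] at this
    convert this using 1
    push_cast; ring
  · rw [edgeNorm, rpow_lt_top_iff hp0, edgePow_congr E s p hgf]
    refine (hE E i 0 g hg hgs).trans_lt (ENNReal.mul_lt_top hD.lt_top ?_)
    rw [← edgePow_congr E s p he]
    exact (h.1.edgePow_weakDeriv_le hs E i).trans_lt (h.edgePow_lt_top hp0)

theorem exists_sobolevNorm_div_baryCoord_le (s p : ℝ) (hp : 1 < p) (hs : 0 ≤ s) :
    ∃ C : ℝ≥0, ∀ (i : Fin 2) (f : Plane → ℝ), MemSobolev (s + 1) p f → HasTrace 1 p i f 0 →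
      MemSobolev s p (fun x => (baryCoord i x)⁻¹ * f x) ∧
      sobolevNorm s p (fun x => (baryCoord i x)⁻¹ * f x) ≤ C * sobolevNorm (s + 1) p f ∧
      sobolevNorm s p (fun x => (baryCoord i x)⁻¹ * f x) ≤
        C * sobolevNorm s p (weakDeriv (unitIndex i) f) := by
  have hp0 : 0 < p := by linarith
  obtain ⟨C, hC, hS⟩ := exists_sobolevPow_hardyMean_le s p hp
  refine ⟨(C ^ (1 / p)).toNNReal, fun i f h ht => ?_⟩
  rw [ENNReal.coe_toNNReal (by finiteness)]
  obtain ⟨g, hg, he, hgs, hgf⟩ := h.exists_ae_eq_hardyMean hp hs ht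
  have hb : sobolevPow s p (fun x => (baryCoord i x)⁻¹ * f x) ≤
      C * sobolevPow s p (weakDeriv (unitIndex i) f) := by
    rw [sobolevPow_congr hgf, sobolevPow_congr he]
    exact (hS i 0 g hg hgs).2
  exact ⟨(hS i 0 g hg hgs).1.congr hgf.symm, sobolevNorm_le_of_pow_le hp0
    (hb.trans (mul_le_mul_right (h.sobolevPow_weakDeriv_le hs i) C)),
    sobolevNorm_le_of_pow_le hp0 hb⟩

theorem exists_edgeNorm_div_baryCoord_le (s p : ℝ) (hp : 1 < p) (hs : 0 ≤ s) :
    ∃ C : ℝ≥0, ∀ (E : Finset (Fin 2)) (i : Fin 2), i ∈ E → ∀ f : Plane → ℝ,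
      MemEdge E (s + 1) p f →
      edgeNorm E s p (fun x => (baryCoord i x)⁻¹ * f x) ≤ C * edgeNorm E (s + 1) p f ∧
      edgeNorm E s p (fun x => (baryCoord i x)⁻¹ * f x) ≤
        C * edgeNorm E s p (weakDeriv (unitIndex i) f) := by
  have hp0 : 0 < p := by linarith
  obtain ⟨C, hC, hE⟩ := exists_edgePow_hardyMean_le s p hp
  refine ⟨(C ^ (1 / p)).toNNReal, fun E i hi f h => ?_⟩
  rw [ENNReal.coe_toNNReal (by finiteness)]
  obtain ⟨g, hg, he, hgs, hgf⟩ := h.1.exists_ae_eq_hardyMean hp hs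
    (h.hasTrace_one hp (by linarith) hi)
  have hb : edgePow E s p (fun x => (baryCoord i x)⁻¹ * f x) ≤
      C * edgePow E s p (weakDeriv (unitIndex i) f) := by
    rw [edgePow_congr E s p hgf, edgePow_congr E s p he]
    exact hE E i 0 g hg hgs
  exact ⟨edgeNorm_le_of_pow_le hp0
    (hb.trans (mul_le_mul_right (h.1.edgePow_weakDeriv_le hs E i) C)),
    edgeNorm_le_of_pow_le hp0 hb⟩

/-! ### Fractional Hardy inequalities -/

/-- The weight `x_i ^ (-a)`. -/
def hardyWeight (i : Fin 2) (a : ℝ) (x : Plane) : ℝ≥0∞ := ENNReal.ofReal (x i) ^ (-a)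

lemma measurable_hardyWeight (i : Fin 2) (a : ℝ) : Measurable (hardyWeight i a) := by
  unfold hardyWeight; fun_prop

lemma dist_coordShift (i : Fin 2) (v x : Plane) : dist x (coordShift i v x) = |x i| * ‖v‖ := by
  rw [coordShift, dist_self_add_right, norm_smul, Real.norm_eq_abs]

lemma localOsc_mul_rpow_le {p q : ℝ} (hp : 0 < p) (hq : 0 < q) (h : Plane → ℝ) (u : Plane)
    {r : ℝ≥0∞} (hr0 : r ≠ 0) (hrt : r ≠ ⊤) :
    localOsc p h u r * r ^ (-q) ≤ 2 ^ q * ∫⁻ z in tri, ‖h u - h z‖ₑ ^ p / edist u z ^ q := by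
  have hq' := ENNReal.rpow_ne_top_of_ne_zero hr0 hrt (y := -q)
  rw [localOsc, ← lintegral_mul_const' _ _ hq', ← lintegral_const_mul' _ _ (by finiteness)]
  refine lintegral_mono fun z => ?_
  split_ifs with hz
  · rw [div_rpow_eq, mul_left_comm]
    rcases eq_or_ne u z with rfl | huz
    · simp [hp]
    refine mul_le_mul_right ?_ _
    rw [ENNReal.rpow_neg, ENNReal.rpow_neg, ENNReal.inv_le_iff_inv_le, ENNReal.mul_inv, inv_inv,
      mul_comm, ← div_eq_mul_inv]
    · refine ENNReal.div_le_of_le_mul ?_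
      rw [mul_comm, ← ENNReal.mul_rpow_of_nonneg _ _ hq.le]
      exact ENNReal.rpow_le_rpow hz hq.le
    · left; positivity
    · left; finiteness
  · simp

/-- The displacement is at most r = L x_i, so averaging at scale r is possible (L x_i ≤ 2 is the cap
on the radius). The weight x_i^(-sp) and the factor r^(-2) combine to r^(-(sp+2)), which the
Gagliardo kernel dominates on |u - z| ≤ 2r. -/
lemma exists_lintegral_weight_sub_le (s p : ℝ) (hs : 0 < s) (hp : 1 < p) (L : ℝ) (hL : 0 < L)
    (τ : ℝ) (hτ : 0 < τ) :
    ∃ C : ℝ≥0∞, C ≠ ⊤ ∧ ∀ (i : Fin 2) (v : Plane) (S : Set Plane) (h : Plane → ℝ), 1 + v i = τ →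
      ‖v‖ ≤ L → MeasurableSet S → S ⊆ tri → (∀ x ∈ S, coordShift i v x ∈ tri ∧ L * x i ≤ 2) →
      Measurable h →
      ∫⁻ x in S, hardyWeight i (s * p) x * ‖h x - h (coordShift i v x)‖ₑ ^ p ≤
        C * gagliardoPow s p h := by
  have hp0 : 0 < p := by linarith
  have hq : 0 < s * p + 2 := by positivity
  obtain ⟨C, hC, hav⟩ := exists_enorm_sub_rpow_le p hp.le
  set B : ℝ≥0∞ := ENNReal.ofReal L ^ (s * p) * C * 2 ^ (s * p + 2) with hB
  have hBt : B ≠ ⊤ := by finiteness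
  refine ⟨B * (1 + ENNReal.ofReal τ⁻¹), by finiteness, fun i v S h hv hvL hS hST hx hh => ?_⟩
  set G : Plane → ℝ≥0∞ := fun u => ∫⁻ z in tri, ‖h u - h z‖ₑ ^ p / edist u z ^ (s * p + 2) with hG
  have hGm : Measurable G := Measurable.lintegral_prod_right'
    (f := fun w : Plane × Plane => ‖h w.1 - h w.2‖ₑ ^ p / edist w.1 w.2 ^ (s * p + 2))
    (by fun_prop)
  have hpt : ∀ x ∈ S, hardyWeight i (s * p) x * ‖h x - h (coordShift i v x)‖ₑ ^ p ≤
      B * (G x + G (coordShift i v x)) := by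
    intro x hxS
    have hxi := coord_pos (hST hxS) i
    have hr : 0 < L * x i := by positivity
    have h1 := hav h hh x (hST hxS) _ (hx x hxS).1 (L * x i) hr (hx x hxS).2 (by
      rw [dist_coordShift, abs_of_pos hxi, mul_comm]
      gcongr)
    set r := ENNReal.ofReal (L * x i) with hrdef
    have hr0 : r ≠ 0 := by simpa [hrdef] using hr
    have hrt : r ≠ ⊤ := ENNReal.ofReal_ne_top
    have hw : hardyWeight i (s * p) x = ENNReal.ofReal L ^ (s * p) * r ^ (-(s * p)) := by
      rw [hrdef, ENNReal.ofReal_mul hL.le, ENNReal.mul_rpow_of_ne_top (by simp) (by simp),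
        ← mul_assoc, ← ENNReal.rpow_add _ _ (by simpa using hL) (by simp), hardyWeight]
      simp
    calc _ ≤ ENNReal.ofReal L ^ (s * p) * r ^ (-(s * p)) * (C * r ^ (-2 : ℝ) *
            (localOsc p h x r + localOsc p h (coordShift i v x) r)) := by
          rw [hw]; gcongr
      _ = ENNReal.ofReal L ^ (s * p) * C * (localOsc p h x r * r ^ (-(s * p + 2)) +
            localOsc p h (coordShift i v x) r * r ^ (-(s * p + 2))) := by
          rw [show -(s * p + 2) = -(s * p) + -2 by ring, ENNReal.rpow_add _ _ hr0 hrt]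
          ring
      _ ≤ ENNReal.ofReal L ^ (s * p) * C * (2 ^ (s * p + 2) * G x +
            2 ^ (s * p + 2) * G (coordShift i v x)) := by
          exact mul_le_mul_right (add_le_add (localOsc_mul_rpow_le hp0 hq h x hr0 hrt)
            (localOsc_mul_rpow_le hp0 hq h _ hr0 hrt)) _
      _ = _ := by rw [hB]; ring
  calc _ ≤ ∫⁻ x in S, B * (G x + G (coordShift i v x)) := setLIntegral_mono' hS hpt
    _ = B * ((∫⁻ x in S, G x) + ∫⁻ x in S, G (coordShift i v x)) := by
        rw [lintegral_const_mul' _ _ hBt, lintegral_add_left hGm]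
    _ ≤ B * ((∫⁻ x in tri, G x) + ENNReal.ofReal τ⁻¹ * ∫⁻ x in tri, G x) := by
        gcongr
        rw [← hv]
        exact setLIntegral_coordShift_le (hv ▸ hτ) hGm hS measurableSet_tri fun x h => (hx x h).1
    _ = B * (1 + ENNReal.ofReal τ⁻¹) * ∫⁻ x in tri, G x := by ring

lemma le_two_mul_of_le_add_half {a N : ℝ≥0∞} (hN : N ≠ ⊤) (h : N ≤ a + 2⁻¹ * N) : N ≤ 2 * a := by
  rcases eq_or_ne a ⊤ with rfl | ha
  · simp
  lift a to ℝ≥0 using ha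
  lift N to ℝ≥0 using hN
  have h' : (N : ℝ) ≤ a + 2⁻¹ * N := by
    rw [show (2⁻¹ : ℝ≥0∞) = ((2⁻¹ : ℝ≥0) : ℝ≥0∞) by simp] at h
    exact_mod_cast h
  have : (N : ℝ) ≤ 2 * a := by linarith
  exact_mod_cast this

lemma enorm_rpow_le_add {p : ℝ} (hp : 1 ≤ p) (a b : ℝ) :
    ‖a‖ₑ ^ p ≤ 2 ^ (p - 1) * (‖a - b‖ₑ ^ p + ‖b‖ₑ ^ p) := by
  refine le_trans ?_ (ENNReal.rpow_add_le_mul_rpow_add_rpow _ _ hp)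
  refine ENNReal.rpow_le_rpow ?_ (by linarith)
  simpa using enorm_add_le (a - b) b

/-- Monotone convergence. Truncated weights give finite integrals for F in L¹, as absorption
requires. -/
lemma lintegral_weight_le_of_trunc {i : Fin 2} {a : ℝ} {F : Plane → ℝ≥0∞} (hF : Measurable F)
    {A : ℝ≥0∞} (h : ∀ K : ℕ, ∫⁻ x in tri, min (hardyWeight i a x) K * F x ≤ A) :
    ∫⁻ x in tri, hardyWeight i a x * F x ≤ A := by
  have hw := measurable_hardyWeight i a
  have e : ∀ x, hardyWeight i a x * F x = ⨆ K : ℕ, min (hardyWeight i a x) K * F x := fun x => by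
    rw [← ENNReal.iSup_mul, ← inf_iSup_eq, ENNReal.iSup_natCast, inf_top_eq]
  simp_rw [e]
  rw [lintegral_iSup (fun K => by fun_prop)]
  · exact iSup_le h
  · intro K K' hK x
    dsimp only
    gcongr

/-- Homogeneity of the weight gives τ^a and the Jacobian τ⁻¹. The weight w is left general so as to
include truncated ones. -/
lemma setLIntegral_weight_coordShift_le {i : Fin 2} {v : Plane} {τ a : ℝ} (hτ : 0 < τ)
    (hv : 1 + v i = τ) {S : Set Plane} (hS : MeasurableSet S)
    (hST : ∀ x ∈ S, coordShift i v x ∈ tri) {w F : Plane → ℝ≥0∞} (hw : Measurable w)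
    (hF : Measurable F)
    (hwS : ∀ x ∈ S, w x ≤ ENNReal.ofReal τ ^ a * w (coordShift i v x)) :
    ∫⁻ x in S, w x * F (coordShift i v x) ≤
      ENNReal.ofReal (τ ^ (a - 1)) * ∫⁻ x in tri, w x * F x := by
  have hfin : ENNReal.ofReal τ ^ a ≠ ⊤ :=
    ENNReal.rpow_ne_top_of_ne_zero (by simpa using hτ) ENNReal.ofReal_ne_top
  calc _ ≤ ∫⁻ x in S, ENNReal.ofReal τ ^ a * (w (coordShift i v x) * F (coordShift i v x)) := by
        refine setLIntegral_mono' hS fun x hx => ?_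
        rw [← mul_assoc]
        exact mul_le_mul_left (hwS x hx) _
    _ ≤ ENNReal.ofReal τ ^ a * (ENNReal.ofReal τ⁻¹ * ∫⁻ x in tri, w x * F x) := by
        rw [lintegral_const_mul' _ _ hfin, ← hv]
        refine mul_le_mul_right ?_ _
        exact setLIntegral_coordShift_le (F := fun x => w x * F x) (hv ▸ hτ) (by fun_prop) hS
          measurableSet_tri hST
    _ = _ := by
        rw [← mul_assoc, rpow_mul_ofReal_inv hτ, ENNReal.ofReal_rpow_of_pos hτ]

lemma hardyWeight_coordShift {i : Fin 2} {v : Plane} {τ a : ℝ} (hτ : 0 < τ)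
    (hv : 1 + v i = τ) (x : Plane) :
    hardyWeight i a x = ENNReal.ofReal τ ^ a * hardyWeight i a (coordShift i v x) := by
  rw [hardyWeight, hardyWeight, coordShift_apply, show x i + x i * v i = τ * x i by rw [← hv]; ring,
    ENNReal.ofReal_mul hτ.le, ENNReal.mul_rpow_of_ne_top (by simp) (by simp), ← mul_assoc,
    ← ENNReal.rpow_add _ _ (by simpa using hτ) (by simp)]
  simp

/-- The fractional Hardy inequality for `s p < 1`, without boundary conditions. -/
lemma exists_lintegral_weight_le_of_lt_one (s p : ℝ) (hs : 0 < s) (hp : 1 < p) (hsp : s * p < 1) :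
    ∃ C : ℝ≥0∞, C ≠ ⊤ ∧ ∀ (i : Fin 2) (f : Plane → ℝ), Measurable f → lpPow p f ≠ ⊤ →
      ∫⁻ x in tri, hardyWeight i (s * p) x * ‖f x‖ₑ ^ p ≤
        C * (lpPow p f + gagliardoPow s p f) := by
  have hp0 : 0 < p := by linarith
  -- Chosen so that 2^(p-1) τ^(sp-1) = 1/4; the two regions below then leave 1/2 of the integral to
  -- absorb.
  set τ : ℝ := 2 ^ ((p + 1) / (1 - s * p)) with hτ
  have hτ1 : 1 < τ := Real.one_lt_rpow one_lt_two (div_pos (by linarith) (by linarith))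
  have hτ0 : 0 < τ := by linarith
  have hτp : τ ^ (s * p - 1) = 2 ^ (-(p + 1)) := by
    rw [hτ, ← Real.rpow_mul zero_le_two]
    congr 1
    have : 1 - s * p ≠ 0 := by linarith
    rw [div_mul_eq_mul_div, div_eq_iff this]; ring
  obtain ⟨C, hC, hD⟩ := exists_lintegral_weight_sub_le s p hs hp (2 * τ) (by positivity) τ hτ0
  set P : ℝ≥0∞ := 2 ^ (p - 1) with hP
  have hPt : P ≠ ⊤ := by finiteness
  set M : ℝ≥0∞ := ENNReal.ofReal (1 / (2 * τ)) ^ (-(s * p)) with hM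
  have hMt : M ≠ ⊤ := ENNReal.rpow_ne_top_of_ne_zero
    (by simpa using hτ0) ENNReal.ofReal_ne_top
  refine ⟨2 * (P * C + P * C + M), by finiteness, fun i f hf hfp => ?_⟩
  have hw := measurable_hardyWeight i (s * p)
  have hfm : Measurable fun x => ‖f x‖ₑ ^ p := by fun_prop
  refine lintegral_weight_le_of_trunc hfm fun K => ?_
  set w : Plane → ℝ≥0∞ := fun x => min (hardyWeight i (s * p) x) K with hwdef
  have hwm : Measurable w := by fun_prop
  set N := ∫⁻ x in tri, w x * ‖f x‖ₑ ^ p with hN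
  have hNt : N ≠ ⊤ := by
    refine ne_top_of_le_ne_top (b := K * lpPow p f) (by finiteness) ?_
    rw [lpPow, ← lintegral_const_mul' _ _ (by finiteness)]
    exact lintegral_mono fun x => mul_le_mul_left (min_le_right _ _) _
  set j := i + 1 with hj
  have hji : j ≠ i := by rw [hj]; fin_cases i <;> decide
  have hsum : ∀ x ∈ tri, x i + x j < 1 := fun x hx => by
    have := hx.2.2
    rw [hj]; fin_cases i
    · simpa using this
    · simpa [add_comm] using this
  have hmem : ∀ x : Plane, 0 < x i → 0 < x j → x i + x j < 1 → x ∈ tri := by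
    intro x
    rw [hj]; fin_cases i
    · exact fun h0 h1 h2 => ⟨h0, h1, h2⟩
    · exact fun h0 h1 h2 => ⟨h1, h0, by simpa [add_comm] using h2⟩
  have hci : Measurable fun x : Plane => x i := by fun_prop
  have hcj : Measurable fun x : Plane => x j := by fun_prop
  -- In the strip Z one has τ x_i < 1/2. Where x_j ≤ 1/2, x_i alone can be multiplied by τ without
  -- leaving the triangle; where x_j > 1/2, the point is moved parallel to the hypotenuse, which
  -- keeps x_i + x_j fixed.
  set Z : Set Plane := {x | x i < 1 / (2 * τ)} with hZ
  set Y : Set Plane := {x | x j ≤ 1 / 2} with hY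
  have hZm : MeasurableSet Z := measurableSet_lt hci measurable_const
  have hYm : MeasurableSet Y := measurableSet_le hcj measurable_const
  have key : ∀ (v : Plane) (S : Set Plane), 1 + v i = τ → ‖v‖ ≤ 2 * τ → MeasurableSet S → S ⊆ tri →
      S ⊆ Z → (∀ x ∈ S, coordShift i v x ∈ tri) →
      ∫⁻ x in S, w x * ‖f x‖ₑ ^ p ≤ P * C * gagliardoPow s p f + 4⁻¹ * N := by
    intro v S hv hvL hS hST hSZ hΦ
    have h1 := hD i v S f hv hvL hS hST (fun x hx => ⟨hΦ x hx, by
      have : x i < 1 / (2 * τ) := hSZ hx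
      rw [lt_div_iff₀ (by positivity)] at this
      linarith⟩) hf
    have h2 := setLIntegral_weight_coordShift_le (a := s * p) hτ0 hv hS hΦ hwm hfm fun x _ => by
      -- The truncated weight inherits the scaling because min(c y, K) ≤ c min(y, K) for c ≥ 1.
      have h1τ : (1 : ℝ≥0∞) ≤ ENNReal.ofReal τ ^ (s * p) :=
        ENNReal.one_le_rpow (by simpa using hτ1.le) (by positivity)
      simp only [hwdef]
      rw [hardyWeight_coordShift hτ0 hv x]
      refine le_trans (min_le_min_left _ (le_mul_of_one_le_left zero_le h1τ)) (le_of_eq ?_)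
      have hmono : Monotone fun y : ℝ≥0∞ => ENNReal.ofReal τ ^ (s * p) * y :=
        fun _ _ h => mul_le_mul_right h _
      exact hmono.map_min.symm
    have hcs := (continuous_coordShift i v).measurable
    calc _ ≤ ∫⁻ x in S, (P * (hardyWeight i (s * p) x * ‖f x - f (coordShift i v x)‖ₑ ^ p) +
            P * (w x * ‖f (coordShift i v x)‖ₑ ^ p)) := by
          refine lintegral_mono fun x => ?_
          calc w x * ‖f x‖ₑ ^ p ≤ w x * (P * (‖f x - f (coordShift i v x)‖ₑ ^ p +
                ‖f (coordShift i v x)‖ₑ ^ p)) := by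
                gcongr; exact enorm_rpow_le_add hp.le _ _
            _ = P * (w x * ‖f x - f (coordShift i v x)‖ₑ ^ p) +
                P * (w x * ‖f (coordShift i v x)‖ₑ ^ p) := by ring
            _ ≤ _ := by gcongr; exact min_le_left _ _
      _ = P * (∫⁻ x in S, hardyWeight i (s * p) x * ‖f x - f (coordShift i v x)‖ₑ ^ p) +
            P * ∫⁻ x in S, w x * ‖f (coordShift i v x)‖ₑ ^ p := by
          rw [lintegral_add_left (by fun_prop), lintegral_const_mul' _ _ hPt,
            lintegral_const_mul' _ _ hPt]
      _ ≤ P * (C * gagliardoPow s p f) + P * (ENNReal.ofReal (τ ^ (s * p - 1)) * N) := by gcongr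
      _ = _ := by
          rw [hτp, ← mul_assoc, ← mul_assoc]
          congr 2
          rw [hP, ← ENNReal.ofReal_rpow_of_pos two_pos, ENNReal.ofReal_ofNat,
            ← ENNReal.rpow_add _ _ two_ne_zero ENNReal.ofNat_ne_top,
            show p - 1 + -(p + 1) = -2 by ring, ENNReal.rpow_neg, ENNReal.rpow_two]
          norm_num
  have ha := key (EuclideanSpace.single i (τ - 1)) (tri ∩ Z ∩ Y) (by simp)
    (by
      rw [PiLp.norm_single, Real.norm_of_nonneg (by linarith)]; linarith)
    ((measurableSet_tri.inter hZm).inter hYm) (fun x hx => hx.1.1) (fun x hx => hx.1.2)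
    (fun x hx => by
      obtain ⟨⟨hx, hxZ⟩, hxY⟩ := hx
      have hxZ : x i < 1 / (2 * τ) := hxZ
      have hxY : x j ≤ 1 / 2 := hxY
      rw [lt_div_iff₀ (by positivity)] at hxZ
      have e1 : coordShift i (EuclideanSpace.single i (τ - 1)) x i = τ * x i := by
        rw [coordShift_apply]; simp; ring
      have e2 : coordShift i (EuclideanSpace.single i (τ - 1)) x j = x j := by
        rw [coordShift_apply]; simp [hji]
      have := coord_pos hx i
      refine hmem _ ?_ ?_ ?_
      · rw [e1]; positivity
      · rw [e2]; exact coord_pos hx j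
      · rw [e1, e2]; linarith)
  have hb := key (EuclideanSpace.single i (τ - 1) - EuclideanSpace.single j (τ - 1))
    ((tri ∩ Z) \ Y) (by simp [hji.symm])
    (by
      refine (norm_sub_le _ _).trans ?_
      rw [PiLp.norm_single, PiLp.norm_single,
        Real.norm_of_nonneg (by linarith)]; linarith)
    ((measurableSet_tri.inter hZm).diff hYm) (fun x hx => hx.1.1) (fun x hx => hx.1.2)
    (fun x hx => by
      obtain ⟨⟨hx, hxZ⟩, hxY⟩ := hx
      have hxZ : x i < 1 / (2 * τ) := hxZ
      have hxY : 1 / 2 < x j := not_le.1 hxY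
      rw [lt_div_iff₀ (by positivity)] at hxZ
      have e1 : coordShift i (EuclideanSpace.single i (τ - 1) - EuclideanSpace.single j (τ - 1)) x i
          = τ * x i := by
        rw [coordShift_apply]; simp [hji.symm]; ring
      have e2 : coordShift i (EuclideanSpace.single i (τ - 1) - EuclideanSpace.single j (τ - 1)) x j
          = x j - x i * (τ - 1) := by
        rw [coordShift_apply]; simp [hji]; ring
      have := coord_pos hx i
      refine hmem _ ?_ ?_ ?_
      · rw [e1]; positivity
      · rw [e2]; nlinarith
      · rw [e1, e2]
        have := hsum x hx
        linarith)
  have hc : ∫⁻ x in tri \ Z, w x * ‖f x‖ₑ ^ p ≤ M * lpPow p f := by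
    calc _ ≤ ∫⁻ x in tri \ Z, M * ‖f x‖ₑ ^ p := by
          refine setLIntegral_mono' (measurableSet_tri.diff hZm) fun x hx => ?_
          gcongr
          refine (min_le_left _ _).trans ?_
          rw [hM, hardyWeight, ENNReal.rpow_neg, ENNReal.rpow_neg]
          refine ENNReal.inv_le_inv' (ENNReal.rpow_le_rpow ?_ (by positivity))
          exact ENNReal.ofReal_le_ofReal (not_lt.1 hx.2)
      _ ≤ ∫⁻ x in tri, M * ‖f x‖ₑ ^ p := lintegral_mono_set sdiff_subset
      _ = _ := lintegral_const_mul' _ _ hMt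
  have htot : N ≤ (P * C * gagliardoPow s p f + P * C * gagliardoPow s p f + M * lpPow p f) +
      2⁻¹ * N := by
    have hsplit : N = ((∫⁻ x in tri ∩ Z ∩ Y, w x * ‖f x‖ₑ ^ p) +
        ∫⁻ x in (tri ∩ Z) \ Y, w x * ‖f x‖ₑ ^ p) + ∫⁻ x in tri \ Z, w x * ‖f x‖ₑ ^ p := by
      rw [lintegral_inter_add_sdiff _ _ hYm, lintegral_inter_add_sdiff _ _ hZm]
    refine hsplit.le.trans ((add_le_add (add_le_add ha hb) hc).trans (le_of_eq ?_))
    have h4 : (4⁻¹ : ℝ≥0∞) + 4⁻¹ = 2⁻¹ := by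
      rw [← two_mul, show (4 : ℝ≥0∞) = 2 * 2 by norm_num, ENNReal.mul_inv (by simp) (by simp),
        ← mul_assoc, ENNReal.mul_inv_cancel (by simp) (by simp), one_mul]
    rw [← h4]; ring
  refine (le_two_mul_of_le_add_half hNt htot).trans ?_
  rw [mul_assoc 2, ← add_mul (P * C) (P * C) (gagliardoPow s p f), add_mul _ M]
  exact mul_le_mul_right (add_le_add (mul_le_mul_right le_add_self _)
    (mul_le_mul_right le_self_add _)) _

lemma abs_sub_slice_le {φ : Plane → ℝ} (h : ContDiff ℝ ∞ φ) (i : Fin 2) :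
    ∃ B : ℝ, 0 ≤ B ∧ ∀ x ∈ tri, ‖φ x - φ (squeeze i 0 x)‖ ≤ B * x i := by
  obtain ⟨B, hB⟩ := isBounded_tri.isCompact_closure.exists_bound_of_continuousOn
    (contDiff_partialDeriv h i).continuous.continuousOn
  have hB0 : 0 ≤ B := (norm_nonneg _).trans (hB _ (subset_closure tri_nonempty))
  refine ⟨B, hB0, fun x hx => ?_⟩
  have hA : ‖hardyMean i 0 (partialDeriv i φ) x‖ ≤ B := by
    have := norm_setIntegral_le_of_norm_le_const (μ := volume) (s := Ioo (0 : ℝ) 1)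
      (f := fun t => t ^ 0 * partialDeriv i φ (squeeze i t x)) (C := B) (by simp)
      fun t ht => by
        rw [pow_zero, one_mul]
        exact hB _ (subset_closure (squeeze_mem_tri ht.1 ht.2.le hx))
    simpa [hardyMean] using this
  have e : φ x - φ (squeeze i 0 x) = x i * hardyMean i 0 (partialDeriv i φ) x := by
    linear_combination eq_slice_add_mul_hardyMean h i x
  rw [e, norm_mul, Real.norm_of_nonneg (coord_pos hx i).le, mul_comm]
  exact mul_le_mul_of_nonneg_right hA (coord_pos hx i).le

/-- The fractional Hardy inequality for `s p > 1` and smooth functions. -/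
lemma exists_lintegral_weight_sub_slice_le (s p : ℝ) (hs : 0 < s) (hs1 : s < 1) (hp : 1 < p)
    (hsp : 1 < s * p) :
    ∃ C : ℝ≥0∞, C ≠ ⊤ ∧ ∀ (i : Fin 2) (φ : Plane → ℝ), ContDiff ℝ ∞ φ →
      ∫⁻ x in tri, hardyWeight i (s * p) x * ‖φ x - φ (squeeze i 0 x)‖ₑ ^ p ≤
        C * gagliardoPow s p φ := by
  have hp0 : 0 < p := by linarith
  -- Chosen so that 2^(p-1) t^(sp-1) = 1/2.
  set t : ℝ := 2 ^ (-p / (s * p - 1)) with ht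
  have ht0 : 0 < t := by positivity
  have ht1 : t < 1 := Real.rpow_lt_one_of_one_lt_of_neg one_lt_two
    (div_neg_of_neg_of_pos (by linarith) (by linarith))
  have htp : t ^ (s * p - 1) = 2 ^ (-p) := by
    rw [ht, ← Real.rpow_mul zero_le_two]
    congr 1
    have : s * p - 1 ≠ 0 := by linarith
    rw [div_mul_cancel₀ _ this]
  obtain ⟨C, hC, hD⟩ := exists_lintegral_weight_sub_le s p hs hp 1 one_pos t ht0
  set P : ℝ≥0∞ := 2 ^ (p - 1) with hP
  have hPt : P ≠ ⊤ := by finiteness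
  refine ⟨2 * (P * C), by finiteness, fun i φ hφ => ?_⟩
  have hφm := hφ.continuous.measurable
  have hsq := measurable_squeeze_right i
  have hw := measurable_hardyWeight i (s * p)
  set ψ : Plane → ℝ := fun x => φ x - φ (squeeze i 0 x) with hψ
  have hψm : Measurable ψ := by
    have := hsq 0
    fun_prop
  set N := ∫⁻ x in tri, hardyWeight i (s * p) x * ‖ψ x‖ₑ ^ p with hN
  -- No truncation here: ψ is O(x_i), and s < 1 makes x_i^(p - sp) bounded.
  have hNt : N ≠ ⊤ := by
    obtain ⟨B, hB0, hB⟩ := abs_sub_slice_le hφ i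
    refine ne_top_of_le_ne_top (b := ENNReal.ofReal B ^ p * volume tri) ?_ ?_
    · have := volume_tri_lt_top.ne
      finiteness
    · rw [← setLIntegral_const]
      refine setLIntegral_mono' measurableSet_tri fun x hx => ?_
      have hxi := coord_pos hx i
      have hX0 : ENNReal.ofReal (x i) ≠ 0 := by simpa using hxi
      calc hardyWeight i (s * p) x * ‖ψ x‖ₑ ^ p
          ≤ hardyWeight i (s * p) x * ENNReal.ofReal (B * x i) ^ p := by
            gcongr
            rw [← ofReal_norm]
            exact ENNReal.ofReal_le_ofReal (hB x hx)
        _ = ENNReal.ofReal B ^ p * ENNReal.ofReal (x i) ^ (p - s * p) := by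
            rw [ENNReal.ofReal_mul hB0, ENNReal.mul_rpow_of_nonneg _ _ hp0.le, hardyWeight,
              sub_eq_add_neg, ENNReal.rpow_add _ _ hX0 ENNReal.ofReal_ne_top]
            ring
        _ ≤ ENNReal.ofReal B ^ p * 1 := by
            gcongr
            refine ENNReal.rpow_le_one ?_ (by nlinarith)
            simpa using (coord_lt_one hx i).le
        _ = _ := mul_one _
  have hv : 1 + (EuclideanSpace.single i (t - 1) : Plane) i = t := by simp
  have hΦ : ∀ x ∈ tri, coordShift i (EuclideanSpace.single i (t - 1)) x ∈ tri := fun x hx =>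
    squeeze_mem_tri (i := i) ht0 ht1.le hx
  have h1 := hD i (EuclideanSpace.single i (t - 1)) tri φ hv
    (by rw [PiLp.norm_single, Real.norm_of_nonpos (by linarith)]; linarith) measurableSet_tri
    subset_rfl (fun x hx => ⟨hΦ x hx, by have := coord_lt_one hx i; linarith⟩) hφm
  have h2 := setLIntegral_weight_coordShift_le (a := s * p) ht0 hv measurableSet_tri hΦ hw
    (F := fun x => ‖ψ x‖ₑ ^ p) (by fun_prop) fun x _ => (hardyWeight_coordShift ht0 hv x).le
  change ∫⁻ x in tri, hardyWeight i (s * p) x * ‖φ x - φ (squeeze i t x)‖ₑ ^ p ≤ _ at h1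
  change ∫⁻ x in tri, hardyWeight i (s * p) x * ‖ψ (squeeze i t x)‖ₑ ^ p ≤ _ at h2
  have htot : N ≤ P * C * gagliardoPow s p φ + 2⁻¹ * N := by
    have hst := hsq t
    calc N ≤ ∫⁻ x in tri, (P * (hardyWeight i (s * p) x * ‖φ x - φ (squeeze i t x)‖ₑ ^ p) +
            P * (hardyWeight i (s * p) x * ‖ψ (squeeze i t x)‖ₑ ^ p)) := by
          refine lintegral_mono fun x => ?_
          -- Since S_0 S_t = S_0, the boundary values cancel.
          have e : ψ x - ψ (squeeze i t x) = φ x - φ (squeeze i t x) := by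
            simp only [hψ, squeeze_squeeze, zero_mul]; ring
          refine (mul_le_mul_right (enorm_rpow_le_add hp.le (ψ x) (ψ (squeeze i t x))) _).trans
            (le_of_eq ?_)
          rw [e]; ring
      _ = P * (∫⁻ x in tri, hardyWeight i (s * p) x * ‖φ x - φ (squeeze i t x)‖ₑ ^ p) +
            P * ∫⁻ x in tri, hardyWeight i (s * p) x * ‖ψ (squeeze i t x)‖ₑ ^ p := by
          rw [lintegral_add_left (by fun_prop), lintegral_const_mul' _ _ hPt,
            lintegral_const_mul' _ _ hPt]
      _ ≤ P * (C * gagliardoPow s p φ) + P * (ENNReal.ofReal (t ^ (s * p - 1)) * N) := by gcongr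
      _ = _ := by
          rw [htp, ← mul_assoc, ← mul_assoc]
          congr 2
          rw [hP, ← ENNReal.ofReal_rpow_of_pos two_pos, ENNReal.ofReal_ofNat,
            ← ENNReal.rpow_add _ _ two_ne_zero ENNReal.ofNat_ne_top,
            show p - 1 + -p = -1 by ring, ENNReal.rpow_neg, ENNReal.rpow_one]
  rw [mul_assoc]
  exact le_two_mul_of_le_add_half hNt htot

lemma gagliardoPow_add_le {σ p : ℝ} (hp : 1 ≤ p) {u : Plane → ℝ} (hu : Measurable u)
    (v : Plane → ℝ) : gagliardoPow σ p (fun x => u x + v x) ≤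
      2 ^ (p - 1) * (gagliardoPow σ p u + gagliardoPow σ p v) := by
  have hK : (2 : ℝ≥0∞) ^ (p - 1) ≠ ⊤ := by finiteness
  have hm : Measurable fun w : Plane × Plane =>
      ‖u w.1 - u w.2‖ₑ ^ p / edist w.1 w.2 ^ (σ * p + 2) := by fun_prop
  rw [gagliardoPow, gagliardoPow, gagliardoPow, ← lintegral_add_left hm.lintegral_prod_right',
    ← lintegral_const_mul' _ _ hK]
  refine lintegral_mono fun x => ?_
  dsimp only
  have hmx : Measurable fun y => ‖u x - u y‖ₑ ^ p / edist x y ^ (σ * p + 2) := by fun_prop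
  rw [← lintegral_add_left hmx, ← lintegral_const_mul' _ _ hK]
  refine lintegral_mono fun y => ?_
  dsimp only
  rw [← ENNReal.add_div, ← mul_div_assoc]
  gcongr
  refine le_trans ?_ (ENNReal.rpow_add_le_mul_rpow_add_rpow _ _ hp)
  refine ENNReal.rpow_le_rpow ?_ (by linarith)
  rw [show u x + v x - (u y + v y) = (u x - u y) + (v x - v y) by ring]
  exact enorm_add_le _ _

lemma sobolevPow_of_lt_one {s p : ℝ} (hs : 0 < s) (hs1 : s < 1) (f : Plane → ℝ) :
    sobolevPow s p f = lpPow p (weakDeriv 0 f) + gagliardoPow s p (weakDeriv 0 f) := by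
  have h0 : ⌊s⌋₊ = 0 := Nat.floor_eq_zero.2 hs1
  have h1 : Int.fract s = s := Int.fract_eq_self.2 ⟨hs.le, hs1⟩
  rw [sobolevPow, h0, h1, if_pos hs]
  simp
  rfl

/-- The fractional Hardy inequality for `s p > 1` and functions with vanishing trace. -/
lemma exists_lintegral_weight_le_of_one_lt (s p : ℝ) (hs : 0 < s) (hs1 : s < 1) (hp : 1 < p)
    (hsp : 1 < s * p) :
    ∃ C : ℝ≥0∞, C ≠ ⊤ ∧ ∀ (i : Fin 2) (f : Plane → ℝ), Measurable f → HasTrace s p i f 0 →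
      ∫⁻ x in tri, hardyWeight i (s * p) x * ‖f x‖ₑ ^ p ≤ C * gagliardoPow s p f := by
  have hp0 : 0 < p := by linarith
  obtain ⟨C, hC, hS⟩ := exists_lintegral_weight_sub_slice_le s p hs hs1 hp hsp
  set P : ℝ≥0∞ := 2 ^ (p - 1) with hP
  have hPt : P ≠ ⊤ := by finiteness
  refine ⟨P * (C * P), by finiteness, fun i f hf ht => ?_⟩
  obtain ⟨hm, φ, hφ, h1, h2⟩ := ht
  have h1' := tendsto_zero_of_sobolevNorm hp0 h1
  have hloc : ∀ n, LocallyIntegrableOn (fun x => φ n x - f x) tri := fun n =>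
    ((hφ n).continuous.locallyIntegrable.locallyIntegrableOn _).sub
      (hm.2.1 0 (by simp)).choose_spec.1
  have hsob : ∀ n, sobolevPow s p (fun x => φ n x - f x) =
      lpPow p (fun x => φ n x - f x) + gagliardoPow s p (fun x => φ n x - f x) := fun n => by
    rw [sobolevPow_of_lt_one hs hs1, lpPow_congr (weakDeriv_zero_ae (hloc n)),
      gagliardoPow_congr (weakDeriv_zero_ae (hloc n))]
  have t1 : Tendsto (fun n => lpPow p (fun x => φ n x - f x)) atTop (𝓝 0) :=
    tendsto_of_tendsto_of_tendsto_of_le_of_le tendsto_const_nhds h1' (fun _ => zero_le)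
      fun n => by rw [hsob n]; exact le_self_add
  have t2 : Tendsto (fun n => gagliardoPow s p (fun x => φ n x - f x)) atTop (𝓝 0) :=
    tendsto_of_tendsto_of_tendsto_of_le_of_le tendsto_const_nhds h1' (fun _ => zero_le)
      fun n => by rw [hsob n]; exact le_add_self
  have t3 : Tendsto (fun n => lpPow p (fun x => φ n (squeeze i 0 x))) atTop (𝓝 0) :=
    tendsto_of_tendsto_of_tendsto_of_le_of_le tendsto_const_nhds h2 (fun _ => zero_le)
      fun n => by simpa using lpPow_slice_le i (hφ n)
  have hw := measurable_hardyWeight i (s * p)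
  have hsq := measurable_squeeze_right i 0
  -- The L^p errors, including the slice, tend to 0 without a weight. Truncation bounds their weight
  -- by K, so they vanish as n → ∞ with K fixed, and the limiting bound does not involve K.
  refine lintegral_weight_le_of_trunc (by fun_prop) fun K => ?_
  have hK : (K : ℝ≥0∞) ≠ ⊤ := ENNReal.natCast_ne_top K
  have key : ∀ n, ∫⁻ x in tri, min (hardyWeight i (s * p) x) K * ‖f x‖ₑ ^ p ≤
      P * (C * (P * (gagliardoPow s p f + gagliardoPow s p (fun x => φ n x - f x))) +
        K * (P * (lpPow p (fun x => φ n x - f x) + lpPow p (fun x => φ n (squeeze i 0 x))))) := by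
    intro n
    have hφm := (hφ n).continuous.measurable
    have e1 : ∫⁻ x in tri, hardyWeight i (s * p) x * ‖φ n x - φ n (squeeze i 0 x)‖ₑ ^ p ≤
        C * (P * (gagliardoPow s p f + gagliardoPow s p (fun x => φ n x - f x))) := by
      refine (hS i _ (hφ n)).trans (mul_le_mul_right ?_ _)
      have := gagliardoPow_add_le (σ := s) hp.le hf (fun x => φ n x - f x)
      simpa using this
    have e2 : lpPow p (fun x => (φ n x - f x) + -φ n (squeeze i 0 x)) ≤
        P * (lpPow p (fun x => φ n x - f x) + lpPow p (fun x => φ n (squeeze i 0 x))) := by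
      refine (lpPow_add_le hp.le (by fun_prop) _).trans (le_of_eq ?_)
      simp only [lpPow, enorm_neg]
      rfl
    calc _ ≤ ∫⁻ x in tri, P * (hardyWeight i (s * p) x * ‖φ n x - φ n (squeeze i 0 x)‖ₑ ^ p +
            K * ‖(φ n x - f x) + -φ n (squeeze i 0 x)‖ₑ ^ p) := by
          refine lintegral_mono fun x => ?_
          have h3 : ‖f x‖ₑ ^ p ≤ P * (‖φ n x - φ n (squeeze i 0 x)‖ₑ ^ p +
              ‖(φ n x - f x) + -φ n (squeeze i 0 x)‖ₑ ^ p) := by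
            rw [← enorm_neg ((φ n x - f x) + -φ n (squeeze i 0 x))]
            refine le_trans ?_ (ENNReal.rpow_add_le_mul_rpow_add_rpow _ _ hp.le)
            refine ENNReal.rpow_le_rpow ?_ hp0.le
            refine le_trans (le_of_eq ?_) (enorm_add_le _ _)
            congr 1; ring
          calc _ ≤ min (hardyWeight i (s * p) x) K * (P * (‖φ n x - φ n (squeeze i 0 x)‖ₑ ^ p +
                ‖(φ n x - f x) + -φ n (squeeze i 0 x)‖ₑ ^ p)) := by gcongr
            _ = P * (min (hardyWeight i (s * p) x) K * ‖φ n x - φ n (squeeze i 0 x)‖ₑ ^ p +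
                min (hardyWeight i (s * p) x) K *
                  ‖(φ n x - f x) + -φ n (squeeze i 0 x)‖ₑ ^ p) := by ring
            _ ≤ _ := by
              gcongr
              · exact min_le_left _ _
              · exact min_le_right _ _
      _ = P * ((∫⁻ x in tri, hardyWeight i (s * p) x * ‖φ n x - φ n (squeeze i 0 x)‖ₑ ^ p) +
            K * lpPow p (fun x => (φ n x - f x) + -φ n (squeeze i 0 x))) := by
          rw [lintegral_const_mul' _ _ hPt, lintegral_add_left (by fun_prop),
            lintegral_const_mul' _ _ hK]
          rfl
      _ ≤ _ := by gcongr
  have hlim : Tendsto (fun n => P * (C * (P * (gagliardoPow s p f +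
      gagliardoPow s p (fun x => φ n x - f x))) + K * (P * (lpPow p (fun x => φ n x - f x) +
        lpPow p (fun x => φ n (squeeze i 0 x)))))) atTop (𝓝 (P * (C * P) * gagliardoPow s p f)) := by
    have a1 := ENNReal.Tendsto.const_mul (t2.const_add (gagliardoPow s p f)) (Or.inr hPt)
    have a2 := ENNReal.Tendsto.const_mul a1 (Or.inr hC)
    have a3 := ENNReal.Tendsto.const_mul (t1.add t3) (Or.inr hPt)
    have a4 := ENNReal.Tendsto.const_mul a3 (Or.inr hK)
    have a5 := ENNReal.Tendsto.const_mul (a2.add a4) (Or.inr hPt)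
    simpa [mul_assoc] using a5
  exact ge_of_tendsto' hlim key

/-- S_0 x is a point of the edge at distance x_i from x. -/
lemma infDist_edge_le {i : Fin 2} {x : Plane} (hx : x ∈ tri) :
    Metric.infDist x (⋃ j ∈ ({i} : Finset (Fin 2)), edge j) ≤ x i := by
  have hm : squeeze i 0 x ∈ ⋃ j ∈ ({i} : Finset (Fin 2)), edge j := by
    refine mem_biUnion (Finset.mem_coe.2 (Finset.mem_singleton_self i)) ?_
    exact ⟨x (i + 1), ⟨(coord_pos hx _).le, (coord_lt_one hx _).le⟩, edgePoint_eq_squeeze_zero i x⟩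
  refine (Metric.infDist_le_dist_of_mem hm).trans (le_of_eq ?_)
  rw [squeeze, dist_coordShift, PiLp.norm_single, abs_of_pos (coord_pos hx i)]
  simp

lemma exists_lintegral_weight_le_edgePow (s p : ℝ) (hs : 0 ≤ s) (hs1 : s < 1) (hp : 1 < p) :
    ∃ C : ℝ≥0∞, C ≠ ⊤ ∧ ∀ (i : Fin 2) (f : Plane → ℝ), Measurable f → MemEdge {i} s p f →
      ∫⁻ x in tri, hardyWeight i (s * p) x * ‖f x‖ₑ ^ p ≤ C * edgePow {i} s p f := by
  have hp0 : 0 < p := by linarith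
  rcases hs.eq_or_lt with rfl | hs0
  · refine ⟨1, ENNReal.one_ne_top, fun i f hf h => ?_⟩
    rw [one_mul]
    refine le_trans ?_ (sobolevPow_le_edgePow _ _ _ _)
    refine le_trans (le_of_eq ?_) (lpPow_weakDeriv_le_sobolevPow (α := 0) (by simp))
    rw [lpPow_congr h.1.weakDeriv_zero_ae]
    simp [hardyWeight, lpPow]
  have hsob : ∀ {i : Fin 2} {f : Plane → ℝ}, MemEdge {i} s p f →
      lpPow p f + gagliardoPow s p f ≤ edgePow {i} s p f := fun {i f} h => by
    refine le_trans (le_of_eq ?_) (sobolevPow_le_edgePow _ _ _ _)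
    rw [sobolevPow_of_lt_one hs0 hs1, lpPow_congr h.1.weakDeriv_zero_ae,
      gagliardoPow_congr h.1.weakDeriv_zero_ae]
  rcases lt_trichotomy (s * p) 1 with hsp | hsp | hsp
  · obtain ⟨C, hC, hH⟩ := exists_lintegral_weight_le_of_lt_one s p hs0 hp hsp
    refine ⟨C, hC, fun i f hf h => ?_⟩
    refine (hH i f hf ?_).trans (mul_le_mul_right (hsob h) _)
    exact ((le_self_add.trans (hsob h)).trans_lt (h.edgePow_lt_top hp0)).ne
  -- In the critical case sp = 1 the weighted term of the norm does the work; as the distance to the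
  -- edge is at most x_i, its weight dominates x_i^(-s).
  · refine ⟨1, ENNReal.one_ne_top, fun i f hf h => ?_⟩
    have h0 : ⌊s⌋₊ = 0 := Nat.floor_eq_zero.2 hs1
    have h1 : Int.fract s = s := Int.fract_eq_self.2 ⟨hs, hs1⟩
    rw [one_mul, edgePow, h0, h1, if_pos ⟨hsp, Finset.singleton_nonempty i⟩]
    refine le_trans ?_ le_add_self
    rw [Finset.HasAntidiagonal.antidiagonal_zero, Finset.sum_singleton]
    change _ ≤ lpPow p fun x => _ * weakDeriv 0 f x
    rw [lpPow_weight_congr (v := f) _ h.1.weakDeriv_zero_ae]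
    refine setLIntegral_mono' measurableSet_tri fun x hx => ?_
    have hpos := infDist_edges_pos (Finset.mem_singleton_self i) hx
    rw [enorm_mul, ENNReal.mul_rpow_of_nonneg _ _ hp0.le]
    gcongr
    rw [Real.enorm_of_nonneg (by positivity), ← ENNReal.ofReal_rpow_of_pos hpos,
      ← ENNReal.rpow_mul, hardyWeight, neg_mul, ENNReal.rpow_neg, ENNReal.rpow_neg]
    refine ENNReal.inv_le_inv' (ENNReal.rpow_le_rpow ?_ (by positivity))
    exact ENNReal.ofReal_le_ofReal (infDist_edge_le hx)
  · obtain ⟨C, hC, hH⟩ := exists_lintegral_weight_le_of_one_lt s p hs0 hs1 hp hsp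
    refine ⟨C, hC, fun i f hf h => ?_⟩
    refine (hH i f hf ?_).trans (mul_le_mul_right (le_add_self.trans (hsob h)) _)
    have := h.2.1 0 (by
      have : 1 / p < s := (div_lt_iff₀ hp0).2 hsp
      simp only [Prod.fst_zero, Prod.snd_zero, add_zero, Nat.cast_zero]; linarith) i
      (Finset.mem_singleton_self i)
    simp only [Prod.fst_zero, Prod.snd_zero, add_zero, Nat.cast_zero, sub_zero] at this
    exact this.congr h.1.weakDeriv_zero_ae

lemma MemEdge.congr {E : Finset (Fin 2)} {s p : ℝ} {f f' : Plane → ℝ} (h : MemEdge E s p f)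
    (hf : f =ᵐ[volume.restrict tri] f') : MemEdge E s p f' := by
  refine ⟨h.1.congr hf, fun β hβ i hi => ?_, ?_⟩
  · rw [← weakDeriv_congr hf]
    exact h.2.1 β hβ i hi
  · rw [edgeNorm, ← edgePow_congr E s p hf]
    exact h.2.2

theorem exists_eLpNorm_rpow_baryCoord_le (s p : ℝ) (hs : 0 ≤ s) (hs1 : s < 1) (hp : 1 < p) :
    ∃ C : ℝ≥0, ∀ (i : Fin 2) (f : Plane → ℝ), MemEdge {i} s p f →
      MemLp (fun x => baryCoord i x ^ (-s) * f x) (ENNReal.ofReal p) triMeasure ∧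
      eLpNorm (fun x => baryCoord i x ^ (-s) * f x) (ENNReal.ofReal p) triMeasure ≤
        C * edgeNorm {i} s p f := by
  have hp0 : 0 < p := by linarith
  obtain ⟨C, hC, hH⟩ := exists_lintegral_weight_le_edgePow s p hs hs1 hp
  refine ⟨(C ^ (1 / p)).toNNReal, fun i f h => ?_⟩
  rw [ENNReal.coe_toNNReal (by finiteness)]
  obtain ⟨f', hf', -, he⟩ := (h.1.2.1 0 (by simp)).elim fun g hg =>
    (isWeakDeriv_zero hg.1).exists_measurable
  have hb : lpPow p (fun x => baryCoord i x ^ (-s) * f x) ≤ C * edgePow {i} s p f := by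
    rw [lpPow_weight_congr (fun x => baryCoord i x ^ (-s)) he, edgePow_congr _ _ _ he]
    refine le_trans (setLIntegral_mono' measurableSet_tri fun x hx => ?_) (hH i f' hf' (h.congr he))
    have hxi := coord_pos hx i
    rw [enorm_mul, ENNReal.mul_rpow_of_nonneg _ _ hp0.le, baryCoord,
      min_eq_left (coord_lt_one hx i).le, Real.enorm_of_nonneg (by positivity),
      ← ENNReal.ofReal_rpow_of_pos hxi, ← ENNReal.rpow_mul, hardyWeight, neg_mul]
  have hn : eLpNorm (fun x => baryCoord i x ^ (-s) * f x) (ENNReal.ofReal p) triMeasure ≤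
      C ^ (1 / p) * edgeNorm {i} s p f := by
    rw [eLpNorm_eq_lpPow hp0, edgeNorm, ← ENNReal.mul_rpow_of_nonneg _ _ (by positivity)]
    exact ENNReal.rpow_le_rpow hb (by positivity)
  refine ⟨⟨?_, hn.trans_lt (ENNReal.mul_lt_top (by finiteness) h.2.2)⟩, hn⟩
  refine AEStronglyMeasurable.mul ?_ h.1.1.1
  have : Measurable (baryCoord i) := by unfold baryCoord; fun_prop
  exact (this.pow_const _).aestronglyMeasurable

end TriHardy

end

theorem mainTheorem7 (p : ℝ) (hp : 1 < p) :
    (∀ s : ℝ, 0 ≤ s → ∃ C : ℝ≥0, ∀ (E : Finset (Fin 2)) (i : Fin 2), i ∈ E →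
      (∀ f : TriHardy.Plane → ℝ, TriHardy.MemSobolev (s + 1) p f → TriHardy.MemEdge E 1 p f →
        TriHardy.MemSobolev s p (fun x => (TriHardy.baryCoord i x)⁻¹ * f x) ∧
        TriHardy.sobolevNorm s p (fun x => (TriHardy.baryCoord i x)⁻¹ * f x) ≤
          C * TriHardy.sobolevNorm (s + 1) p f ∧
        TriHardy.sobolevNorm s p (fun x => (TriHardy.baryCoord i x)⁻¹ * f x) ≤
          C * TriHardy.sobolevNorm s p (TriHardy.weakDeriv (TriHardy.unitIndex i) f)) ∧
      (∀ f : TriHardy.Plane → ℝ, TriHardy.MemEdge E (s + 1) p f →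
        TriHardy.MemEdge E s p (fun x => (TriHardy.baryCoord i x)⁻¹ * f x) ∧
        TriHardy.edgeNorm E s p (fun x => (TriHardy.baryCoord i x)⁻¹ * f x) ≤
          C * TriHardy.edgeNorm E (s + 1) p f ∧
        TriHardy.edgeNorm E s p (fun x => (TriHardy.baryCoord i x)⁻¹ * f x) ≤
          C * TriHardy.edgeNorm E s p (TriHardy.weakDeriv (TriHardy.unitIndex i) f))) ∧
    (∀ s : ℝ, 0 ≤ s → s < 1 → ∃ C : ℝ≥0, ∀ (i : Fin 2) (f : TriHardy.Plane → ℝ),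
      TriHardy.MemEdge {i} s p f →
        MemLp (fun x => TriHardy.baryCoord i x ^ (-s) * f x) (ENNReal.ofReal p)
          TriHardy.triMeasure ∧
        eLpNorm (fun x => TriHardy.baryCoord i x ^ (-s) * f x) (ENNReal.ofReal p)
          TriHardy.triMeasure ≤ C * TriHardy.edgeNorm {i} s p f) := by
  refine ⟨fun s hs => ?_, fun s hs hs1 =>
    TriHardy.exists_eLpNorm_rpow_baryCoord_le s p hs hs1 hp⟩
  obtain ⟨C, hC⟩ := TriHardy.exists_sobolevNorm_div_baryCoord_le s p hp hs
  obtain ⟨D, hD⟩ := TriHardy.exists_edgeNorm_div_baryCoord_le s p hp hs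
  have hCD : (C : ℝ≥0∞) ≤ ((C + D : ℝ≥0) : ℝ≥0∞) := by
    exact_mod_cast (le_self_add : C ≤ C + D)
  have hDC : (D : ℝ≥0∞) ≤ ((C + D : ℝ≥0) : ℝ≥0∞) := by
    exact_mod_cast (le_add_self : D ≤ C + D)
  refine ⟨C + D, fun E i hi => ⟨fun f hf hE => ?_, fun f hf => ?_⟩⟩
  · obtain ⟨h1, h2, h3⟩ := hC i f hf (hE.hasTrace_one hp le_rfl hi)
    exact ⟨h1, h2.trans (mul_le_mul_left hCD _), h3.trans (mul_le_mul_left hCD _)⟩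
  · obtain ⟨h2, h3⟩ := hD E i hi f hf
    exact ⟨hf.div_baryCoord hp hs hi, h2.trans (mul_le_mul_left hDC _),
      h3.trans (mul_le_mul_left hDC _)⟩
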